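/- **Biracks.** Let $X$ be a set and let $B=(B_1,B_2):X\times X\to X\times X$. Then $(X,B)$ is a *birack* if $B$ is a bijection; there is a unique map $S:X\times X\to X\times X$ with $S(B_1(x,y),x)=(B_2(x,y),y)$ for all $x,y$, and $S$ is a bijection; the four maps $x\mapsto S_i(x,x)$, $x\mapsto (S^{-1})_i(x,x)$ ($i=1,2$) are bijections; and $B$ satisfies the set-theoretic Yang–Baxter equation $(B\times\mathrm{Id})(\mathrm{Id}\times B)(B\times\mathrm{Id})=(\mathrm{Id}\times B)(B\times\mathrm{Id})(\mathrm{Id}\times B)$. Put $\alpha=(x\mapsto (S^{-1})_2(x,x))^{-1}$ and $\pi(x)=(S^{-1})_1(\alpha(x),\alpha(x))$ (the kink map). The *rank* $N$ is the order of the permutation $\pi$ ($N=0$ if the order is infinite; for finite $X$ it is positive). A homomorphism is a map commuting with $B_1$ and $B_2$; a subbirack is a subset closed under the components of $B$ and $S$; $\mathrm{Im}(f)$ is the subbirack generated by the values of the homomorphism $f$. **Diagrams.** Oriented link diagrams with $c$ ordered components are either classical or virtual; virtual crossings are ignored, i.e. diagrams are signed Gauss codes (in which crossingless components are allowed), and the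 classical ones are those of genus $0$. Semiarcs are the portions between consecutive passages through crossings, and the crossingless components. The *blackboard-framed moves* are: removal or insertion of two successive kinks of opposite sign on a strand, and all oriented type II and type III Reidemeister moves. The *unframed moves* are all oriented Reidemeister moves of types I, II, III. In the classical case all diagrams involved in a sequence of moves are classical. The diagrams up to unframed moves are the oriented links. The writhe $w_k$ of the $k$-th component is the sum of the signs of its self-crossings. A *labeling* of a diagram $D$ by $X$ assigns to each semiarc an element of $X$ so that $B(x,y)=(z,w)$ holds at each crossing, where at a positive crossing $x,y$ are the incoming over- and under-labels and $z,w$ the outgoing under- and over-labels, and at a negative crossing $x,y$ are the outgoing over- and under-labels and $z,w$ the incoming under- and over-labels. The fundamental birack $BR(D)$ is the birack generated by the semiarcs of $D$ with these crossing relations. **Theorem.** Let $(X,B)$ be a birack of rank $N$. In the classical as well as in the virtual setting, for all diagrams with $c$ ordered components: 1. Restriction to the generators is a bijection from $\mathrm{Hom}(BR(D),X)$ to the set of labelings of $D$ by $X$. 2. If $D$ and $D'$ are related by blackboard-framed moves, then there is a bijection between their sets of labelings by $X$. 3. If $D$ and $D'$ represent the same unframed link and $w_k(D)\equiv w_k(D')\pmod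 N$ for every component $k$, then there is a bijection between their sets of labelings by $X$. (So the number of labelings is $N$-periodic in the writhe of each component.) 4. Every unframed link has a diagram with any given writhe vector in $\mathbb Z^c$. 5. Let $X$ be finite and $W=(\mathbb Z/N)^c$. For a link $L$ choose, for every $\mathbf w\in W$, a diagram of $L$ with writhe vector $\mathbf w$ modulo $N$ (this is possible), and let $BR(L,\mathbf w)$ be its fundamental birack. Then each of the following depends only on the link $L$, and not on the choices: - $\sum_{\mathbf w\in W}|\mathrm{Hom}(BR(L,\mathbf w),X)|$; - the multiset $\{(|\mathrm{Hom}(BR(L,\mathbf w),X)|,\mathbf w):\mathbf w\in W\}$ and the polynomial $\sum_{\mathbf w\in W}|\mathrm{Hom}(BR(L,\mathbf w),X)|\prod_i q_i^{w_i}$, with exponents $0\le w_i<N$; - the multiset $\{|\mathrm{Im}(f)|: f\in\mathrm{Hom}(BR(L,\mathbf w),X),\ \mathbf w\in W\}$ and the polynomial $\sum_{\mathbf w\in W}\sum_f z^{|\mathrm{Im}(f)|}$; - the multiset $\{\rho_{\mathrm{Im}(f)}: f\in\mathrm{Hom}(BR(L,\mathbf w),X),\ \mathbf w\in W\}$ and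 the formal sum $\sum_{\mathbf w\in W}\sum_f z^{\rho_{\mathrm{Im}(f)}}$, where $\rho_Y=\sum_{y\in Y}s_1^{c_1(y)}s_2^{c_2(y)}t_1^{r_1(y)}t_2^{r_2(y)}$, $r_1(x)=|\{y:B_1(y,x)=x\}|$, $r_2(x)=|\{y:B_2(x,y)=x\}|$, and either $c_1(x)=|\{y:B_1(y,x)=y\}|$ and $c_2(x)=|\{y:B_2(x,y)=y\}|$, or $c_1(x)=|\{y:B_1(x,y)=y\}|$ and $c_2(x)=|\{y:B_2(y,x)=y\}|$. If the components of $L$ are reordered by a permutation $\sigma$ of the indices, these invariants do not change, except that in the second item the vectors $\mathbf w$ are permuted accordingly and $q_i$ is replaced by $q_{\sigma(i)}$. -/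

import Mathlib

universe u v

namespace BirackLinks

/-! ## Biracks -/

/-- The map `B × Id` on triples. -/
def timesId {X : Type u} (B : X × X → X × X) (t : X × X × X) : X × X × X :=
  ((B (t.1, t.2.1)).1, (B (t.1, t.2.1)).2, t.2.2)

/-- The map `Id × B` on triples. -/
def idTimes {X : Type u} (B : X × X → X × X) (t : X × X × X) : X × X × X :=
  (t.1, B t.2)

/-- A birack structure on `X`: a strongly invertible solution `B` of the set-theoretic Yang-Baxter
equation. The sideways map `S` is recorded as a field; it is determined by `B`, being the only map
which satisfies the sideways identity. -/
structure Birack (X : Type u) where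
  /-- the (invertible) birack map -/
  B : Equiv.Perm (X × X)
  /-- the (invertible) sideways map -/
  S : Equiv.Perm (X × X)
  sideways : ∀ x y : X, S ((B (x, y)).1, x) = ((B (x, y)).2, y)
  sideways_unique : ∀ T : X × X → X × X,
    (∀ x y : X, T ((B (x, y)).1, x) = ((B (x, y)).2, y)) → T = S
  diag_S_fst : Function.Bijective fun x : X => (S (x, x)).1
  diag_S_snd : Function.Bijective fun x : X => (S (x, x)).2
  diag_Sinv_fst : Function.Bijective fun x : X => (S.symm (x, x)).1
  diag_Sinv_snd : Function.Bijective fun x : X => (S.symm (x, x)).2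
  yang_baxter : timesId B ∘ idTimes B ∘ timesId B = idTimes B ∘ timesId B ∘ idTimes B

namespace Birack

/-- The bijection `α = (S₂⁻¹ ∘ Δ)⁻¹`. -/
noncomputable def alpha {X : Type u} (𝓑 : Birack X) : Equiv.Perm X :=
  (Equiv.ofBijective _ 𝓑.diag_Sinv_snd).symm

/-- The kink map `π = S₁⁻¹ ∘ Δ ∘ (S₂⁻¹ ∘ Δ)⁻¹`. -/
noncomputable def kink {X : Type u} (𝓑 : Birack X) : Equiv.Perm X :=
  𝓑.alpha.trans (Equiv.ofBijective _ 𝓑.diag_Sinv_fst)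

/-- The birack rank: the smallest positive `N` with `π ^ N = 1` (and `0` if there is none, which
cannot happen when `X` is finite). -/
noncomputable def rank {X : Type u} (𝓑 : Birack X) : ℕ := orderOf 𝓑.kink

instance instNeZeroRank {X : Type u} [Finite X] (𝓑 : Birack X) : NeZero 𝓑.rank :=
  ⟨(orderOf_pos 𝓑.kink).ne'⟩

/-- `Y` is a subbirack: closed under the components of `B` and `S`. -/
def IsSubbirack {X : Type u} (𝓑 : Birack X) (Y : Set X) : Prop :=
  ∀ x ∈ Y, ∀ y ∈ Y, (𝓑.B (x, y)).1 ∈ Y ∧ (𝓑.B (x, y)).2 ∈ Y ∧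
    (𝓑.S (x, y)).1 ∈ Y ∧ (𝓑.S (x, y)).2 ∈ Y

/-- The subbirack generated by a set. -/
def generated {X : Type u} (𝓑 : Birack X) (A : Set X) : Set X :=
  ⋂₀ {Y | 𝓑.IsSubbirack Y ∧ A ⊆ Y}

/-- Birack homomorphisms. -/
@[ext] structure Hom {X : Type u} {Y : Type v} (𝓑 : Birack X) (𝓒 : Birack Y) where
  toFun : X → Y
  map_fst : ∀ x y : X, toFun (𝓑.B (x, y)).1 = (𝓒.B (toFun x, toFun y)).1
  map_snd : ∀ x y : X, toFun (𝓑.B (x, y)).2 = (𝓒.B (toFun x, toFun y)).2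

/-- The image of a homomorphism: the subbirack generated by its values. -/
def Hom.image {X : Type u} {Y : Type v} {𝓑 : Birack X} {𝓒 : Birack Y} (h : Hom 𝓑 𝓒) : Set Y :=
  𝓒.generated (Set.range h.toFun)

end Birack

/-! ## Biracks given by generators and relations -/

/-- The names of the maps `B`, `B⁻¹`, `S`, `S⁻¹`. -/
inductive Op : Type
  | B | Binv | S | Sinv

/-- Exchanging a map with its inverse. -/
def Op.inv : Op → Op
  | .B => .Binv
  | .Binv => .B
  | .S => .Sinv
  | .Sinv => .S

/-- The sideways map and its inverse. -/
def sideOp : Bool → Op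
  | true => .S
  | false => .Sinv

/-- Birack words in the generators `G`: `fst o x y` and `snd o x y` stand for the two components of
the map `o` at `(x, y)`, and `diagFst b`, `diagSnd b` for the inverses of the diagonal maps
`x ↦ o₁(x, x)` and `x ↦ o₂(x, x)` with `o = S` (`b = true`) or `o = S⁻¹` (`b = false`). -/
inductive Word (G : Type) : Type
  | gen : G → Word G
  | fst : Op → Word G → Word G → Word G
  | snd : Op → Word G → Word G → Word G
  | diagFst : Bool → Word G → Word G
  | diagSnd : Bool → Word G → Word G

open Word in
/-- The congruence on birack words generated by the birack axioms and by the relations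
`B(x, y) = (z, w)` for `R x y z w`. -/
inductive WordRel {G : Type} (R : G → G → G → G → Prop) : Word G → Word G → Prop
  | refl (x) : WordRel R x x
  | symm {x y} : WordRel R x y → WordRel R y x
  | trans {x y z} : WordRel R x y → WordRel R y z → WordRel R x z
  | congr_fst (o : Op) {x x' y y'} :
      WordRel R x x' → WordRel R y y' → WordRel R (fst o x y) (fst o x' y')
  | congr_snd (o : Op) {x x' y y'} :
      WordRel R x x' → WordRel R y y' → WordRel R (snd o x y) (snd o x' y')
  | congr_diagFst (b : Bool) {x x'} : WordRel R x x' → WordRel R (diagFst b x) (diagFst b x')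
  | congr_diagSnd (b : Bool) {x x'} : WordRel R x x' → WordRel R (diagSnd b x) (diagSnd b x')
  | inv_fst (o : Op) (x y) : WordRel R (fst o (fst o.inv x y) (snd o.inv x y)) x
  | inv_snd (o : Op) (x y) : WordRel R (snd o (fst o.inv x y) (snd o.inv x y)) y
  | side_fst (x y) : WordRel R (fst .S (fst .B x y) x) (snd .B x y)
  | side_snd (x y) : WordRel R (snd .S (fst .B x y) x) y
  | side_fst' (u v) : WordRel R (fst .B v (snd .S u v)) u
  | side_snd' (u v) : WordRel R (snd .B v (snd .S u v)) (fst .S u v)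
  | diagFst_left (b : Bool) (x) : WordRel R (diagFst b (fst (sideOp b) x x)) x
  | diagFst_right (b : Bool) (x) : WordRel R (fst (sideOp b) (diagFst b x) (diagFst b x)) x
  | diagSnd_left (b : Bool) (x) : WordRel R (diagSnd b (snd (sideOp b) x x)) x
  | diagSnd_right (b : Bool) (x) : WordRel R (snd (sideOp b) (diagSnd b x) (diagSnd b x)) x
  | yb_one (x y z) :
      WordRel R (fst .B x (fst .B y z)) (fst .B (fst .B x y) (fst .B (snd .B x y) z))
  | yb_two (x y z) :
      WordRel R (fst .B (snd .B x (fst .B y z)) (snd .B y z))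
        (snd .B (fst .B x y) (fst .B (snd .B x y) z))
  | yb_three (x y z) :
      WordRel R (snd .B (snd .B x (fst .B y z)) (snd .B y z)) (snd .B (snd .B x y) z)
  | rel_fst {x y z w : G} : R x y z w → WordRel R (fst .B (gen x) (gen y)) (gen z)
  | rel_snd {x y z w : G} : R x y z w → WordRel R (snd .B (gen x) (gen y)) (gen w)

/-- The setoid of the congruence. -/
def wordSetoid {G : Type} (R : G → G → G → G → Prop) : Setoid (Word G) where
  r := WordRel R
  iseqv := ⟨.refl, .symm, .trans⟩

/-- The underlying set of the birack `⟨G | R⟩`. -/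
def Presented {G : Type} (R : G → G → G → G → Prop) : Type := Quotient (wordSetoid R)

namespace Presented

/-- The class of a word. -/
def mk {G : Type} (R : G → G → G → G → Prop) (x : Word G) : Presented R :=
  Quotient.mk (wordSetoid R) x

theorem mk_eq {G : Type} {R : G → G → G → G → Prop} {x y : Word G} (h : WordRel R x y) :
    mk R x = mk R y := Quotient.sound h

theorem ind_mk {G : Type} {R : G → G → G → G → Prop} {p : Presented R → Prop}
    (h : ∀ x, p (mk R x)) (q : Presented R) : p q := Quotient.ind h q

/-- The map named by `o` on `⟨G | R⟩`. -/
def opMap {G : Type} (R : G → G → G → G → Prop) (o : Op) (t : Presented R × Presented R) :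
    Presented R × Presented R :=
  (Quotient.map₂ (sa := wordSetoid R) (sb := wordSetoid R) (sc := wordSetoid R)
      (Word.fst o) (fun _ _ h _ _ h' => WordRel.congr_fst o h h') t.1 t.2,
   Quotient.map₂ (sa := wordSetoid R) (sb := wordSetoid R) (sc := wordSetoid R)
      (Word.snd o) (fun _ _ h _ _ h' => WordRel.congr_snd o h h') t.1 t.2)

theorem opMap_mk {G : Type} {R : G → G → G → G → Prop} (o : Op) (x y : Word G) :
    opMap R o (mk R x, mk R y) = (mk R (Word.fst o x y), mk R (Word.snd o x y)) := rfl

theorem opMap_inv {G : Type} {R : G → G → G → G → Prop} (o : Op)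
    (t : Presented R × Presented R) : opMap R o (opMap R o.inv t) = t := by
  obtain ⟨a, b⟩ := t
  induction a using ind_mk with | h x => ?_
  induction b using ind_mk with | h y => ?_
  simp only [opMap_mk]
  exact Prod.ext (mk_eq (.inv_fst o x y)) (mk_eq (.inv_snd o x y))

theorem opMap_inv' {G : Type} {R : G → G → G → G → Prop} (o : Op)
    (t : Presented R × Presented R) : opMap R o.inv (opMap R o t) = t := by
  cases o <;> exact opMap_inv (Op.inv _) t

/-- The map named by `o`, as a permutation. -/
def opPerm {G : Type} (R : G → G → G → G → Prop) (o : Op) :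
    Equiv.Perm (Presented R × Presented R) where
  toFun := opMap R o
  invFun := opMap R o.inv
  left_inv := opMap_inv' o
  right_inv := opMap_inv o

theorem bijective_diagFst {G : Type} (R : G → G → G → G → Prop) (b : Bool) :
    Function.Bijective fun x : Presented R => (opMap R (sideOp b) (x, x)).1 := by
  refine Function.bijective_iff_has_inverse.2
    ⟨Quotient.map (sa := wordSetoid R) (sb := wordSetoid R) (Word.diagFst b)
      (fun _ _ h => WordRel.congr_diagFst b h), fun q => ?_, fun q => ?_⟩
  · induction q using ind_mk with | h x => exact mk_eq (.diagFst_left b x)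
  · induction q using ind_mk with | h x => exact mk_eq (.diagFst_right b x)

theorem bijective_diagSnd {G : Type} (R : G → G → G → G → Prop) (b : Bool) :
    Function.Bijective fun x : Presented R => (opMap R (sideOp b) (x, x)).2 := by
  refine Function.bijective_iff_has_inverse.2
    ⟨Quotient.map (sa := wordSetoid R) (sb := wordSetoid R) (Word.diagSnd b)
      (fun _ _ h => WordRel.congr_diagSnd b h), fun q => ?_, fun q => ?_⟩
  · induction q using ind_mk with | h x => exact mk_eq (.diagSnd_left b x)
  · induction q using ind_mk with | h x => exact mk_eq (.diagSnd_right b x)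

/-- The birack `⟨G | R⟩`. -/
def birack {G : Type} (R : G → G → G → G → Prop) : Birack (Presented R) where
  B := opPerm R .B
  S := opPerm R .S
  sideways a b := by
    induction a using ind_mk with | h x => ?_
    induction b using ind_mk with | h y => ?_
    exact Prod.ext (mk_eq (.side_fst x y)) (mk_eq (.side_snd x y))
  sideways_unique T hT := by
    funext t
    obtain ⟨a, b⟩ := t
    induction a using ind_mk with | h u => ?_
    induction b using ind_mk with | h v => ?_
    have h := hT (mk R v) (mk R (Word.snd .S u v))
    have e : (opPerm R .B (mk R v, mk R (Word.snd .S u v))).1 = mk R u := mk_eq (.side_fst' u v)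
    have e' : (opPerm R .B (mk R v, mk R (Word.snd .S u v))).2 = mk R (Word.fst .S u v) :=
      mk_eq (.side_snd' u v)
    rw [e, e'] at h
    exact h
  diag_S_fst := bijective_diagFst R true
  diag_S_snd := bijective_diagSnd R true
  diag_Sinv_fst := bijective_diagFst R false
  diag_Sinv_snd := bijective_diagSnd R false
  yang_baxter := by
    funext t
    obtain ⟨a, b, c⟩ := t
    induction a using ind_mk with | h x => ?_
    induction b using ind_mk with | h y => ?_
    induction c using ind_mk with | h z => ?_
    exact Prod.ext (mk_eq (.symm (.yb_one x y z)))
      (Prod.ext (mk_eq (.symm (.yb_two x y z))) (mk_eq (.symm (.yb_three x y z))))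

/-- A homomorphism out of `⟨G | R⟩` is determined by its values on the generators. -/
theorem hom_ext {G : Type} {R : G → G → G → G → Prop} {X : Type u} {𝓑 : Birack X}
    {h h' : Birack.Hom (birack R) 𝓑}
    (hg : ∀ g, h.toFun (mk R (.gen g)) = h'.toFun (mk R (.gen g))) : h = h' := by
  let P : Op → Equiv.Perm (X × X) := fun o =>
    match o with
    | .B => 𝓑.B
    | .Binv => 𝓑.B.symm
    | .S => 𝓑.S
    | .Sinv => 𝓑.S.symm
  have hPB : ∀ k : Birack.Hom (birack R) 𝓑, ∀ a b, 𝓑.B (k.toFun a, k.toFun b) =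
      (k.toFun (opMap R .B (a, b)).1, k.toFun (opMap R .B (a, b)).2) := fun k a b =>
    Prod.ext (k.map_fst a b).symm (k.map_snd a b).symm
  have hPS : ∀ k : Birack.Hom (birack R) 𝓑, ∀ a b, 𝓑.S (k.toFun a, k.toFun b) =
      (k.toFun (opMap R .S (a, b)).1, k.toFun (opMap R .S (a, b)).2) := by
    intro k a b
    induction a using ind_mk with | h u => ?_
    induction b using ind_mk with | h v => ?_
    have e := hPB k (mk R v) (mk R (Word.snd .S u v))
    have e1 : (opMap R .B (mk R v, mk R (Word.snd .S u v))).1 = mk R u := mk_eq (.side_fst' u v)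
    have e2 : (opMap R .B (mk R v, mk R (Word.snd .S u v))).2 = mk R (Word.fst .S u v) :=
      mk_eq (.side_snd' u v)
    have s := 𝓑.sideways (k.toFun (mk R v)) (k.toFun (mk R (Word.snd .S u v)))
    rw [e, e1, e2] at s
    exact s
  have hP : ∀ k : Birack.Hom (birack R) 𝓑, ∀ o a b, P o (k.toFun a, k.toFun b) =
      (k.toFun (opMap R o (a, b)).1, k.toFun (opMap R o (a, b)).2) := by
    intro k o a b
    cases o with
    | B => exact hPB k a b
    | S => exact hPS k a b
    | Binv =>
      refine (Equiv.symm_apply_eq _).2 ?_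
      rw [hPB]
      have e := opMap_inv (R := R) .B (a, b)
      exact (Prod.ext (congrArg (fun t => k.toFun t.1) e)
        (congrArg (fun t => k.toFun t.2) e)).symm
    | Sinv =>
      refine (Equiv.symm_apply_eq _).2 ?_
      rw [hPS]
      have e := opMap_inv (R := R) .S (a, b)
      exact (Prod.ext (congrArg (fun t => k.toFun t.1) e)
        (congrArg (fun t => k.toFun t.2) e)).symm
  have key : ∀ x : Word G, h.toFun (mk R x) = h'.toFun (mk R x) := by
    intro x
    induction x with
    | gen g => exact hg g
    | fst o x y ihx ihy =>
      have e := hP h o (mk R x) (mk R y)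
      rw [ihx, ihy, hP h' o (mk R x) (mk R y)] at e
      exact (congrArg Prod.fst e).symm
    | snd o x y ihx ihy =>
      have e := hP h o (mk R x) (mk R y)
      rw [ihx, ihy, hP h' o (mk R x) (mk R y)] at e
      exact (congrArg Prod.snd e).symm
    | diagFst b x ih =>
      have inj : Function.Injective fun a : X => (P (sideOp b) (a, a)).1 := by
        cases b
        · exact 𝓑.diag_Sinv_fst.1
        · exact 𝓑.diag_S_fst.1
      have e : (opMap R (sideOp b) (mk R (.diagFst b x), mk R (.diagFst b x))).1 = mk R x :=
        mk_eq (.diagFst_right b x)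
      apply inj
      simp only [hP, e, ih]
    | diagSnd b x ih =>
      have inj : Function.Injective fun a : X => (P (sideOp b) (a, a)).2 := by
        cases b
        · exact 𝓑.diag_Sinv_snd.1
        · exact 𝓑.diag_S_snd.1
      have e : (opMap R (sideOp b) (mk R (.diagSnd b x), mk R (.diagSnd b x))).2 = mk R x :=
        mk_eq (.diagSnd_right b x)
      apply inj
      simp only [hP, e, ih]
  exact Birack.Hom.ext (funext fun q => ind_mk (p := fun q => h.toFun q = h'.toFun q) key q)

instance instFiniteHom {G : Type} [Finite G] (R : G → G → G → G → Prop) {X : Type u} [Finite X]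
    (𝓑 : Birack X) : Finite (Birack.Hom (birack R) 𝓑) :=
  Finite.of_injective (fun h (g : G) => h.toFun (mk R (.gen g)))
    fun _ _ e => hom_ext fun g => congrFun e g

end Presented

/-! ## Oriented link diagrams -/

/-- The strand of a crossing which goes over. -/
abbrev ovr : Bool := true

/-- The strand of a crossing which goes under. -/
abbrev und : Bool := false

/-- An oriented virtual link diagram with `c` ordered components, as a signed Gauss code (virtual
crossings are ignored). Each crossing is passed twice, once on each strand; `next` sends a passage
to the passage that follows it along the oriented link, and `comp` gives the component. A component
without passages is a circle without crossings. -/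
structure LinkDiagram (c : ℕ) where
  /-- number of (classical) crossings -/
  n : ℕ
  sign : Fin n → ℤˣ
  next : Equiv.Perm (Fin n × Bool)
  comp : Fin n × Bool → Fin c
  comp_eq_iff : ∀ p q, comp p = comp q ↔ next.SameCycle p q

namespace LinkDiagram

variable {c : ℕ} (D : LinkDiagram c)

/-- Semiarcs: one leaving each passage, and one for each component without crossings. -/
abbrev Semiarc : Type := (Fin D.n × Bool) ⊕ {k : Fin c // ∀ p, D.comp p ≠ k}

/-- The semiarc which leaves a passage. -/
def outArc (p : Fin D.n × Bool) : D.Semiarc := .inl p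

/-- The semiarc which enters a passage. -/
def inArc (p : Fin D.n × Bool) : D.Semiarc := .inl (D.next.symm p)

/-- The semiarcs `(x, y)` at a crossing where the relation is `B(x, y) = (z, w)`:
both incoming (over, under) at a positive crossing; both outgoing (over, under) at a negative
crossing, where the map from the incoming to the outgoing labels is `B⁻¹`. -/
def source (v : Fin D.n) : D.Semiarc × D.Semiarc :=
  if D.sign v = 1 then (D.inArc (v, ovr), D.inArc (v, und))
  else (D.outArc (v, ovr), D.outArc (v, und))

/-- The semiarcs `(z, w)` at a crossing where the relation is `B(x, y) = (z, w)`: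
both outgoing (under, over) at a positive crossing; both incoming (under, over) at a negative
crossing. -/
def target (v : Fin D.n) : D.Semiarc × D.Semiarc :=
  if D.sign v = 1 then (D.outArc (v, und), D.outArc (v, ovr))
  else (D.inArc (v, und), D.inArc (v, ovr))

/-- Labelings of the semiarcs by elements of a birack, subject to the crossing relations. -/
def Labeling {X : Type u} (𝓑 : Birack X) : Type u :=
  {ℓ : D.Semiarc → X // ∀ v, 𝓑.B (ℓ (D.source v).1, ℓ (D.source v).2) =
    (ℓ (D.target v).1, ℓ (D.target v).2)}

/-- The crossing relations `B(x, y) = (z, w)`. -/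
def CrossingRel (x y z w : D.Semiarc) : Prop :=
  ∃ v, D.source v = (x, y) ∧ D.target v = (z, w)

/-- The fundamental birack `BR(D)`: generated by the semiarcs, with the crossing relations. -/
def fundamentalBirack : Birack (Presented D.CrossingRel) := Presented.birack D.CrossingRel

/-- `Hom(BR(D), X)`. -/
abbrev HomTo {X : Type u} (𝓑 : Birack X) : Type u := Birack.Hom D.fundamentalBirack 𝓑

/-- The labeling given by a homomorphism `BR(D) → X`. -/
def labelingOfHom {X : Type u} (𝓑 : Birack X) (h : D.HomTo 𝓑) : D.Labeling 𝓑 :=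
  ⟨fun s => h.toFun (Presented.mk _ (.gen s)), fun v => by
    have hr : D.CrossingRel (D.source v).1 (D.source v).2 (D.target v).1 (D.target v).2 :=
      ⟨v, rfl, rfl⟩
    refine Prod.ext ((h.map_fst _ _).symm.trans ?_) ((h.map_snd _ _).symm.trans ?_)
    · exact congrArg h.toFun (Presented.mk_eq (.rel_fst hr))
    · exact congrArg h.toFun (Presented.mk_eq (.rel_snd hr))⟩

/-- The writhe of a component: the sum of the signs of its self-crossings. -/
def writhe (k : Fin c) : ℤ :=
  ∑ v : Fin D.n, if D.comp (v, ovr) = k ∧ D.comp (v, und) = k then (D.sign v : ℤ) else 0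

/-- Reordering the components. -/
def relabel (σ : Equiv.Perm (Fin c)) : LinkDiagram c where
  n := D.n
  sign := D.sign
  next := D.next
  comp p := σ (D.comp p)
  comp_eq_iff p q := by rw [σ.injective.eq_iff, D.comp_eq_iff]

/-! ### Classical diagrams -/

/-- Ends of strands at the crossings: a passage, together with `true` for its outgoing end or
`false` for its incoming end. -/
abbrev Dart : Type := (Fin D.n × Bool) × Bool

/-- Each edge joins the outgoing end of a passage to the incoming end of the next one. -/
def edgeFlip : Equiv.Perm D.Dart where
  toFun d := if d.2 then (D.next d.1, false) else (D.next.symm d.1, true)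
  invFun d := if d.2 then (D.next d.1, false) else (D.next.symm d.1, true)
  left_inv := by rintro ⟨p, _ | _⟩ <;> simp
  right_inv := by rintro ⟨p, _ | _⟩ <;> simp

/-- The counterclockwise rotation of the four ends at each crossing: over-in, under-in, over-out,
under-out at a positive crossing and under-in, over-in, under-out, over-out at a negative one. -/
def rotation : Equiv.Perm D.Dart where
  toFun d := ((d.1.1, !d.1.2), if (d.1.2 = ovr ↔ D.sign d.1.1 = 1) then d.2 else !d.2)
  invFun d := ((d.1.1, !d.1.2), if (d.1.2 = ovr ↔ D.sign d.1.1 = 1) then !d.2 else d.2)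
  left_inv := by
    rintro ⟨⟨v, s⟩, d⟩
    by_cases h : D.sign v = 1 <;> cases s <;> simp [h]
  right_inv := by
    rintro ⟨⟨v, s⟩, d⟩
    by_cases h : D.sign v = 1 <;> cases s <;> simp [h]

/-- The faces of the surface carrying the diagram, as the orbits of a permutation of the ends. -/
abbrev Face : Type := Quotient (Equiv.Perm.SameCycle.setoid (D.rotation * D.edgeFlip))

/-- The connected pieces of the four-valent graph formed by the crossings. -/
abbrev Piece : Type := Quot fun v w : Fin D.n => ∃ s t, D.next (v, s) = (w, t)

/-- The diagram is classical, i.e. drawn on the sphere without virtual crossings: Euler's formula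
`V - E + F = 2C` with `V = n` and `E = 2n`. -/
def IsPlanar : Prop := Nat.card D.Face = D.n + 2 * Nat.card D.Piece

/-! ### Reidemeister moves -/

/-- `D` arises from `E` by deleting the crossings in `K` (up to renaming of crossings): the passage
following `p` in `D` is the first one following `p` in `E` which is not deleted. -/
def IsDeletion (E D : LinkDiagram c) (K : Set (Fin E.n)) : Prop :=
  ∃ i : Fin D.n → Fin E.n, Function.Injective i ∧ Set.range i = Kᶜ ∧
    (∀ v, E.sign (i v) = D.sign v) ∧
    (∀ v s, E.comp (i v, s) = D.comp (v, s)) ∧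
    ∀ v s, ∃ k : ℕ,
      (E.next ^ (k + 1)) (i v, s) = (i (D.next (v, s)).1, (D.next (v, s)).2) ∧
      ∀ j, 1 ≤ j → j ≤ k → ((E.next ^ j) (i v, s)).1 ∈ K

/-- The crossing `a` is a kink which is first passed on the strand `s`. -/
def IsKink (a : Fin D.n) (s : Bool) : Prop := D.next (a, s) = (a, !s)

/-- The unframed type I move (either sign, either order of passage). -/
def MoveI (E D : LinkDiagram c) : Prop :=
  ∃ a s, E.IsKink a s ∧ IsDeletion E D {a}

/-- The blackboard-framed type I move: two successive kinks of opposite sign are removed. -/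
def FramedMoveI (E D : LinkDiagram c) : Prop :=
  ∃ a b s t, a ≠ b ∧ E.sign b = -E.sign a ∧ E.IsKink a s ∧ E.next (a, !s) = (b, t) ∧
    E.IsKink b t ∧ IsDeletion E D {a, b}

/-- The type II moves, direct and reverse: a strand passing over another one at two crossings of
opposite sign, consecutive on both strands, is pulled away. -/
def MoveII (E D : LinkDiagram c) : Prop :=
  ∃ a b, a ≠ b ∧ E.sign b = -E.sign a ∧ E.next (a, ovr) = (b, ovr) ∧
    (E.next (a, und) = (b, und) ∨ E.next (b, und) = (a, und)) ∧ IsDeletion E D {a, b}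

/-- `p` immediately precedes `q` if `ε = 1`, and immediately follows it if `ε = -1`. -/
def Precedes (ε : ℤˣ) (p q : Fin D.n × Bool) : Prop :=
  if ε = 1 then D.next p = q else D.next q = p

/-- The type III moves, in all orientations: `a`, `b`, `d` are the crossings of the top with the
middle, of the top with the bottom, and of the middle with the bottom strand of a triangle. The
orders in which they are met are those of three oriented lines in the plane, where `κ` tells on
which side of `a` the bottom line lies; the move reverses the order on each of the three strands. -/
def MoveIII (E D : LinkDiagram c) : Prop :=
  ∃ (a b d : Fin E.n) (κ : ℤˣ) (e : Fin E.n ≃ Fin D.n), a ≠ b ∧ a ≠ d ∧ b ≠ d ∧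
    E.Precedes (κ * E.sign b) (a, ovr) (b, ovr) ∧
    E.Precedes (κ * E.sign d) (a, und) (d, ovr) ∧
    E.Precedes (κ * E.sign a * E.sign b * E.sign d) (b, und) (d, und) ∧
    (∀ v, D.sign (e v) = E.sign v) ∧
    (∀ v s, D.comp (e v, s) = E.comp (v, s)) ∧
    let τ : Equiv.Perm (Fin E.n × Bool) := Equiv.swap (a, ovr) (b, ovr) *
      Equiv.swap (a, und) (d, ovr) * Equiv.swap (b, und) (d, und)
    ∀ p, D.next (Prod.map e id (τ p)) = Prod.map e id (τ (E.next p))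

/-- Blackboard-framed Reidemeister moves (and renaming of crossings). -/
def FramedMove (E D : LinkDiagram c) : Prop :=
  IsDeletion E D ∅ ∨ FramedMoveI E D ∨ MoveII E D ∨ MoveIII E D

/-- Unframed Reidemeister moves (and renaming of crossings). -/
def Move (E D : LinkDiagram c) : Prop :=
  IsDeletion E D ∅ ∨ MoveI E D ∨ MoveII E D ∨ MoveIII E D

end LinkDiagram

/-! ## Classical and virtual links -/

/-- The two settings. -/
inductive Kind : Type
  | classical | virtual

/-- The diagrams allowed in each setting. -/
def Kind.Allows {c : ℕ} : Kind → LinkDiagram c → Prop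
  | .classical, D => D.IsPlanar
  | .virtual, _ => True

/-- Classical, respectively virtual, oriented link diagrams with `c` components. -/
abbrev Diagram (𝓚 : Kind) (c : ℕ) : Type := {D : LinkDiagram c // 𝓚.Allows D}

/-- Blackboard-framed links: diagrams up to blackboard-framed isotopy. -/
def FramedLink (𝓚 : Kind) (c : ℕ) : Type :=
  Quot fun E D : Diagram 𝓚 c => LinkDiagram.FramedMove E.1 D.1

/-- Unframed oriented links with ordered components: diagrams up to Reidemeister moves. -/
def Link (𝓚 : Kind) (c : ℕ) : Type :=
  Quot fun E D : Diagram 𝓚 c => LinkDiagram.Move E.1 D.1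

/-- The blackboard-framed link of a diagram. -/
def Diagram.framedLink {𝓚 : Kind} {c : ℕ} (D : Diagram 𝓚 c) : FramedLink 𝓚 c := Quot.mk _ D

/-- The unframed link of a diagram. -/
def Diagram.link {𝓚 : Kind} {c : ℕ} (D : Diagram 𝓚 c) : Link 𝓚 c := Quot.mk _ D

/-- A full period of framings of the link `L`: for each `w` in `(ℤ/N)ᶜ` a diagram of `L` whose
writhe vector is `w` modulo `N`. -/
def IsPeriodOf {𝓚 : Kind} {c : ℕ} (N : ℕ) (L : Link 𝓚 c)
    (𝓓 : (Fin c → ZMod N) → Diagram 𝓚 c) : Prop :=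
  ∀ w, (𝓓 w).link = L ∧ ∀ k, ((𝓓 w).1.writhe k : ZMod N) = w k

/-! ## The counting invariants, computed from a full period of framings -/

/-- The two conventions for the numbers `c₁` and `c₂` in the birack polynomial. -/
inductive CountConvention : Type
  | fixing | trivialAction

section Invariants

variable {X : Type u} [Finite X] (𝓑 : Birack X) {𝓚 : Kind} {c : ℕ}

instance instFiniteHomTo (D : LinkDiagram c) : Finite (D.HomTo 𝓑) :=
  Presented.instFiniteHom D.CrossingRel 𝓑

noncomputable instance instFintypeHomTo (D : LinkDiagram c) : Fintype (D.HomTo 𝓑) :=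
  Fintype.ofFinite _

/-- `∑_w |Hom(BR(L, w), X)|`. -/
noncomputable def integralInvariant (𝓓 : (Fin c → ZMod 𝓑.rank) → Diagram 𝓚 c) : ℕ :=
  ∑ w, Nat.card ((𝓓 w).1.HomTo 𝓑)

/-- The multiset of the pairs `(|Hom(BR(L, w), X)|, w)`. -/
noncomputable def writheMultiset (𝓓 : (Fin c → ZMod 𝓑.rank) → Diagram 𝓚 c) :
    Multiset (ℕ × (Fin c → ZMod 𝓑.rank)) :=
  Finset.univ.val.map fun w => (Nat.card ((𝓓 w).1.HomTo 𝓑), w)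

/-- `∑_w |Hom(BR(L, w), X)| q^w`, with exponents `0 ≤ w_i < N`. -/
noncomputable def writhePolynomial (𝓓 : (Fin c → ZMod 𝓑.rank) → Diagram 𝓚 c) :
    MvPolynomial (Fin c) ℤ :=
  ∑ w, (Nat.card ((𝓓 w).1.HomTo 𝓑) : MvPolynomial (Fin c) ℤ) *
    ∏ i, MvPolynomial.X i ^ (w i).val

/-- The multiset of the `|Im f|`. -/
noncomputable def imageMultiset (𝓓 : (Fin c → ZMod 𝓑.rank) → Diagram 𝓚 c) : Multiset ℕ :=
  ∑ w, (Finset.univ : Finset ((𝓓 w).1.HomTo 𝓑)).val.map fun f => Nat.card f.image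

/-- `∑_w ∑_f z^|Im f|`. -/
noncomputable def imagePolynomial (𝓓 : (Fin c → ZMod 𝓑.rank) → Diagram 𝓚 c) : Polynomial ℤ :=
  ∑ w, ∑ f : (𝓓 w).1.HomTo 𝓑, Polynomial.X ^ Nat.card f.image

/-- The number `c₁(x)`, under two conventions: the number of `y` with `B₁(y, x) = y`, or the number
of `y` on which `x` acts trivially, `B₁(x, y) = y`. -/
noncomputable def cOne (𝓒 : CountConvention) (x : X) : ℕ :=
  match 𝓒 with
  | .fixing => Nat.card {y : X // (𝓑.B (y, x)).1 = y}
  | .trivialAction => Nat.card {y : X // (𝓑.B (x, y)).1 = y}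

/-- The number `c₂(x)`, under two conventions: the number of `y` with `B₂(x, y) = y`, or the number
of `y` on which `x` acts trivially, `B₂(y, x) = y`. -/
noncomputable def cTwo (𝓒 : CountConvention) (x : X) : ℕ :=
  match 𝓒 with
  | .fixing => Nat.card {y : X // (𝓑.B (x, y)).2 = y}
  | .trivialAction => Nat.card {y : X // (𝓑.B (y, x)).2 = y}

/-- The number `r₁(x)` of `y` with `B₁(y, x) = x`. -/
noncomputable def rOne (x : X) : ℕ := Nat.card {y : X // (𝓑.B (y, x)).1 = x}

/-- The number `r₂(x)` of `y` with `B₂(x, y) = x`. -/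
noncomputable def rTwo (x : X) : ℕ := Nat.card {y : X // (𝓑.B (x, y)).2 = x}

/-- The subbirack polynomial `ρ_{Y ⊂ X} = ∑_{y ∈ Y} s₁^c₁(y) s₂^c₂(y) t₁^r₁(y) t₂^r₂(y)` in the
variables `s₁, s₂, t₁, t₂`, numbered in this order. -/
noncomputable def subbirackPolynomial (𝓒 : CountConvention) (Y : Set X) :
    MvPolynomial (Fin 4) ℤ :=
  ∑ y ∈ (Set.toFinite Y).toFinset,
    MvPolynomial.X 0 ^ cOne 𝓑 𝓒 y * MvPolynomial.X 1 ^ cTwo 𝓑 𝓒 y *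
    MvPolynomial.X 2 ^ rOne 𝓑 y * MvPolynomial.X 3 ^ rTwo 𝓑 y

/-- The multiset of the subbirack polynomials `ρ_{Im f ⊂ X}`. -/
noncomputable def birackPolynomialMultiset (𝓒 : CountConvention)
    (𝓓 : (Fin c → ZMod 𝓑.rank) → Diagram 𝓚 c) :
    Multiset (MvPolynomial (Fin 4) ℤ) :=
  ∑ w, (Finset.univ : Finset ((𝓓 w).1.HomTo 𝓑)).val.map fun f =>
    subbirackPolynomial 𝓑 𝓒 f.image

/-- `∑_w ∑_f z^(ρ_{Im f ⊂ X})`, a formal sum of powers of `z` whose exponents are polynomials. -/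
noncomputable def birackPolynomialInvariant (𝓒 : CountConvention)
    (𝓓 : (Fin c → ZMod 𝓑.rank) → Diagram 𝓚 c) :
    AddMonoidAlgebra ℤ (MvPolynomial (Fin 4) ℤ) :=
  ∑ w, ∑ f : (𝓓 w).1.HomTo 𝓑, AddMonoidAlgebra.single (subbirackPolynomial 𝓑 𝓒 f.image) 1

end Invariants

end BirackLinks

open BirackLinks

/-!
Write `π` for the kink map. The labels of a strand change by `π` along a positive kink and by `π⁻¹`
along a negative one, whether the strand first passes over or under itself
(`Birack.CrossRel.kink`), and powers of `π` commute with the crossing relations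
(`Birack.cross_zpow_iff`). Both are consequences of the Yang-Baxter equation.

This suggests to consider *twisted* labelings, where the label of each semiarc may change by a given
power of `π` on its way. Since `π` slides through crossings, the twisted labelings only depend on
the sum of the twists along each component, up to bijection (`twisted_equiv_of_totalTwist_eq`).
Twists stand for kinks: call two diagrams equivalent if they have the same twisted labelings as soon
as the twists raise their writhes to the same vector (`SameTwisted`). All Reidemeister moves respect
this. A type I move replaces a kink by a twist, a type II move erases a tangle without holonomy, and
both are instances of the erasure of tangles which consist of strands with two passages
(`TwistData.labelEquiv`). For a type III move the twists are first pushed off the triangle, and then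
the boundary labels of the triangle determine the inner ones on both sides of the move, by the
Yang-Baxter equation and the invertibility of `B` and `S` (`Birack.Triangle.flip`).

Twists by multiples of the rank of the birack have no effect, so diagrams of the same link whose
writhes agree modulo the rank have equivalent labelings (`SameTwisted.labelEquiv`). All bijections
preserve the closed subsets of the birack which contain a labeling. In a finite birack the closed
subsets are the subbiracks, so the corresponding homomorphisms have the same image
(`LabelEquiv.exists_hom_equiv`).

Finally, a kink can be inserted on every component of a diagram. Counting the cycles of the face
permutation and the pieces of the diagram shows that it stays planar (`LinkDiagram.exists_kink`).
This gives diagrams with arbitrary writhes.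
-/

namespace BirackLinks

/-! ### Crossing relations and the kink map in a birack -/

namespace Birack

variable {X : Type u} (𝓑 : Birack X)

/-- The relation `B(x, y) = (z, w)` between the four labels around a crossing. -/
def Cross (x y z w : X) : Prop := 𝓑.B (x, y) = (z, w)

variable {𝓑}

theorem Cross.sideways {x y z w : X} (h : 𝓑.Cross x y z w) : 𝓑.S (z, x) = (w, y) := by
  have := 𝓑.sideways x y
  rwa [show 𝓑.B (x, y) = (z, w) from h] at this

variable (𝓑)

theorem exists_cross_down (x y : X) : ∃ z w, 𝓑.Cross x y z w := ⟨_, _, rfl⟩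

theorem exists_cross_up (z w : X) : ∃ x y, 𝓑.Cross x y z w :=
  ⟨(𝓑.B.symm (z, w)).1, (𝓑.B.symm (z, w)).2, 𝓑.B.apply_symm_apply (z, w)⟩

/-- The labels on the left of a crossing are arbitrary: otherwise the sideways identity would leave
some value of `S` undetermined. -/
theorem exists_cross_left (z x : X) : ∃ y w, 𝓑.Cross x y z w := by
  classical
  rcases subsingleton_or_nontrivial X with hX | hX
  · exact ⟨x, x, Subsingleton.elim _ _⟩
  by_contra! hno
  obtain ⟨t, ht⟩ := exists_ne (𝓑.S (z, x))
  have hT := 𝓑.sideways_unique (Function.update 𝓑.S (z, x) t) fun a b => by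
    rw [Function.update_of_ne, 𝓑.sideways]
    intro hab
    rw [Prod.mk.injEq] at hab
    exact hno b _ (Prod.ext (by rw [← hab.2]; exact hab.1) (by rw [← hab.2]))
  exact ht (by simpa using congrFun hT (z, x))

variable {𝓑}

theorem cross_iff_sideways {x y z w : X} : 𝓑.Cross x y z w ↔ 𝓑.S (z, x) = (w, y) := by
  refine ⟨Cross.sideways, fun h => ?_⟩
  obtain ⟨y', w', h'⟩ := 𝓑.exists_cross_left z x
  have e := h'.sideways.symm.trans h
  rw [Prod.mk.injEq] at e
  rwa [e.1, e.2] at h'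

variable (𝓑) in
theorem exists_cross_right (w y : X) : ∃ x z, 𝓑.Cross x y z w :=
  ⟨(𝓑.S.symm (w, y)).2, (𝓑.S.symm (w, y)).1,
    cross_iff_sideways.2 (𝓑.S.apply_symm_apply (w, y))⟩

theorem Cross.down_unique {x y z w z' w' : X} (h : 𝓑.Cross x y z w) (h' : 𝓑.Cross x y z' w') :
    z = z' ∧ w = w' := Prod.mk.inj (h.symm.trans h')

theorem Cross.up_unique {x y z w x' y' : X} (h : 𝓑.Cross x y z w) (h' : 𝓑.Cross x' y' z w) :
    x = x' ∧ y = y' := Prod.mk.inj (𝓑.B.injective (Eq.trans h h'.symm))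

theorem Cross.left_unique {x y z w y' w' : X} (h : 𝓑.Cross x y z w) (h' : 𝓑.Cross x y' z w') :
    y = y' ∧ w = w' := (Prod.mk.inj (h.sideways.symm.trans h'.sideways)).symm

theorem Cross.right_unique {x y z w x' z' : X} (h : 𝓑.Cross x y z w) (h' : 𝓑.Cross x' y z' w) :
    x = x' ∧ z = z' :=
  (Prod.mk.inj (𝓑.S.injective (Eq.trans h.sideways h'.sideways.symm))).symm

/-- The Yang-Baxter equation, read on the labels of a triangle of crossings. -/
theorem Cross.yang_baxter {x y z p q r z' x' y' s t u' : X}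
    (h₁ : 𝓑.Cross x y p q) (h₂ : 𝓑.Cross q z r z') (h₃ : 𝓑.Cross p r x' y')
    (k₁ : 𝓑.Cross y z s t) (k₂ : 𝓑.Cross x s u' q') : u' = x' ∧ 𝓑.Cross q' t y' z' := by
  have h := congrFun 𝓑.yang_baxter (x, y, z)
  simp only [Cross] at *
  simp only [Function.comp, timesId, idTimes, h₁, h₂, h₃, k₁, k₂, Prod.mk.injEq] at h
  exact ⟨h.1.symm, h.2.symm⟩

/-! #### The kink map -/

variable (𝓑) in
/-- The labels of a positive kink whose strand first passes over: `x` enters, `α x` is the label of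
the loop, and `π x` leaves. -/
theorem cross_kink (x : X) : 𝓑.Cross x (𝓑.alpha x) (𝓑.kink x) (𝓑.alpha x) := by
  rw [cross_iff_sideways, ← Equiv.eq_symm_apply]
  refine Prod.ext rfl ?_
  exact ((Equiv.ofBijective _ 𝓑.diag_Sinv_snd).apply_symm_apply x).symm

/-- In a positive kink whose strand first passes over, the label which enters determines the others.
-/
theorem Cross.kink {x y z : X} (h : 𝓑.Cross x y z y) : y = 𝓑.alpha x ∧ z = 𝓑.kink x := by
  have e : 𝓑.S.symm (y, y) = (z, x) := by rw [Equiv.symm_apply_eq, h.sideways]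
  have hy : y = 𝓑.alpha x := by
    rw [alpha, Equiv.eq_symm_apply, Equiv.ofBijective_apply, e]
  subst hy
  exact ⟨rfl, (h.right_unique (𝓑.cross_kink x)).2⟩

/-- A kink slides under a crossing. -/
theorem Cross.kink_right {x y z w : X} (h : 𝓑.Cross x y z w) :
    𝓑.Cross x (𝓑.kink y) (𝓑.kink z) w := by
  obtain ⟨z₁, w₁, h₁⟩ := 𝓑.exists_cross_down w (𝓑.alpha y)
  obtain ⟨z₂, w₂, h₂⟩ := 𝓑.exists_cross_down z z₁
  obtain ⟨z₃, w₃, h₃⟩ := 𝓑.exists_cross_down x (𝓑.kink y)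
  obtain ⟨rfl, h₄⟩ := h.yang_baxter h₁ h₂ (𝓑.cross_kink y) h₃
  obtain ⟨rfl, rfl⟩ := h₄.right_unique h₁
  rwa [h₂.kink.2] at h₃

/-- A kink slides over a crossing. -/
theorem Cross.kink_left {x y z w : X} (h : 𝓑.Cross x y z w) :
    𝓑.Cross (𝓑.kink x) y z (𝓑.kink w) := by
  obtain ⟨u, v, h₁⟩ := 𝓑.exists_cross_left y (𝓑.alpha x)
  obtain ⟨z₂, w₂, h₂⟩ := 𝓑.exists_cross_down (𝓑.kink x) y
  obtain ⟨rfl, h₄⟩ := (𝓑.cross_kink x).yang_baxter h₁ h₂ h₁ h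
  rwa [h₄.kink.2] at h₂

theorem cross_kink_left_iff {x y z w : X} :
    𝓑.Cross (𝓑.kink x) y z (𝓑.kink w) ↔ 𝓑.Cross x y z w := by
  refine ⟨fun h => ?_, Cross.kink_left⟩
  obtain ⟨z', w', h'⟩ := 𝓑.exists_cross_down x y
  obtain ⟨rfl, e⟩ := h.down_unique h'.kink_left
  rwa [𝓑.kink.injective e]

theorem cross_kink_right_iff {x y z w : X} :
    𝓑.Cross x (𝓑.kink y) (𝓑.kink z) w ↔ 𝓑.Cross x y z w := by
  refine ⟨fun h => ?_, Cross.kink_right⟩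
  obtain ⟨z', w', h'⟩ := 𝓑.exists_cross_down x y
  obtain ⟨e, rfl⟩ := h.down_unique h'.kink_right
  rwa [𝓑.kink.injective e]

/-- Powers of the kink map on the two strands of a crossing do not affect the crossing relation. -/
theorem cross_zpow_iff (i j : ℤ) {x y z w : X} :
    𝓑.Cross ((𝓑.kink ^ i) x) ((𝓑.kink ^ j) y) ((𝓑.kink ^ j) z) ((𝓑.kink ^ i) w) ↔
      𝓑.Cross x y z w := by
  have key (i : ℤ) (x y z w : X) :
      𝓑.Cross ((𝓑.kink ^ i) x) y z ((𝓑.kink ^ i) w) ↔ 𝓑.Cross x y z w := by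
    induction i generalizing x w with
    | zero => simp
    | succ n ih =>
      rw [zpow_add_one, Equiv.Perm.mul_apply, Equiv.Perm.mul_apply, ih, cross_kink_left_iff]
    | pred n ih =>
      rw [zpow_sub_one, Equiv.Perm.mul_apply, Equiv.Perm.mul_apply, ih, ← cross_kink_left_iff]
      simp
  have key' (i : ℤ) (x y z w : X) :
      𝓑.Cross x ((𝓑.kink ^ i) y) ((𝓑.kink ^ i) z) w ↔ 𝓑.Cross x y z w := by
    induction i generalizing y z with
    | zero => simp
    | succ n ih =>
      rw [zpow_add_one, Equiv.Perm.mul_apply, Equiv.Perm.mul_apply, ih, cross_kink_right_iff]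
    | pred n ih =>
      rw [zpow_sub_one, Equiv.Perm.mul_apply, Equiv.Perm.mul_apply, ih, ← cross_kink_right_iff]
      simp
  rw [key, key']

/-- A positive kink has the same holonomy, whether the strand first passes over or under itself.
This is the algebraic form of the Whitney trick. -/
theorem Cross.kink_under {b y w : X} (h : 𝓑.Cross b y b w) : w = 𝓑.kink y := by
  have e := h.kink_right.sideways.symm.trans (𝓑.cross_kink b).sideways
  rw [Prod.mk.injEq] at e
  exact e.1.trans e.2.symm

variable (𝓑) in
/-- The labels of a positive kink whose strand first passes under. -/
theorem exists_cross_under (y : X) : ∃ b, 𝓑.Cross b y b (𝓑.kink y) := by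
  obtain ⟨b, hb⟩ := 𝓑.diag_S_snd.2 y
  have h : 𝓑.Cross b y b (𝓑.S (b, b)).1 := cross_iff_sideways.2 (Prod.ext rfl hb)
  exact ⟨b, h.kink_under ▸ h⟩

theorem Cross.under_unique {b b' y w w' : X} (h : 𝓑.Cross b y b w) (h' : 𝓑.Cross b' y b' w') :
    b = b' := by
  refine 𝓑.diag_S_snd.1 ?_
  simp only [h.sideways, h'.sideways]

/-! ### Closed subsets -/

variable (𝓑) in
/-- A subset closed under all operations of a birack: any two neighbouring labels at a crossing
force the other two, and the labels outside a kink force the label of its loop. In a finite birack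
every subbirack is closed in this sense. -/
structure IsClosed (Y : Set X) : Prop where
  down {x y z w : X} : 𝓑.Cross x y z w → x ∈ Y → y ∈ Y → z ∈ Y ∧ w ∈ Y
  up {x y z w : X} : 𝓑.Cross x y z w → z ∈ Y → w ∈ Y → x ∈ Y ∧ y ∈ Y
  left {x y z w : X} : 𝓑.Cross x y z w → z ∈ Y → x ∈ Y → w ∈ Y ∧ y ∈ Y
  right {x y z w : X} : 𝓑.Cross x y z w → w ∈ Y → y ∈ Y → z ∈ Y ∧ x ∈ Y
  loop_over {x y z : X} : 𝓑.Cross x y z y → x ∈ Y ∨ z ∈ Y → y ∈ Y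
  loop_under {b y w : X} : 𝓑.Cross b y b w → y ∈ Y ∨ w ∈ Y → b ∈ Y

theorem IsClosed.kink_mem_iff {Y : Set X} (hY : 𝓑.IsClosed Y) (x : X) :
    𝓑.kink x ∈ Y ↔ x ∈ Y := by
  have h := 𝓑.cross_kink x
  refine ⟨fun hx => ?_, fun hx => ?_⟩
  · have := hY.loop_over h (.inr hx)
    exact (hY.right h this this).2
  · exact (hY.down h hx (hY.loop_over h (.inl hx))).1

theorem IsClosed.zpow_mem_iff {Y : Set X} (hY : 𝓑.IsClosed Y) (i : ℤ) (x : X) :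
    (𝓑.kink ^ i) x ∈ Y ↔ x ∈ Y := by
  induction i generalizing x with
  | zero => simp
  | succ n ih => rw [zpow_add_one, Equiv.Perm.mul_apply, ih, hY.kink_mem_iff]
  | pred n ih =>
    rw [zpow_sub_one, Equiv.Perm.mul_apply, ih, ← hY.kink_mem_iff]
    simp

/-- An injective self-map of a finite set is surjective on each invariant subset. -/
theorem mem_of_apply_mem {A : Type*} [Finite A] {Y : Set A} {f : A → A}
    (hf : Function.Injective f) (hY : ∀ a ∈ Y, f a ∈ Y) {a : A} (ha : f a ∈ Y) : a ∈ Y := by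
  have himg : f '' Y = Y := Set.eq_of_subset_of_ncard_le (Set.image_subset_iff.2 hY)
    (Set.ncard_image_of_injective Y hf).ge (Set.toFinite _)
  obtain ⟨b, hb, e⟩ : f a ∈ f '' Y := himg.symm ▸ ha
  exact hf e ▸ hb

/-- The inverses of the operations preserve finite subbiracks. -/
theorem IsSubbirack.isClosed [Finite X] {Y : Set X} (hY : 𝓑.IsSubbirack Y) : 𝓑.IsClosed Y := by
  have hB : ∀ t : X × X, t ∈ Y ×ˢ Y → 𝓑.B t ∈ Y ×ˢ Y := fun t ht =>
    ⟨(hY _ ht.1 _ ht.2).1, (hY _ ht.1 _ ht.2).2.1⟩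
  have hS : ∀ t : X × X, t ∈ Y ×ˢ Y → 𝓑.S t ∈ Y ×ˢ Y := fun t ht =>
    ⟨(hY _ ht.1 _ ht.2).2.2.1, (hY _ ht.1 _ ht.2).2.2.2⟩
  have hup : ∀ {x y z w : X}, 𝓑.Cross x y z w → z ∈ Y → w ∈ Y → x ∈ Y ∧ y ∈ Y :=
    fun {x y z w} h hz hw => mem_of_apply_mem (a := (x, y)) 𝓑.B.injective hB
      (by rw [show 𝓑.B (x, y) = (z, w) from h]; exact ⟨hz, hw⟩)
  have hright : ∀ {x y z w : X}, 𝓑.Cross x y z w → w ∈ Y → y ∈ Y → z ∈ Y ∧ x ∈ Y :=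
    fun {x y z w} h hw hy => mem_of_apply_mem (a := (z, x)) 𝓑.S.injective hS
      (by rw [h.sideways]; exact ⟨hw, hy⟩)
  have hleft : ∀ {x y z w : X}, 𝓑.Cross x y z w → z ∈ Y → x ∈ Y → w ∈ Y ∧ y ∈ Y :=
    fun {x y z w} h hz hx => by
      have := hS (z, x) ⟨hz, hx⟩
      rwa [h.sideways] at this
  refine ⟨fun {x y z w} h hx hy => ?_, hup, hleft, hright, fun {x y z} h hm => ?_,
    fun {b y w} h hm => ?_⟩
  · have := hB (x, y) ⟨hx, hy⟩
    rwa [show 𝓑.B (x, y) = (z, w) from h] at this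
  · have e : 𝓑.S.symm (y, y) = (z, x) := by rw [Equiv.symm_apply_eq, h.sideways]
    have hSi : ∀ a ∈ Y, (𝓑.S.symm (a, a)).1 ∈ Y ∧ (𝓑.S.symm (a, a)).2 ∈ Y := fun a ha =>
      mem_of_apply_mem (a := 𝓑.S.symm (a, a)) 𝓑.S.injective hS (by simpa using ha)
    rcases hm with hm | hm
    · exact mem_of_apply_mem 𝓑.diag_Sinv_snd.1 (fun a ha => (hSi a ha).2) (by simpa [e] using hm)
    · exact mem_of_apply_mem 𝓑.diag_Sinv_fst.1 (fun a ha => (hSi a ha).1) (by simpa [e] using hm)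
  · rcases hm with hm | hm
    · exact mem_of_apply_mem 𝓑.diag_S_snd.1 (fun a ha => (hS (a, a) ⟨ha, ha⟩).2)
        (by simpa [h.sideways] using hm)
    · exact mem_of_apply_mem 𝓑.diag_S_fst.1 (fun a ha => (hS (a, a) ⟨ha, ha⟩).1)
        (by simpa [h.sideways] using hm)

theorem IsClosed.isSubbirack {Y : Set X} (hY : 𝓑.IsClosed Y) : 𝓑.IsSubbirack Y := by
  intro x hx y hy
  obtain ⟨v, w, h⟩ := 𝓑.exists_cross_left x y
  have := hY.left h hx hy
  rw [h.sideways]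
  exact ⟨(hY.down (w := (𝓑.B (x, y)).2) rfl hx hy).1, (hY.down (z := (𝓑.B (x, y)).1) rfl hx hy).2,
    this.1, this.2⟩

end Birack

/-! ### The type III relation on labels -/

namespace Birack

variable {X : Type u} {𝓑 : Birack X}

/-! In a type III move three lines meet in pairs. Name the six crossings of the two sides of the
Yang-Baxter equation `a`, `b`, `d` and `a'`, `b'`, `d'`. In each orientation one side of the move
has one crossing out of each of the pairs `a, a'` and `b, b'` and `d, d'`, and the other side has
the remaining three. Each such triple of crossings forces the opposite triple. -/

variable {x y z p q r j h k s t l : X}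

theorem hexagon_abd (ha : 𝓑.Cross x y p q) (hb : 𝓑.Cross q z r k) (hd : 𝓑.Cross p r j h) :
    ∃ l t s, 𝓑.Cross l t h k ∧ 𝓑.Cross x s j l ∧ 𝓑.Cross y z s t := by
  obtain ⟨s, t, hd'⟩ := 𝓑.exists_cross_down y z
  obtain ⟨j', l, hb'⟩ := 𝓑.exists_cross_down x s
  obtain ⟨rfl, ha'⟩ := ha.yang_baxter hb hd hd' hb'
  exact ⟨l, t, s, ha', hb', hd'⟩

theorem hexagon_abd' (ha : 𝓑.Cross x y p q) (hb : 𝓑.Cross q z r k) (hd' : 𝓑.Cross y z s t) :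
    ∃ l h j, 𝓑.Cross l t h k ∧ 𝓑.Cross x s j l ∧ 𝓑.Cross p r j h := by
  obtain ⟨j, h, hd⟩ := 𝓑.exists_cross_down p r
  obtain ⟨j', l, hb'⟩ := 𝓑.exists_cross_down x s
  obtain ⟨rfl, ha'⟩ := ha.yang_baxter hb hd hd' hb'
  exact ⟨l, h, j', ha', hb', hd⟩

theorem hexagon_ab'd (ha : 𝓑.Cross x y p q) (hb' : 𝓑.Cross x s j l) (hd : 𝓑.Cross p r j h) :
    ∃ k t z, 𝓑.Cross l t h k ∧ 𝓑.Cross q z r k ∧ 𝓑.Cross y z s t := by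
  obtain ⟨z, k, hb⟩ := 𝓑.exists_cross_left r q
  obtain ⟨s', t, hd'⟩ := 𝓑.exists_cross_down y z
  obtain ⟨j', l', hb₂⟩ := 𝓑.exists_cross_down x s'
  obtain ⟨rfl, ha'⟩ := ha.yang_baxter hb hd hd' hb₂
  obtain ⟨rfl, rfl⟩ := hb'.left_unique hb₂
  exact ⟨k, t, z, ha', hb, hd'⟩

theorem hexagon_ab'd' (ha : 𝓑.Cross x y p q) (hb' : 𝓑.Cross x s j l) (hd' : 𝓑.Cross y z s t) :
    ∃ k h r, 𝓑.Cross l t h k ∧ 𝓑.Cross q z r k ∧ 𝓑.Cross p r j h := by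
  obtain ⟨r, k, hb⟩ := 𝓑.exists_cross_down q z
  obtain ⟨j', h, hd⟩ := 𝓑.exists_cross_down p r
  obtain ⟨rfl, ha'⟩ := ha.yang_baxter hb hd hd' hb'
  exact ⟨k, h, r, ha', hb, hd⟩

theorem hexagon_a'b'd' (ha' : 𝓑.Cross l t h k) (hb' : 𝓑.Cross x s j l) (hd' : 𝓑.Cross y z s t) :
    ∃ q p r, 𝓑.Cross x y p q ∧ 𝓑.Cross q z r k ∧ 𝓑.Cross p r j h := by
  obtain ⟨p, q, ha⟩ := 𝓑.exists_cross_down x y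
  obtain ⟨k', h', r, e, hb, hd⟩ := hexagon_ab'd' ha hb' hd'
  obtain ⟨rfl, rfl⟩ := ha'.down_unique e
  exact ⟨q, p, r, ha, hb, hd⟩

theorem hexagon_a'b'd (ha' : 𝓑.Cross l t h k) (hb' : 𝓑.Cross x s j l) (hd : 𝓑.Cross p r j h) :
    ∃ q y z, 𝓑.Cross x y p q ∧ 𝓑.Cross q z r k ∧ 𝓑.Cross y z s t := by
  obtain ⟨y, z, hd'⟩ := 𝓑.exists_cross_up s t
  obtain ⟨q, p', r', ha, hb, hd₂⟩ := hexagon_a'b'd' ha' hb' hd'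
  obtain ⟨rfl, rfl⟩ := hd.up_unique hd₂
  exact ⟨q, y, z, ha, hb, hd'⟩

theorem hexagon_a'bd (ha' : 𝓑.Cross l t h k) (hb : 𝓑.Cross q z r k) (hd : 𝓑.Cross p r j h) :
    ∃ x y s, 𝓑.Cross x y p q ∧ 𝓑.Cross x s j l ∧ 𝓑.Cross y z s t := by
  obtain ⟨x, y, ha⟩ := 𝓑.exists_cross_up p q
  obtain ⟨l', t', s, e, hb', hd'⟩ := hexagon_abd ha hb hd
  obtain ⟨rfl, rfl⟩ := ha'.up_unique e
  exact ⟨x, y, s, ha, hb', hd'⟩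

theorem hexagon_a'bd' (ha' : 𝓑.Cross l t h k) (hb : 𝓑.Cross q z r k) (hd' : 𝓑.Cross y z s t) :
    ∃ x p j, 𝓑.Cross x y p q ∧ 𝓑.Cross x s j l ∧ 𝓑.Cross p r j h := by
  obtain ⟨x, p, ha⟩ := 𝓑.exists_cross_right q y
  obtain ⟨l', h', j, e, hb', hd⟩ := hexagon_abd' ha hb hd'
  obtain ⟨rfl, rfl⟩ := ha'.right_unique e
  exact ⟨x, p, j, ha, hb', hd⟩

variable (𝓑) in
/-- The labels around a crossing of sign `ε`: `i` and `o` are the labels entering and leaving on the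
over- (`true`) and understrand (`false`). -/
def CrossRel (ε : ℤˣ) (i o : Bool → X) : Prop :=
  if ε = 1 then 𝓑.Cross (i ovr) (i und) (o und) (o ovr)
  else 𝓑.Cross (o ovr) (o und) (i und) (i ovr)

/-- Two labels of a strand with two passages: its labels `u` before and `w` after, and its label `v`
in between, give the label pairs (before, after) of the passage which comes first if `ε = 1`, and of
the other passage if `ε = -1`. -/
def passLabels (ε : ℤˣ) (u v w : X) : X × X := if ε = 1 then (u, v) else (v, w)

variable (𝓑) in
/-- The crossing relations in the triangle of a type III move. The boundary labels are `u 0, u 1` on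
the top strand, `u 2, u 3` on the middle strand and `u 4, u 5` on the bottom strand, the inner
labels are `v 0`, `v 1` and `v 2`. -/
def Triangle (εa εb εd κ : ℤˣ) (u : Fin 6 → X) (v : Fin 3 → X) : Prop :=
  let f (ε : ℤˣ) (ℓ m : X × X) : Prop :=
    𝓑.CrossRel ε (fun s => bif s then ℓ.1 else m.1) (fun s => bif s then ℓ.2 else m.2)
  f εa (passLabels (κ * εb) (u 0) (v 0) (u 1)) (passLabels (κ * εd) (u 2) (v 1) (u 3)) ∧
  f εb (passLabels (-(κ * εb)) (u 0) (v 0) (u 1))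
    (passLabels (κ * εa * εb * εd) (u 4) (v 2) (u 5)) ∧
  f εd (passLabels (-(κ * εd)) (u 2) (v 1) (u 3))
    (passLabels (-(κ * εa * εb * εd)) (u 4) (v 2) (u 5))

/-- The boundary labels of the triangle on one side of a type III move extend to the other side. -/
theorem Triangle.flip {εa εb εd κ : ℤˣ} {u : Fin 6 → X} {v : Fin 3 → X}
    (H : 𝓑.Triangle εa εb εd κ u v) : ∃ v', 𝓑.Triangle εa εb εd (-κ) u v' := by
  suffices ∃ v₀ v₁ v₂, 𝓑.Triangle εa εb εd (-κ) u ![v₀, v₁, v₂] by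
    obtain ⟨v₀, v₁, v₂, h⟩ := this
    exact ⟨_, h⟩
  rcases Int.units_eq_one_or εa with rfl | rfl <;> rcases Int.units_eq_one_or εb with rfl | rfl <;>
  rcases Int.units_eq_one_or εd with rfl | rfl <;> rcases Int.units_eq_one_or κ with rfl | rfl <;>
  simp [Triangle, passLabels, CrossRel, -exists_and_left, -exists_and_right] at H ⊢ <;>
  obtain ⟨h₁, h₂, h₃⟩ := H <;>
  first
  | exact hexagon_abd h₁ h₂ h₃
  | exact hexagon_abd' h₁ h₂ h₃
  | exact hexagon_ab'd h₁ h₂ h₃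
  | exact hexagon_ab'd' h₁ h₂ h₃
  | exact hexagon_a'bd h₁ h₂ h₃
  | exact hexagon_a'bd' h₁ h₂ h₃
  | exact hexagon_a'b'd h₁ h₂ h₃
  | exact hexagon_a'b'd' h₁ h₂ h₃

theorem triangle_unique_aux {x y z w x' y' z' w' : X} (h : 𝓑.Cross x y z w)
    (h' : 𝓑.Cross x' y' z' w') :
    (x = x' ∧ y = y' → z = z' ∧ w = w') ∧ (z = z' ∧ w = w' → x = x' ∧ y = y') ∧
    (z = z' ∧ x = x' → y = y' ∧ w = w') ∧ (w = w' ∧ y = y' → x = x' ∧ z = z') := by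
  refine ⟨?_, ?_, ?_, ?_⟩ <;> rintro ⟨rfl, rfl⟩
  exacts [h.down_unique h', h.up_unique h', h.left_unique h', h.right_unique h']

/-- The boundary labels of the triangle determine the inner labels. -/
theorem Triangle.unique {εa εb εd κ : ℤˣ} {u : Fin 6 → X} {v v' : Fin 3 → X}
    (H : 𝓑.Triangle εa εb εd κ u v) (H' : 𝓑.Triangle εa εb εd κ u v') : v = v' := by
  suffices v 0 = v' 0 ∧ v 1 = v' 1 ∧ v 2 = v' 2 by
    funext i
    fin_cases i
    exacts [this.1, this.2.1, this.2.2]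
  rcases Int.units_eq_one_or εa with rfl | rfl <;> rcases Int.units_eq_one_or εb with rfl | rfl <;>
  rcases Int.units_eq_one_or εd with rfl | rfl <;> rcases Int.units_eq_one_or κ with rfl | rfl <;>
  simp [Triangle, passLabels, CrossRel] at H H' <;>
  obtain ⟨h₁, h₂, h₃⟩ := H <;> obtain ⟨k₁, k₂, k₃⟩ := H' <;>
  have e₁ := triangle_unique_aux h₁ k₁ <;> have e₂ := triangle_unique_aux h₂ k₂ <;>
  have e₃ := triangle_unique_aux h₃ k₃ <;> clear h₁ h₂ h₃ k₁ k₂ k₃ <;>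
  simp_all only [true_and, and_true, and_self, true_imp_iff]

theorem IsClosed.cross_mem {Y : Set X} (hY : 𝓑.IsClosed Y) {x y z w : X} (h : 𝓑.Cross x y z w) :
    (x ∈ Y ∧ y ∈ Y → z ∈ Y ∧ w ∈ Y) ∧ (z ∈ Y ∧ w ∈ Y → x ∈ Y ∧ y ∈ Y) ∧
    (z ∈ Y ∧ x ∈ Y → w ∈ Y ∧ y ∈ Y) ∧ (w ∈ Y ∧ y ∈ Y → z ∈ Y ∧ x ∈ Y) :=
  ⟨fun e => hY.down h e.1 e.2, fun e => hY.up h e.1 e.2, fun e => hY.left h e.1 e.2,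
    fun e => hY.right h e.1 e.2⟩

theorem Triangle.mem {εa εb εd κ : ℤˣ} {u : Fin 6 → X} {v : Fin 3 → X}
    (H : 𝓑.Triangle εa εb εd κ u v) {Y : Set X} (hY : 𝓑.IsClosed Y) (hu : ∀ i, u i ∈ Y)
    (i : Fin 3) : v i ∈ Y := by
  suffices v 0 ∈ Y ∧ v 1 ∈ Y ∧ v 2 ∈ Y by
    fin_cases i
    exacts [this.1, this.2.1, this.2.2]
  have := hu 0; have := hu 1; have := hu 2; have := hu 3; have := hu 4; have := hu 5
  clear hu
  rcases Int.units_eq_one_or εa with rfl | rfl <;> rcases Int.units_eq_one_or εb with rfl | rfl <;>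
  rcases Int.units_eq_one_or εd with rfl | rfl <;> rcases Int.units_eq_one_or κ with rfl | rfl <;>
  simp [Triangle, passLabels, CrossRel] at H <;>
  obtain ⟨h₁, h₂, h₃⟩ := H <;>
  have e₁ := hY.cross_mem h₁ <;> have e₂ := hY.cross_mem h₂ <;>
  have e₃ := hY.cross_mem h₃ <;> clear h₁ h₂ h₃ <;>
  simp_all only [true_and, and_true, and_self, true_imp_iff]

/-! ### The local relations of kinks and of pairs of opposite crossings -/

/-- The holonomy of a kink: the strand `s` is passed first, and the loop joins its end to the
beginning of the other strand. The label changes by `π` for a positive and by `π⁻¹` for a negative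
kink. -/
theorem CrossRel.kink {ε : ℤˣ} {i o : Bool → X} (h : 𝓑.CrossRel ε i o) {s : Bool}
    (hs : i (!s) = o s) : o (!s) = (𝓑.kink ^ (ε : ℤ)) (i s) := by
  rcases Int.units_eq_one_or ε with rfl | rfl <;> cases s <;>
    simp [CrossRel, ovr, und] at h hs ⊢ <;> rw [hs] at h
  · exact h.kink_under
  · exact h.kink.2
  · rw [Equiv.eq_symm_apply]
    exact h.kink.2.symm
  · rw [Equiv.eq_symm_apply]
    exact h.kink_under.symm

variable (𝓑) in
theorem exists_crossRel_kink (ε : ℤˣ) (s : Bool) (x : X) :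
    ∃ i o : Bool → X, 𝓑.CrossRel ε i o ∧ i (!s) = o s ∧ i s = x := by
  have aux : ∀ x, ∃ b, 𝓑.Cross b (𝓑.kink⁻¹ x) b x := fun x => by
    obtain ⟨b, hb⟩ := 𝓑.exists_cross_under (𝓑.kink⁻¹ x)
    exact ⟨b, by simpa using hb⟩
  have aux' : ∀ x, ∃ y, 𝓑.Cross (𝓑.kink⁻¹ x) y x y := fun x =>
    ⟨_, by simpa using 𝓑.cross_kink (𝓑.kink⁻¹ x)⟩
  obtain ⟨b, hb⟩ := 𝓑.exists_cross_under x
  obtain ⟨b', hb'⟩ := aux x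
  obtain ⟨y', hy'⟩ := aux' x
  have hy := 𝓑.cross_kink x
  rcases Int.units_eq_one_or ε with rfl | rfl <;> cases s
  · exact ⟨fun t => bif t then b else x, fun t => bif t then 𝓑.kink x else b,
      by simpa [CrossRel] using hb, rfl, rfl⟩
  · exact ⟨fun t => bif t then x else 𝓑.alpha x, fun t => bif t then 𝓑.alpha x else 𝓑.kink x,
      by simpa [CrossRel] using hy, rfl, rfl⟩
  · exact ⟨fun t => bif t then y' else x, fun t => bif t then 𝓑.kink⁻¹ x else y',
      by simpa [CrossRel] using hy', rfl, rfl⟩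
  · exact ⟨fun t => bif t then x else b', fun t => bif t then b' else 𝓑.kink⁻¹ x,
      by simpa [CrossRel] using hb', rfl, rfl⟩

theorem CrossRel.kink_unique {ε : ℤˣ} {i o i' o' : Bool → X} (h : 𝓑.CrossRel ε i o)
    (h' : 𝓑.CrossRel ε i' o') {s : Bool} (hs : i (!s) = o s) (hs' : i' (!s) = o' s)
    (e : i s = i' s) : o = o' := by
  have e₁ : o (!s) = o' (!s) := by rw [h.kink hs, h'.kink hs', e]
  suffices o s = o' s by
    funext t
    rcases Bool.eq_or_eq_not t s with rfl | rfl
    exacts [this, e₁]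
  rcases Int.units_eq_one_or ε with rfl | rfl <;> cases s <;>
    simp [CrossRel, ovr, und] at h h' hs hs' e e₁ ⊢ <;> rw [hs] at h <;> rw [hs', ← e] at h'
  · exact h.under_unique h'
  · exact h.kink.1.trans h'.kink.1.symm
  · rw [← e₁] at h'
    exact h.kink.1.trans h'.kink.1.symm
  · rw [← e₁] at h'
    exact h.under_unique h'

theorem CrossRel.kink_mem {ε : ℤˣ} {i o : Bool → X} (h : 𝓑.CrossRel ε i o) {s : Bool}
    (hs : i (!s) = o s) {Y : Set X} (hY : 𝓑.IsClosed Y) (e : i s ∈ Y) (t : Bool) : o t ∈ Y := by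
  have e₁ : o (!s) ∈ Y := by rwa [h.kink hs, hY.zpow_mem_iff]
  suffices o s ∈ Y by
    rcases Bool.eq_or_eq_not t s with rfl | rfl
    exacts [this, e₁]
  rcases Int.units_eq_one_or ε with rfl | rfl <;> cases s <;>
    simp [CrossRel, ovr, und] at h hs e e₁ ⊢ <;> rw [hs] at h
  · exact hY.loop_under h (.inl e)
  · exact hY.loop_over h (.inl e)
  · exact hY.loop_over h (.inr e)
  · exact hY.loop_under h (.inr e)

end Birack

/-! ### Homomorphisms from a presented birack -/

namespace Presented

variable {X : Type u} (𝓑 : Birack X)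

/-- The map of a birack named by `o`. -/
def opEval : Op → Equiv.Perm (X × X)
  | .B => 𝓑.B
  | .Binv => 𝓑.B.symm
  | .S => 𝓑.S
  | .Sinv => 𝓑.S.symm

theorem opEval_inv (o : Op) (t : X × X) : opEval 𝓑 o (opEval 𝓑 o.inv t) = t := by
  cases o <;> simp [opEval, Op.inv]

theorem bijective_opEval_fst (b : Bool) :
    Function.Bijective fun x : X => (opEval 𝓑 (sideOp b) (x, x)).1 := by
  cases b
  exacts [𝓑.diag_Sinv_fst, 𝓑.diag_S_fst]

theorem bijective_opEval_snd (b : Bool) :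
    Function.Bijective fun x : X => (opEval 𝓑 (sideOp b) (x, x)).2 := by
  cases b
  exacts [𝓑.diag_Sinv_snd, 𝓑.diag_S_snd]

/-- The value of a birack word for given values of the generators. -/
noncomputable def wordEval {G : Type} (ℓ : G → X) : Word G → X
  | .gen g => ℓ g
  | .fst o x y => (opEval 𝓑 o (wordEval ℓ x, wordEval ℓ y)).1
  | .snd o x y => (opEval 𝓑 o (wordEval ℓ x, wordEval ℓ y)).2
  | .diagFst b x => (Equiv.ofBijective _ (bijective_opEval_fst 𝓑 b)).symm (wordEval ℓ x)
  | .diagSnd b x => (Equiv.ofBijective _ (bijective_opEval_snd 𝓑 b)).symm (wordEval ℓ x)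

variable {𝓑}

/-- The relations between words hold in every birack in which the generators satisfy `R`. -/
theorem wordEval_eq {G : Type} {R : G → G → G → G → Prop} {ℓ : G → X}
    (hℓ : ∀ x y z w, R x y z w → 𝓑.Cross (ℓ x) (ℓ y) (ℓ z) (ℓ w)) {a b : Word G}
    (h : WordRel R a b) : wordEval 𝓑 ℓ a = wordEval 𝓑 ℓ b := by
  induction h with
  | refl => rfl
  | symm _ ih => exact ih.symm
  | trans _ _ ih₁ ih₂ => exact ih₁.trans ih₂
  | congr_fst o _ _ ih₁ ih₂ => simp only [wordEval, ih₁, ih₂]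
  | congr_snd o _ _ ih₁ ih₂ => simp only [wordEval, ih₁, ih₂]
  | congr_diagFst b _ ih => simp only [wordEval, ih]
  | congr_diagSnd b _ ih => simp only [wordEval, ih]
  | inv_fst o x y => exact congrArg Prod.fst (opEval_inv 𝓑 o (_, _))
  | inv_snd o x y => exact congrArg Prod.snd (opEval_inv 𝓑 o (_, _))
  | side_fst x y => exact congrArg Prod.fst (𝓑.sideways _ _)
  | side_snd x y => exact congrArg Prod.snd (𝓑.sideways _ _)
  | side_fst' a b =>
    obtain ⟨y, w, h⟩ := 𝓑.exists_cross_left (wordEval 𝓑 ℓ a) (wordEval 𝓑 ℓ b)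
    simp only [wordEval, opEval, h.sideways]
    exact congrArg Prod.fst h
  | side_snd' a b =>
    obtain ⟨y, w, h⟩ := 𝓑.exists_cross_left (wordEval 𝓑 ℓ a) (wordEval 𝓑 ℓ b)
    simp only [wordEval, opEval, h.sideways]
    exact congrArg Prod.snd h
  | diagFst_left b x => exact Equiv.ofBijective_symm_apply_apply _ (bijective_opEval_fst 𝓑 b) _
  | diagFst_right b x => exact Equiv.ofBijective_apply_symm_apply _ (bijective_opEval_fst 𝓑 b) _
  | diagSnd_left b x => exact Equiv.ofBijective_symm_apply_apply _ (bijective_opEval_snd 𝓑 b) _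
  | diagSnd_right b x => exact Equiv.ofBijective_apply_symm_apply _ (bijective_opEval_snd 𝓑 b) _
  | yb_one x y z =>
    exact (congrArg Prod.fst (congrFun 𝓑.yang_baxter (wordEval 𝓑 ℓ x, wordEval 𝓑 ℓ y,
      wordEval 𝓑 ℓ z))).symm
  | yb_two x y z =>
    exact (congrArg (fun t => t.2.1) (congrFun 𝓑.yang_baxter (wordEval 𝓑 ℓ x, wordEval 𝓑 ℓ y,
      wordEval 𝓑 ℓ z))).symm
  | yb_three x y z =>
    exact (congrArg (fun t => t.2.2) (congrFun 𝓑.yang_baxter (wordEval 𝓑 ℓ x, wordEval 𝓑 ℓ y,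
      wordEval 𝓑 ℓ z))).symm
  | rel_fst h => exact congrArg Prod.fst (hℓ _ _ _ _ h)
  | rel_snd h => exact congrArg Prod.snd (hℓ _ _ _ _ h)

/-- The homomorphism with given values on the generators. -/
noncomputable def lift {G : Type} {R : G → G → G → G → Prop} (ℓ : G → X)
    (hℓ : ∀ x y z w, R x y z w → 𝓑.Cross (ℓ x) (ℓ y) (ℓ z) (ℓ w)) :
    Birack.Hom (birack R) 𝓑 where
  toFun := Quotient.lift (s := wordSetoid R) (wordEval 𝓑 ℓ) fun _ _ h => wordEval_eq hℓ h
  map_fst a b := by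
    induction a using ind_mk with | h x => ?_
    induction b using ind_mk with | h y => ?_
    rfl
  map_snd a b := by
    induction a using ind_mk with | h x => ?_
    induction b using ind_mk with | h y => ?_
    rfl

theorem wordEval_mem [Finite X] {G : Type} {ℓ : G → X} {Y : Set X} (hY : 𝓑.IsClosed Y)
    (hℓ : ∀ g, ℓ g ∈ Y) (a : Word G) : wordEval 𝓑 ℓ a ∈ Y := by
  have hop : ∀ o x y, x ∈ Y → y ∈ Y → (opEval 𝓑 o (x, y)).1 ∈ Y ∧ (opEval 𝓑 o (x, y)).2 ∈ Y := by
    intro o x y hx hy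
    cases o with
    | B => exact hY.down (rfl : 𝓑.Cross x y _ _) hx hy
    | Binv => exact hY.up (𝓑.B.apply_symm_apply (x, y) : 𝓑.Cross _ _ x y) hx hy
    | S =>
      obtain ⟨v, w, h⟩ := 𝓑.exists_cross_left x y
      simp only [opEval, h.sideways]
      exact hY.left h hx hy
    | Sinv =>
      obtain ⟨v, w, h⟩ := 𝓑.exists_cross_right x y
      have e : 𝓑.S.symm (x, y) = (w, v) := by rw [Equiv.symm_apply_eq, h.sideways]
      simp only [opEval, e]
      exact hY.right h hx hy
  induction a with
  | gen g => exact hℓ g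
  | fst o x y ihx ihy => exact (hop o _ _ ihx ihy).1
  | snd o x y ihx ihy => exact (hop o _ _ ihx ihy).2
  | diagFst b x ih =>
    refine Birack.mem_of_apply_mem (bijective_opEval_fst 𝓑 b).1 (fun a ha => (hop _ a a ha ha).1)
      ?_
    rw [wordEval, Equiv.ofBijective_apply_symm_apply (fun x : X => (opEval 𝓑 (sideOp b) (x, x)).1)]
    exact ih
  | diagSnd b x ih =>
    refine Birack.mem_of_apply_mem (bijective_opEval_snd 𝓑 b).1 (fun a ha => (hop _ a a ha ha).2)
      ?_
    rw [wordEval, Equiv.ofBijective_apply_symm_apply (fun x : X => (opEval 𝓑 (sideOp b) (x, x)).2)]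
    exact ih

end Presented

namespace LinkDiagram

variable {c : ℕ} (D : LinkDiagram c) {X : Type u} (𝓑 : Birack X)

theorem labelingOfHom_bijective : Function.Bijective (D.labelingOfHom 𝓑) := by
  refine ⟨fun h h' e => Presented.hom_ext fun g => congrFun (congrArg Subtype.val e) g,
    fun ℓ => ⟨Presented.lift ℓ.1 ?_, Subtype.ext rfl⟩⟩
  rintro x y z w ⟨v, hs, ht⟩
  have := ℓ.2 v
  rwa [hs, ht] at this

/-- For a finite target, the image of a homomorphism is the intersection of the closed subsets which
contain all labels of the corresponding labeling. -/
theorem image_eq_sInter [Finite X] (h : D.HomTo 𝓑) :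
    h.image = ⋂₀ {Y | 𝓑.IsClosed Y ∧ ∀ s, (D.labelingOfHom 𝓑 h).1 s ∈ Y} := by
  have hrel : ∀ x y z w, D.CrossingRel x y z w → 𝓑.Cross ((D.labelingOfHom 𝓑 h).1 x)
      ((D.labelingOfHom 𝓑 h).1 y) ((D.labelingOfHom 𝓑 h).1 z) ((D.labelingOfHom 𝓑 h).1 w) := by
    rintro x y z w ⟨v, hs, ht⟩
    have := (D.labelingOfHom 𝓑 h).2 v
    rwa [hs, ht] at this
  have e : h = Presented.lift (D.labelingOfHom 𝓑 h).1 hrel := Presented.hom_ext fun g => rfl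
  refine congrArg Set.sInter (Set.ext fun Y => and_congr_left' ?_ |>.trans
    (and_congr_right fun hY => ?_))
  · exact ⟨fun H => H.isClosed, fun H => H.isSubbirack⟩
  · refine ⟨fun H s => H ⟨_, rfl⟩, fun H => ?_⟩
    rintro _ ⟨q, rfl⟩
    rw [e]
    induction q using Presented.ind_mk with
    | h x => exact Presented.wordEval_mem hY H x

end LinkDiagram

/-! ### Twisted labelings -/

/-- Two sets of labelings (possibly of different diagrams) have the same size, by a bijection under
which corresponding labelings have labels in the same closed subsets. -/
def LabelEquiv {X : Type u} (𝓑 : Birack X) {A A' : Type} (L : Set (A → X)) (L' : Set (A' → X)) :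
    Prop :=
  ∃ e : L ≃ L', ∀ Y, 𝓑.IsClosed Y → ∀ ℓ : L, (∀ a, ℓ.1 a ∈ Y) ↔ ∀ a, (e ℓ).1 a ∈ Y

namespace LabelEquiv

variable {X : Type u} {𝓑 : Birack X} {A A' A'' : Type} {L : Set (A → X)} {L' : Set (A' → X)}
  {L'' : Set (A'' → X)}

theorem symm (h : LabelEquiv 𝓑 L L') : LabelEquiv 𝓑 L' L := by
  obtain ⟨e, he⟩ := h
  exact ⟨e.symm, fun Y hY ℓ => by simpa using (he Y hY (e.symm ℓ)).symm⟩

theorem trans (h : LabelEquiv 𝓑 L L') (h' : LabelEquiv 𝓑 L' L'') : LabelEquiv 𝓑 L L'' := by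
  obtain ⟨e, he⟩ := h
  obtain ⟨e', he'⟩ := h'
  exact ⟨e.trans e', fun Y hY ℓ => (he Y hY ℓ).trans (he' Y hY (e ℓ))⟩

/-- A bijection given by a relation. -/
theorem of_rel (r : (A → X) → (A' → X) → Prop)
    (h₁ : ∀ ℓ ∈ L, ∃ ℓ' ∈ L', r ℓ ℓ') (h₂ : ∀ ℓ' ∈ L', ∃ ℓ ∈ L, r ℓ ℓ')
    (h₃ : ∀ ℓ ∈ L, ∀ ℓ' ∈ L', ∀ k' ∈ L', r ℓ ℓ' → r ℓ k' → ℓ' = k')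
    (h₄ : ∀ ℓ ∈ L, ∀ k ∈ L, ∀ ℓ' ∈ L', r ℓ ℓ' → r k ℓ' → ℓ = k)
    (h₅ : ∀ Y, 𝓑.IsClosed Y → ∀ ℓ ∈ L, ∀ ℓ' ∈ L', r ℓ ℓ' → ((∀ a, ℓ a ∈ Y) ↔ ∀ a, ℓ' a ∈ Y)) :
    LabelEquiv 𝓑 L L' := by
  choose f hf hr using h₁
  choose g hg hs using h₂
  refine ⟨⟨fun ℓ => ⟨f ℓ.1 ℓ.2, hf _ _⟩, fun ℓ => ⟨g ℓ.1 ℓ.2, hg _ _⟩, fun ℓ => ?_, fun ℓ => ?_⟩,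
    fun Y hY ℓ => h₅ Y hY _ ℓ.2 _ (hf _ _) (hr _ _)⟩
  · exact Subtype.ext (h₄ _ (hg _ _) _ ℓ.2 _ (hf _ _) (hs _ _) (hr _ _))
  · exact Subtype.ext (h₃ _ (hg _ _) _ (hf _ _) _ ℓ.2 (hr _ _) (hs _ _))

end LabelEquiv

namespace LinkDiagram

variable {c : ℕ} (D : LinkDiagram c) {X : Type u} (𝓑 : Birack X)

/-- The label entering a passage, when the twist `m` lets the label of each semiarc change by a
power of the kink map on the way from the beginning to the end of the semiarc. -/
noncomputable def inLabel (m : D.Semiarc → ℤ) (ℓ : D.Semiarc → X) (q : Fin D.n × Bool) : X :=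
  (𝓑.kink ^ m (D.inArc q)) (ℓ (D.inArc q))

/-- Twisted labelings: labels of the beginnings of the semiarcs, satisfying the crossing relations
with the twisted labels at the ends of the semiarcs. On a circle without crossings the beginning and
the end carry the same label. -/
def twisted (m : D.Semiarc → ℤ) : Set (D.Semiarc → X) :=
  {ℓ | (∀ v, 𝓑.CrossRel (D.sign v) (fun s => D.inLabel 𝓑 m ℓ (v, s))
      (fun s => ℓ (D.outArc (v, s)))) ∧
    ∀ k, (𝓑.kink ^ m (.inr k)) (ℓ (.inr k)) = ℓ (.inr k)}

open Classical in
/-- The total twist along a component. -/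
noncomputable def totalTwist (m : D.Semiarc → ℤ) (k : Fin c) : ℤ :=
  (∑ p, if D.comp p = k then m (.inl p) else 0) +
    if h : ∀ p, D.comp p ≠ k then m (.inr ⟨k, h⟩) else 0

/-- The twist `m` raises the writhes to `w`: its totals are `w` minus the writhes. -/
def TwistsTo (w : Fin c → ℤ) (m : D.Semiarc → ℤ) : Prop :=
  ∀ k, D.totalTwist m k = w k - D.writhe k

theorem inLabel_next (m : D.Semiarc → ℤ) (ℓ : D.Semiarc → X) (q : Fin D.n × Bool) :
    D.inLabel 𝓑 m ℓ (D.next q) = (𝓑.kink ^ m (.inl q)) (ℓ (.inl q)) := by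
  simp [inLabel, inArc]

theorem exists_totalTwist (t : Fin c → ℤ) : ∃ m, D.totalTwist m = t := by
  classical
  have hr : ∀ k, ∃ s : D.Semiarc, Sum.elim D.comp Subtype.val s = k := by
    intro k
    by_cases h : ∀ p, D.comp p ≠ k
    · exact ⟨.inr ⟨k, h⟩, rfl⟩
    · push Not at h
      obtain ⟨p, hp⟩ := h
      exact ⟨.inl p, hp⟩
  choose r hr using hr
  refine ⟨fun s => if s = r (Sum.elim D.comp Subtype.val s) then
    t (Sum.elim D.comp Subtype.val s) else 0, funext fun k => ?_⟩
  have hrk := hr k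
  unfold totalTwist
  by_cases h : ∀ p, D.comp p ≠ k
  · rcases hs : r k with p | k'
    · rw [hs] at hrk
      exact absurd hrk (h p)
    · rw [hs] at hrk
      have : k' = ⟨k, h⟩ := Subtype.ext hrk
      subst this
      simp [h, hs]
  · rcases hs : r k with p | k'
    · rw [hs] at hrk
      rw [dif_neg h, add_zero, Finset.sum_eq_single p]
      · have : D.comp p = k := hrk
        simp [this, hs]
      · intro q _ hq
        split_ifs with h₁
        · simp only [Sum.elim_inl, h₁, hs, Sum.inl.injEq, hq, if_false]
        · rfl
      · simp
    · rw [hs] at hrk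
      have : k'.1 = k := hrk
      exact absurd (this ▸ k'.2) h

theorem totalTwist_mul (N : ℤ) (m : D.Semiarc → ℤ) (k : Fin c) :
    D.totalTwist (fun s => N * m s) k = N * D.totalTwist m k := by
  unfold totalTwist
  rw [mul_add, Finset.mul_sum]
  congr 1
  · exact Finset.sum_congr rfl fun p _ => by split_ifs <;> simp
  · split_ifs <;> simp

theorem totalTwist_zero (k : Fin c) : D.totalTwist (fun _ => 0) k = 0 := by
  simp [totalTwist]

/-- A twist by multiples of the rank has no effect. -/
theorem twisted_rank_mul (m : D.Semiarc → ℤ) :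
    D.twisted 𝓑 (fun s => 𝓑.rank * m s) = D.twisted 𝓑 fun _ => 0 := by
  have h (i : ℤ) : 𝓑.kink ^ (𝓑.rank * i) = 1 := by
    rw [zpow_mul, zpow_natCast, Birack.rank, pow_orderOf_eq_one, one_zpow]
  simp [twisted, inLabel, h]

theorem mem_twisted_zero {ℓ : D.Semiarc → X} : ℓ ∈ D.twisted 𝓑 (fun _ => 0) ↔
    ∀ v, 𝓑.B (ℓ (D.source v).1, ℓ (D.source v).2) = (ℓ (D.target v).1, ℓ (D.target v).2) := by
  simp only [twisted, inLabel, zpow_zero, Equiv.Perm.coe_one, id, Set.mem_ofPred_eq, implies_true,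
    and_true]
  refine forall_congr' fun v => ?_
  by_cases h : D.sign v = 1 <;> simp [Birack.CrossRel, source, target, h, Birack.Cross]

/-- The labelings of a diagram are its untwisted labelings. -/
def labelingEquiv : D.Labeling 𝓑 ≃ D.twisted 𝓑 fun _ => 0 :=
  Equiv.subtypeEquivRight fun _ => (D.mem_twisted_zero 𝓑).symm

end LinkDiagram

/-- An integer function whose sum over each cycle of a permutation vanishes is a coboundary. -/
theorem exists_coboundary {P C : Type*} [Fintype P] [DecidableEq P] [DecidableEq C]
    (next : Equiv.Perm P) (comp : P → C)
    (hcomp : ∀ p q, comp p = comp q ↔ next.SameCycle p q) (d : P → ℤ)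
    (hd : ∀ k, ∑ p, (if comp p = k then d p else 0) = 0) :
    ∃ h : P → ℤ, ∀ p, d p = h (next p) - h p := by
  -- Unit masses on the same cycle differ by a coboundary, and `d` is a combination of such
  -- differences.
  let H : AddSubgroup (P → ℤ) :=
    { carrier := {d | ∃ h : P → ℤ, ∀ p, d p = h (next p) - h p}
      zero_mem' := ⟨0, by simp⟩
      add_mem' := by
        rintro a b ⟨h, hh⟩ ⟨h', hh'⟩
        exact ⟨h + h', fun p => by simp [hh, hh']; ring⟩
      neg_mem' := by
        rintro a ⟨h, hh⟩
        exact ⟨-h, fun p => by simp [hh]; ring⟩ }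
  have hstep (p : P) : Pi.single p (1 : ℤ) - Pi.single (next p) 1 ∈ H :=
    ⟨Pi.single (next p) 1, fun q => by simp [Pi.single_apply]⟩
  have hcycle (p q : P) (hpq : comp p = comp q) :
      Pi.single p (1 : ℤ) - Pi.single q 1 ∈ H := by
    obtain ⟨n, rfl⟩ := ((hcomp p q).1 hpq).exists_nat_pow_eq
    clear hpq
    induction n with
    | zero => simp
    | succ n ih =>
      have := H.add_mem ih (hstep ((next ^ n) p))
      rw [pow_succ', Equiv.Perm.mul_apply]
      simpa using this
  rcases isEmpty_or_nonempty P with hP | hP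
  · exact ⟨0, fun p => (hP.false p).elim⟩
  let r : C → P := Function.invFun comp
  have hr (p : P) : comp (r (comp p)) = comp p := Function.invFun_eq ⟨p, rfl⟩
  have hsum : d = ∑ p, d p • (Pi.single p (1 : ℤ) - Pi.single (r (comp p)) 1) := by
    funext q
    have h₁ : ∑ p, d p * (if q = r (comp p) then (1 : ℤ) else 0) = 0 := by
      by_cases hq : q = r (comp q)
      · refine Eq.trans ?_ (hd (comp q))
        refine Finset.sum_congr rfl fun p _ => ?_
        have : q = r (comp p) ↔ comp p = comp q :=
          ⟨fun h => by rw [h, hr], fun h => by rw [h]; exact hq⟩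
        simp [this]
      · refine Finset.sum_eq_zero fun p _ => ?_
        rw [if_neg, mul_zero]
        intro h
        apply hq
        rw [h, hr]
    simp only [mul_ite, mul_one, mul_zero] at h₁
    simp [Finset.sum_apply, Pi.single_apply, mul_sub, Finset.sum_sub_distrib, h₁]
  rw [hsum]
  exact H.sum_mem fun p _ => H.zsmul_mem (hcycle p _ (hr p).symm) _

namespace LinkDiagram

variable {c : ℕ} (D : LinkDiagram c) {X : Type u} (𝓑 : Birack X)

theorem totalTwist_of_forall_ne {k : Fin c} (h : ∀ p, D.comp p ≠ k) (m : D.Semiarc → ℤ) :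
    D.totalTwist m k = m (.inr ⟨k, h⟩) := by
  unfold totalTwist
  rw [dif_pos h, Finset.sum_eq_zero fun p _ => if_neg (h p), zero_add]

theorem totalTwist_of_exists {k : Fin c} (h : ∃ p, D.comp p = k) (m : D.Semiarc → ℤ) :
    D.totalTwist m k = ∑ p, if D.comp p = k then m (.inl p) else 0 := by
  unfold totalTwist
  rw [dif_neg (by push Not; exact h), add_zero]

variable {D} in
/-- Twists slide along the components: up to bijection, the twisted labelings only depend on the
total twists. -/
theorem twisted_equiv_of_totalTwist_eq {m m' : D.Semiarc → ℤ}
    (h : D.totalTwist m = D.totalTwist m') :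
    LabelEquiv 𝓑 (D.twisted 𝓑 m) (D.twisted 𝓑 m') := by
  obtain ⟨g, hg⟩ := exists_coboundary D.next D.comp D.comp_eq_iff
    (fun p => m' (.inl p) - m (.inl p)) fun k => by
      by_cases hk : ∃ p, D.comp p = k
      · have := congrFun h k
        rw [totalTwist_of_exists D hk, totalTwist_of_exists D hk] at this
        refine Eq.trans ?_ (sub_eq_zero.2 this.symm)
        rw [← Finset.sum_sub_distrib]
        exact Finset.sum_congr rfl fun p _ => by split_ifs <;> simp
      · push Not at hk
        exact Finset.sum_eq_zero fun p _ => if_neg (hk p)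
  have hfree (k) : m (.inr k) = m' (.inr k) := by
    have := congrFun h k.1
    rwa [totalTwist_of_forall_ne D k.2, totalTwist_of_forall_ne D k.2] at this
  -- The two twists differ by the coboundary of `g`, so that `π ^ g` exchanges the twisted
  -- labelings.
  let f : (D.Semiarc → X) → (D.Semiarc → X) := fun ℓ =>
    Sum.elim (fun p => (𝓑.kink ^ g p) (ℓ (.inl p))) fun k => ℓ (.inr k)
  let f' : (D.Semiarc → X) → (D.Semiarc → X) := fun ℓ =>
    Sum.elim (fun p => (𝓑.kink ^ (-g p)) (ℓ (.inl p))) fun k => ℓ (.inr k)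
  have hff' (ℓ) : f (f' ℓ) = ℓ := by
    funext s
    rcases s with p | k <;> simp [f, f']
  have hf'f (ℓ) : f' (f ℓ) = ℓ := by
    funext s
    rcases s with p | k <;> simp [f, f']
  have hin (ℓ q) : D.inLabel 𝓑 m' (f ℓ) q = (𝓑.kink ^ g q) (D.inLabel 𝓑 m ℓ q) := by
    obtain ⟨p, rfl⟩ := D.next.surjective q
    have e : m' (.inl p) + g p = g (D.next p) + m (.inl p) := by
      have := hg p
      linarith
    simp only [inLabel_next, f, Sum.elim_inl, ← Equiv.Perm.mul_apply, ← zpow_add, e]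
  have hmem (ℓ) : f ℓ ∈ D.twisted 𝓑 m' ↔ ℓ ∈ D.twisted 𝓑 m := by
    refine and_congr (forall_congr' fun v => ?_) (forall_congr' fun k => ?_)
    · simp only [hin, Birack.CrossRel, f, outArc, Sum.elim_inl]
      split_ifs <;> exact Birack.cross_zpow_iff _ _
    · simp only [f, Sum.elim_inr, hfree]
  refine LabelEquiv.of_rel (fun ℓ ℓ' => ℓ' = f ℓ) (fun ℓ hℓ => ⟨f ℓ, (hmem ℓ).2 hℓ, rfl⟩)
    (fun ℓ' hℓ' => ⟨f' ℓ', (hmem _).1 (by rwa [hff']), (hff' ℓ').symm⟩)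
    (fun _ _ _ _ _ _ e e' => e.trans e'.symm) (fun ℓ _ k _ _ _ e e' => ?_)
    fun Y hY ℓ _ ℓ' _ e => ?_
  · rw [← hf'f ℓ, ← hf'f k, ← e, ← e']
  · subst e
    rw [Sum.forall, Sum.forall]
    simp [f, hY.zpow_mem_iff]

end LinkDiagram

/-! ### Deleting crossings -/

namespace LinkDiagram

variable {c : ℕ} {X : Type u}

/-- A witness for the deletion of the crossings in `K`: the inclusion of the remaining crossings. -/
structure Deletion (E D : LinkDiagram c) (K : Set (Fin E.n)) where
  /-- the inclusion of the crossings which are not deleted -/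
  incl : Fin D.n → Fin E.n
  injective : Function.Injective incl
  range_eq : Set.range incl = Kᶜ
  sign_incl : ∀ v, E.sign (incl v) = D.sign v
  comp_incl : ∀ v s, E.comp (incl v, s) = D.comp (v, s)
  next_incl : ∀ v s, ∃ k : ℕ,
    (E.next ^ (k + 1)) (incl v, s) = (incl (D.next (v, s)).1, (D.next (v, s)).2) ∧
      ∀ j, 1 ≤ j → j ≤ k → ((E.next ^ j) (incl v, s)).1 ∈ K

theorem IsDeletion.exists_deletion {E D : LinkDiagram c} {K : Set (Fin E.n)}
    (h : IsDeletion E D K) : Nonempty (Deletion E D K) := by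
  obtain ⟨i, h₁, h₂, h₃, h₄, h₅⟩ := h
  exact ⟨⟨i, h₁, h₂, h₃, h₄, h₅⟩⟩

namespace Deletion

variable {E D : LinkDiagram c} {K : Set (Fin E.n)} (δ : Deletion E D K)

/-- The inclusion of the remaining passages. -/
def pass (p : Fin D.n × Bool) : Fin E.n × Bool := (δ.incl p.1, p.2)

theorem pass_injective : Function.Injective δ.pass := by
  rintro ⟨v, s⟩ ⟨w, t⟩ h
  simp only [pass, Prod.mk.injEq] at h
  rw [δ.injective h.1, h.2]

theorem pass_notMem (p : Fin D.n × Bool) : (δ.pass p).1 ∉ K := by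
  have : δ.incl p.1 ∈ Set.range δ.incl := ⟨_, rfl⟩
  rwa [δ.range_eq] at this

theorem exists_pass {q : Fin E.n × Bool} (h : q.1 ∉ K) : ∃ p, δ.pass p = q := by
  obtain ⟨v, hv⟩ : q.1 ∈ Set.range δ.incl := by rwa [δ.range_eq]
  exact ⟨(v, q.2), by simp [pass, hv]⟩

theorem comp_pass (p : Fin D.n × Bool) : E.comp (δ.pass p) = D.comp p := δ.comp_incl _ _

/-- The passage `q` of the larger diagram is met on the way from `p` to the next passage of the
smaller diagram. -/
def Reaches (p : Fin D.n × Bool) (q : Fin E.n × Bool) (j : ℕ) : Prop :=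
  (E.next ^ (j + 1)) (δ.pass p) = q ∧
    ∀ l, 1 ≤ l → l ≤ j → ((E.next ^ l) (δ.pass p)).1 ∈ K

theorem Reaches.succ {p q j} (h : δ.Reaches p q j) (hq : q.1 ∈ K) :
    δ.Reaches p (E.next q) (j + 1) := by
  refine ⟨by rw [pow_succ', Equiv.Perm.mul_apply, h.1], fun l hl hl' => ?_⟩
  rcases hl'.lt_or_eq with h' | rfl
  · exact h.2 l hl (by omega)
  · rwa [h.1]

theorem Reaches.unique_of_le {p p' q j j'} (h : δ.Reaches p q j) (h' : δ.Reaches p' q j')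
    (hj : j ≤ j') : p = p' := by
  have e : δ.pass p = (E.next ^ (j' - j)) (δ.pass p') := by
    apply (E.next ^ (j + 1)).injective
    rw [← Equiv.Perm.mul_apply, ← pow_add, h.1, show j + 1 + (j' - j) = j' + 1 by omega, h'.1]
  rcases hj.eq_or_lt with rfl | hlt
  · rw [Nat.sub_self, pow_zero] at e
    exact δ.pass_injective e
  · exact absurd (e ▸ h'.2 (j' - j) (by omega) (by omega)) (δ.pass_notMem p)

theorem Reaches.unique {p p' q j j'} (h : δ.Reaches p q j) (h' : δ.Reaches p' q j') : p = p' :=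
  (le_total j j').elim (h.unique_of_le δ h') fun hj => (h'.unique_of_le δ h hj).symm

theorem exists_reaches_pow (p : Fin D.n × Bool) (n : ℕ) :
    ∃ p' j, δ.Reaches p' ((E.next ^ (n + 1)) (δ.pass p)) j := by
  induction n with
  | zero => exact ⟨p, 0, rfl, fun l hl hl' => by omega⟩
  | succ n ih =>
    rw [pow_succ', Equiv.Perm.mul_apply]
    by_cases hK : ((E.next ^ (n + 1)) (δ.pass p)).1 ∈ K
    · obtain ⟨p', j, h⟩ := ih
      exact ⟨p', j + 1, h.succ δ hK⟩
    · obtain ⟨p', hp'⟩ := δ.exists_pass hK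
      exact ⟨p', 0, by rw [← hp']; rfl, fun l hl hl' => by omega⟩

theorem comp_ne_of_not_reaches {q : Fin E.n × Bool} (h : ¬∃ p j, δ.Reaches p q j)
    (p : Fin D.n × Bool) : D.comp p ≠ E.comp q := by
  intro hp
  rw [← δ.comp_pass, E.comp_eq_iff] at hp
  obtain ⟨n, hn, -, rfl⟩ := hp.exists_pow_eq''
  obtain ⟨n, rfl⟩ := Nat.exists_eq_add_of_lt hn
  rw [zero_add] at h
  exact h (δ.exists_reaches_pow p n)

open Classical in
/-- The semiarc of the smaller diagram on which the semiarc entering the passage `q` of the larger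
diagram lies. -/
noncomputable def arc (q : Fin E.n × Bool) : D.Semiarc :=
  if h : ∃ p j, δ.Reaches p q j then .inl h.choose
  else .inr ⟨E.comp q, δ.comp_ne_of_not_reaches h⟩

theorem Reaches.arc_eq {p q j} (h : δ.Reaches p q j) : δ.arc q = .inl p := by
  have hex : ∃ p j, δ.Reaches p q j := ⟨p, j, h⟩
  rw [arc, dif_pos hex]
  obtain ⟨j', h'⟩ := hex.choose_spec
  exact congrArg _ (h'.unique δ h)

theorem exists_reaches {p q} (h : δ.arc q = .inl p) : ∃ j, δ.Reaches p q j := by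
  rw [arc] at h
  split_ifs at h with hex
  · rw [Sum.inl.injEq] at h
    exact h ▸ hex.choose_spec

theorem comp_of_arc_inr {q k} (h : δ.arc q = .inr k) : E.comp q = k.1 := by
  rw [arc] at h
  split_ifs at h with hex
  rw [Sum.inr.injEq] at h
  rw [← h]

theorem comp_of_arc_inl {q p} (h : δ.arc q = .inl p) : E.comp q = D.comp p := by
  obtain ⟨j, hj⟩ := δ.exists_reaches h
  rw [← δ.comp_pass, E.comp_eq_iff, ← hj.1]
  exact (Equiv.Perm.sameCycle_pow_right.2 (Equiv.Perm.SameCycle.refl _ _)).symm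

theorem arc_eq_inr {q} (k : {k : Fin c // ∀ p, D.comp p ≠ k}) (h : E.comp q = k.1) :
    δ.arc q = .inr k := by
  rcases e : δ.arc q with p | k'
  · exact absurd ((δ.comp_of_arc_inl e).symm.trans h) (k.2 p)
  · exact congrArg _ (Subtype.ext ((δ.comp_of_arc_inr e).symm.trans h))

theorem arc_next_pass (p : Fin D.n × Bool) : δ.arc (E.next (δ.pass p)) = .inl p :=
  Reaches.arc_eq δ (j := 0) ⟨rfl, fun l hl hl' => by omega⟩

theorem comp_next (E : LinkDiagram c) (q : Fin E.n × Bool) : E.comp (E.next q) = E.comp q :=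
  (E.comp_eq_iff _ _).2 (Equiv.Perm.sameCycle_apply_left.2 (Equiv.Perm.SameCycle.refl _ _))

theorem arc_next {q : Fin E.n × Bool} (hq : q.1 ∈ K) : δ.arc (E.next q) = δ.arc q := by
  rcases e : δ.arc q with p | k
  · obtain ⟨j, hj⟩ := δ.exists_reaches e
    exact (hj.succ δ hq).arc_eq δ
  · exact δ.arc_eq_inr k ((comp_next E q).trans (δ.comp_of_arc_inr e))

theorem arc_pass (p : Fin D.n × Bool) : δ.arc (δ.pass p) = D.inArc p := by
  obtain ⟨p, rfl⟩ := D.next.surjective p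
  obtain ⟨k, hk, hk'⟩ := δ.next_incl p.1 p.2
  rw [inArc, Equiv.symm_apply_apply]
  exact Reaches.arc_eq δ (j := k) ⟨hk, hk'⟩

theorem mem_of_comp (δ : Deletion E D K) {q : Fin E.n × Bool}
    (h : ∀ p, D.comp p ≠ E.comp q) : q.1 ∈ K := by
  by_contra hq
  obtain ⟨p, rfl⟩ := δ.exists_pass hq
  exact h p (δ.comp_pass p).symm

end Deletion

/-! ### Erasing tangles -/

/-- Labels `i` and `o` entering and leaving the passages through the crossings in `K` satisfy the
crossing relations, and agree along the arcs which leave the passages in `T`. -/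
def IsLocal (E : LinkDiagram c) (𝓑 : Birack X) (K : Set (Fin E.n)) (T : Finset (Fin E.n × Bool))
    (i o : Fin E.n × Bool → X) : Prop :=
  (∀ v ∈ K, 𝓑.CrossRel (E.sign v) (fun s => i (v, s)) (fun s => o (v, s))) ∧
    ∀ e ∈ T, i (E.next e) = o e

/-- The crossings in `K` form tangles whose strands have two passages each, the first ones being the
elements of `T`, such that the labels on entering the tangles are arbitrary, determine all other
labels in the tangles, and change by the power `ε` of the kink map along each strand. -/
structure Erasable (E : LinkDiagram c) (𝓑 : Birack X) (K : Set (Fin E.n))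
    (T : Finset (Fin E.n × Bool)) (ε : Fin E.n × Bool → ℤ) : Prop where
  mem_iff : ∀ q : Fin E.n × Bool, q.1 ∈ K ↔ q ∈ T ∨ ∃ e ∈ T, E.next e = q
  next_notMem : ∀ e ∈ T, E.next e ∉ T
  holonomy : ∀ i o, E.IsLocal 𝓑 K T i o → ∀ e ∈ T, o (E.next e) = (𝓑.kink ^ ε e) (i e)
  exists_local : ∀ b : Fin E.n × Bool → X, ∃ i o, E.IsLocal 𝓑 K T i o ∧ ∀ e ∈ T, i e = b e
  unique : ∀ i o i' o', E.IsLocal 𝓑 K T i o → E.IsLocal 𝓑 K T i' o' → (∀ e ∈ T, i e = i' e) →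
    ∀ q, q.1 ∈ K → o q = o' q
  closed : ∀ Y, 𝓑.IsClosed Y → ∀ i o, E.IsLocal 𝓑 K T i o → (∀ e ∈ T, i e ∈ Y) →
    ∀ q, q.1 ∈ K → o q ∈ Y

/-- Compatibility of twists `m` and `m'` of two diagrams related by a deletion. The twist cancels
the holonomy of the erased strands. If a whole component is erased, then one of its strands, given
by `f`, carries the twist of the resulting circle. -/
structure TwistData {E D : LinkDiagram c} {K : Set (Fin E.n)} (δ : Deletion E D K)
    (T : Finset (Fin E.n × Bool)) (ε : Fin E.n × Bool → ℤ) (m : E.Semiarc → ℤ)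
    (m' : D.Semiarc → ℤ) (f : {k : Fin c // ∀ p, D.comp p ≠ k} → Option (Fin E.n × Bool))
    (x : Fin E.n × Bool → ℤ) : Prop where
  mem_of_some : ∀ k e, f k = some e → e ∈ T ∧ E.comp e = k.1
  exists_some : ∀ k, (∃ q, E.comp q = k.1) → ∃ e, f k = some e
  pass : ∀ p, m (.inl (δ.pass p)) = m' (.inl p)
  first : ∀ e ∈ T, m (.inl e) = 0
  second : ∀ e ∈ T, m (.inl (E.next e)) = -ε e + x e
  free : ∀ k (h : ∀ p, E.comp p ≠ k) (h' : ∀ p, D.comp p ≠ k), m (.inr ⟨k, h⟩) = m' (.inr ⟨k, h'⟩)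
  extra_inl : ∀ e p, δ.arc e = .inl p → x e = 0
  extra_some : ∀ e k, δ.arc e = .inr k → f k = some e → x e = m' (.inr k)
  extra_ne : ∀ e k, δ.arc e = .inr k → f k ≠ some e → x e = 0

/-- The twist of a diagram with erased tangles comes from a twist of the original diagram. -/
theorem exists_twistData {E D : LinkDiagram c} {K : Set (Fin E.n)} (δ : Deletion E D K)
    {𝓑 : Birack X} {T : Finset (Fin E.n × Bool)} {ε : Fin E.n × Bool → ℤ}
    (hT : E.Erasable 𝓑 K T ε) (m' : D.Semiarc → ℤ) : ∃ m f x, TwistData δ T ε m m' f x := by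
  classical
  have hf : ∀ k : {k : Fin c // ∀ p, D.comp p ≠ k}, ∃ o : Option (Fin E.n × Bool),
      (∀ e, o = some e → e ∈ T ∧ E.comp e = k.1) ∧
        ((∃ q, E.comp q = k.1) → ∃ e, o = some e) := by
    intro k
    by_cases hk : ∃ q, E.comp q = k.1
    · obtain ⟨q, hq⟩ := hk
      have hqK : q.1 ∈ K := δ.mem_of_comp (hq ▸ k.2)
      obtain ⟨e, he, hek⟩ : ∃ e ∈ T, E.comp e = k.1 := by
        rcases (hT.mem_iff q).1 hqK with h | ⟨e, he, rfl⟩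
        · exact ⟨q, h, hq⟩
        · exact ⟨e, he, (Deletion.comp_next E e).symm.trans hq⟩
      refine ⟨some e, fun e' h => ?_, fun _ => ⟨e, rfl⟩⟩
      rw [Option.some.injEq] at h
      exact h ▸ ⟨he, hek⟩
    · exact ⟨none, fun e h => (Option.some_ne_none e h.symm).elim, fun h => absurd h hk⟩
  choose f hf hf' using hf
  have hP : ∀ q : Fin E.n × Bool, q.1 ∉ K → ∃ p, δ.pass p = q := fun q h => δ.exists_pass h
  have hdisj (p) : δ.pass p ∉ T := fun h => δ.pass_notMem p ((hT.mem_iff _).2 (.inl h))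
  let x : Fin E.n × Bool → ℤ := fun e =>
    Sum.elim (fun _ => 0) (fun k => if f k = some e then m' (.inr k) else 0) (δ.arc e)
  refine ⟨Sum.elim (fun q => if h : q.1 ∈ K then
    (if q ∈ T then 0 else -ε (E.next.symm q) + x (E.next.symm q)) else m' (.inl (hP q h).choose))
    (fun k => m' (.inr ⟨k.1, fun p => δ.comp_pass p ▸ k.2 _⟩)), f, x,
    ⟨hf, hf', fun p => ?_, fun e he => ?_, fun e he => ?_, fun k h h' => rfl, fun e p h => ?_,
    fun e k h h' => ?_, fun e k h h' => ?_⟩⟩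
  · have h := hP _ (δ.pass_notMem p)
    simp only [Sum.elim_inl]
    rw [dif_neg (δ.pass_notMem p), δ.pass_injective h.choose_spec]
  · simp only [Sum.elim_inl]
    rw [dif_pos ((hT.mem_iff e).2 (.inl he)), if_pos he]
  · simp only [Sum.elim_inl]
    rw [dif_pos ((hT.mem_iff _).2 (.inr ⟨e, he, rfl⟩)), if_neg (hT.next_notMem e he),
      Equiv.symm_apply_apply]
  · simp [x, h]
  · simp [x, h, h']
  · simp [x, h, h']

/-- A function which is constant along a cycle of a permutation, except possibly after one point, is
constant on the cycle. -/
theorem eq_of_sameCycle {P A : Type*} [Finite P] (next : Equiv.Perm P) {q₀ : P} {f : P → A}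
    (hf : ∀ q, next.SameCycle q q₀ → q ≠ q₀ → f (next q) = f q) {q : P}
    (hq : next.SameCycle q q₀) : f q = f q₀ := by
  obtain ⟨n, hn⟩ := hq.exists_nat_pow_eq
  induction n generalizing q with
  | zero => exact congrArg f hn
  | succ n ih =>
    by_cases h : q = q₀
    · rw [h]
    · rw [← hf q hq h]
      refine ih (Equiv.Perm.sameCycle_apply_left.2 hq) ?_
      rwa [pow_succ, Equiv.Perm.mul_apply] at hn

namespace TwistData

variable {E D : LinkDiagram c} {K : Set (Fin E.n)} {δ : Deletion E D K} {𝓑 : Birack X}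
  {T : Finset (Fin E.n × Bool)} {ε : Fin E.n × Bool → ℤ} {m : E.Semiarc → ℤ}
  {m' : D.Semiarc → ℤ} {f : {k : Fin c // ∀ p, D.comp p ≠ k} → Option (Fin E.n × Bool)}
  {x : Fin E.n × Bool → ℤ}

theorem sum_eq (δ : Deletion E D K) (hT : E.Erasable 𝓑 K T ε) (g : Fin E.n × Bool → ℤ) :
    ∑ q, g q = ∑ p, g (δ.pass p) + ∑ e ∈ T, (g e + g (E.next e)) := by
  classical
  have huniv : (Finset.univ : Finset (Fin E.n × Bool)) =
      Finset.univ.image δ.pass ∪ (T ∪ T.image E.next) := by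
    refine (Finset.eq_univ_iff_forall.2 fun q => ?_).symm
    simp only [Finset.mem_union, Finset.mem_image, Finset.mem_univ, true_and]
    by_cases hq : q.1 ∈ K
    · exact .inr ((hT.mem_iff q).1 hq)
    · exact .inl (δ.exists_pass hq)
  have h₁ : Disjoint (Finset.univ.image δ.pass) (T ∪ T.image E.next) := by
    rw [Finset.disjoint_left]
    intro q hq hq'
    simp only [Finset.mem_image, Finset.mem_univ, true_and] at hq
    obtain ⟨p, rfl⟩ := hq
    simp only [Finset.mem_union, Finset.mem_image] at hq'
    exact δ.pass_notMem p ((hT.mem_iff _).2 hq')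
  have h₂ : Disjoint T (T.image E.next) := by
    rw [Finset.disjoint_left]
    intro q hq hq'
    obtain ⟨e, he, rfl⟩ := Finset.mem_image.1 hq'
    exact hT.next_notMem e he hq
  rw [huniv, Finset.sum_union h₁, Finset.sum_union h₂,
    Finset.sum_image fun _ _ _ _ h => δ.pass_injective h,
    Finset.sum_image fun _ _ _ _ h => E.next.injective h, Finset.sum_add_distrib]

/-- The holonomy of the erased strands is subtracted from the total twists. -/
theorem totalTwist_eq (H : TwistData δ T ε m m' f x) (hT : E.Erasable 𝓑 K T ε) (k : Fin c) :
    E.totalTwist m k = D.totalTwist m' k - ∑ e ∈ T, if E.comp e = k then ε e else 0 := by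
  classical
  have hsum : ∑ q, (if E.comp q = k then m (.inl q) else 0) =
      ∑ p, (if D.comp p = k then m' (.inl p) else 0) +
        (∑ e ∈ T, (if E.comp e = k then x e else 0) -
          ∑ e ∈ T, if E.comp e = k then ε e else 0) := by
    rw [sum_eq δ hT, ← Finset.sum_sub_distrib]
    congr 1
    · exact Finset.sum_congr rfl fun p _ => by rw [δ.comp_pass, H.pass]
    · refine Finset.sum_congr rfl fun e he => ?_
      rw [Deletion.comp_next, H.first e he, H.second e he]
      split_ifs <;> ring
  unfold totalTwist
  rw [hsum]
  have hx : ∑ e ∈ T, (if E.comp e = k then x e else 0) +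
      (if h : ∀ p, E.comp p ≠ k then m (.inr ⟨k, h⟩) else 0) =
      if h : ∀ p, D.comp p ≠ k then m' (.inr ⟨k, h⟩) else 0 := by
    by_cases hD : ∀ p, D.comp p ≠ k
    · rw [dif_pos hD]
      by_cases hE : ∀ p, E.comp p ≠ k
      · rw [dif_pos hE, H.free k hE hD, Finset.sum_eq_zero fun e _ => if_neg (hE e), zero_add]
      · rw [dif_neg hE, add_zero]
        push Not at hE
        obtain ⟨e, he⟩ := H.exists_some ⟨k, hD⟩ hE
        obtain ⟨heT, hek⟩ := H.mem_of_some _ _ he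
        have harc (e') (h : E.comp e' = k) : δ.arc e' = .inr ⟨k, hD⟩ := δ.arc_eq_inr _ h
        rw [Finset.sum_eq_single e, if_pos hek, H.extra_some e _ (harc e hek) he]
        · intro e' _ hne
          split_ifs with h
          · refine H.extra_ne e' _ (harc e' h) fun h' => hne ?_
            exact Option.some_injective _ (h'.symm.trans he)
          · rfl
        · exact fun h => absurd heT h
    · rw [dif_neg hD]
      rw [dif_neg fun hE => hD fun p => δ.comp_pass p ▸ hE _, add_zero]
      refine Finset.sum_eq_zero fun e _ => ?_
      split_ifs with h
      · rcases ha : δ.arc e with p | k'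
        · exact H.extra_inl e p ha
        · exact absurd ((δ.comp_of_arc_inr ha).symm.trans h ▸ k'.2) hD
      · rfl
  rw [← hx]
  ring

/-- The label at the end of a semiarc. -/
noncomputable def _root_.BirackLinks.LinkDiagram.endLabel (D : LinkDiagram c) (𝓑 : Birack X)
    (m : D.Semiarc → ℤ) (ℓ : D.Semiarc → X) (s : D.Semiarc) : X := (𝓑.kink ^ m s) (ℓ s)

theorem inLabel_second (H : TwistData δ T ε m m' f x) {ℓ : E.Semiarc → X} {e}
    (he : e ∈ T) : E.inLabel 𝓑 m ℓ (E.next e) = ℓ (.inl e) := by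
  rw [inLabel_next, H.first e he, zpow_zero, Equiv.Perm.one_apply]

theorem isLocal (H : TwistData δ T ε m m' f x) {ℓ : E.Semiarc → X}
    (hℓ : ℓ ∈ E.twisted 𝓑 m) : E.IsLocal 𝓑 K T (E.inLabel 𝓑 m ℓ) fun q => ℓ (.inl q) :=
  ⟨fun v _ => hℓ.1 v, fun _ he => H.inLabel_second he⟩

open Classical in
/-- The label entering the strand of a tangle on which the passage `q` lies (the label entering `q`,
if `q` is not in a tangle). -/
noncomputable def entryLabel (E : LinkDiagram c) (𝓑 : Birack X) (T : Finset (Fin E.n × Bool))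
    (m : E.Semiarc → ℤ) (ℓ : E.Semiarc → X) (q : Fin E.n × Bool) : X :=
  if E.next.symm q ∈ T then E.inLabel 𝓑 m ℓ (E.next.symm q) else E.inLabel 𝓑 m ℓ q

theorem symm_pass_notMem (hT : E.Erasable 𝓑 K T ε) (p) : E.next.symm (δ.pass p) ∉ T := fun h =>
  δ.pass_notMem p ((hT.mem_iff _).2 (.inr ⟨_, h, by simp⟩))

theorem symm_notMem (hT : E.Erasable 𝓑 K T ε) {e} (he : e ∈ T) : E.next.symm e ∉ T := fun h =>
  hT.next_notMem _ h (by simpa using he)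

theorem pass_notMem (δ : Deletion E D K) (hT : E.Erasable 𝓑 K T ε) (p) : δ.pass p ∉ T := fun h =>
  δ.pass_notMem p ((hT.mem_iff _).2 (.inl h))

theorem entryLabel_pass (hT : E.Erasable 𝓑 K T ε) (ℓ : E.Semiarc → X) (p) :
    entryLabel E 𝓑 T m ℓ (δ.pass p) = E.inLabel 𝓑 m ℓ (δ.pass p) :=
  if_neg (symm_pass_notMem hT p)

theorem entryLabel_first (hT : E.Erasable 𝓑 K T ε) (ℓ : E.Semiarc → X) {e} (he : e ∈ T) :
    entryLabel E 𝓑 T m ℓ e = E.inLabel 𝓑 m ℓ e :=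
  if_neg (symm_notMem hT he)

theorem entryLabel_second (ℓ : E.Semiarc → X) {e} (he : e ∈ T) :
    entryLabel E 𝓑 T m ℓ (E.next e) = E.inLabel 𝓑 m ℓ e := by
  rw [entryLabel, if_pos (by simpa using he), Equiv.symm_apply_apply]

theorem entryLabel_next_pass (H : TwistData δ T ε m m' f x) (hT : E.Erasable 𝓑 K T ε)
    (ℓ : E.Semiarc → X) (p) : entryLabel E 𝓑 T m ℓ (E.next (δ.pass p)) =
      (𝓑.kink ^ m' (.inl p)) (ℓ (.inl (δ.pass p))) := by
  rw [entryLabel, if_neg (by simpa using pass_notMem δ hT p), inLabel_next, H.pass]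

theorem entryLabel_next_second (H : TwistData δ T ε m m' f x) (hT : E.Erasable 𝓑 K T ε)
    {ℓ : E.Semiarc → X} (hℓ : ℓ ∈ E.twisted 𝓑 m) {e} (he : e ∈ T) :
    entryLabel E 𝓑 T m ℓ (E.next (E.next e)) =
      (𝓑.kink ^ x e) (entryLabel E 𝓑 T m ℓ (E.next e)) := by
  rw [entryLabel_second ℓ he, entryLabel, if_neg (by simpa using hT.next_notMem e he),
    inLabel_next, H.second e he, hT.holonomy _ _ (H.isLocal hℓ) e he, ← Equiv.Perm.mul_apply,
    ← zpow_add, show -ε e + x e + ε e = x e by ring]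

/-- Inside a tangle the entry label is carried along the strands, apart from the extra twists. -/
theorem entryLabel_next (H : TwistData δ T ε m m' f x) (hT : E.Erasable 𝓑 K T ε)
    {ℓ : E.Semiarc → X} (hℓ : ℓ ∈ E.twisted 𝓑 m) {q} (hq : q.1 ∈ K)
    (hx : ∀ e ∈ T, E.next e = q → x e = 0) :
    entryLabel E 𝓑 T m ℓ (E.next q) = entryLabel E 𝓑 T m ℓ q := by
  rcases (hT.mem_iff q).1 hq with h | ⟨e, he, rfl⟩
  · rw [entryLabel_second ℓ h, entryLabel_first hT ℓ h]
  · rw [H.entryLabel_next_second hT hℓ he, hx e he rfl, zpow_zero, Equiv.Perm.one_apply]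

theorem entryLabel_of_reaches (H : TwistData δ T ε m m' f x) (hT : E.Erasable 𝓑 K T ε)
    {ℓ : E.Semiarc → X} (hℓ : ℓ ∈ E.twisted 𝓑 m) {p q j} (h : δ.Reaches p q j) :
    entryLabel E 𝓑 T m ℓ q = (𝓑.kink ^ m' (.inl p)) (ℓ (.inl (δ.pass p))) := by
  induction j generalizing q with
  | zero =>
    rw [← h.1, ← H.entryLabel_next_pass hT]
    rfl
  | succ j ih =>
    obtain ⟨rfl, h'⟩ := h
    have hj : δ.Reaches p ((E.next ^ (j + 1)) (δ.pass p)) j :=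
      ⟨rfl, fun l hl hl' => h' l hl (by omega)⟩
    have hK := h' (j + 1) (by omega) le_rfl
    rw [pow_succ', Equiv.Perm.mul_apply, H.entryLabel_next hT hℓ hK, ih hj]
    intro e he hq
    refine H.extra_inl e p ?_
    rw [← δ.arc_next ((hT.mem_iff e).2 (.inl he)), hq, hj.arc_eq δ]

/-- On an erased component all entry labels agree, and are fixed by its twist. -/
theorem entryLabel_of_free (H : TwistData δ T ε m m' f x) (hT : E.Erasable 𝓑 K T ε)
    {ℓ : E.Semiarc → X} (hℓ : ℓ ∈ E.twisted 𝓑 m) (k : {k : Fin c // ∀ p, D.comp p ≠ k})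
    (hk : ∃ q, E.comp q = k.1) : ∃ a, (∀ q, E.comp q = k.1 → entryLabel E 𝓑 T m ℓ q = a) ∧
      (𝓑.kink ^ m' (.inr k)) a = a := by
  obtain ⟨e, he⟩ := H.exists_some k hk
  obtain ⟨heT, hek⟩ := H.mem_of_some _ _ he
  have hsame (q) : E.next.SameCycle q (E.next e) ↔ E.comp q = k.1 := by
    rw [← E.comp_eq_iff, Deletion.comp_next, hek]
  have hconst (q) (hq : E.comp q = k.1) :
      entryLabel E 𝓑 T m ℓ q = entryLabel E 𝓑 T m ℓ (E.next e) := by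
    refine eq_of_sameCycle E.next (fun q hq hne => ?_) ((hsame q).2 hq)
    rw [hsame] at hq
    refine H.entryLabel_next hT hℓ (δ.mem_of_comp (hq ▸ k.2)) fun e' he' hq' => ?_
    refine H.extra_ne e' k (δ.arc_eq_inr k ?_) fun hf => hne ?_
    · rw [← hq, ← hq', Deletion.comp_next]
    · rw [← hq', Option.some_injective _ (hf.symm.trans he)]
  refine ⟨_, hconst, ?_⟩
  rw [← H.extra_some e k (δ.arc_eq_inr k hek) he, ← H.entryLabel_next_second hT hℓ heT]
  refine hconst _ ?_
  rw [Deletion.comp_next, Deletion.comp_next, hek]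

/-- Correspondence between twisted labelings before and after a deletion. -/
def Corresponds (δ : Deletion E D K) (𝓑 : Birack X) (T : Finset (Fin E.n × Bool))
    (m : E.Semiarc → ℤ) (m' : D.Semiarc → ℤ) (ℓ : E.Semiarc → X) (ℓ' : D.Semiarc → X) : Prop :=
  (∀ p, ℓ (.inl (δ.pass p)) = ℓ' (.inl p)) ∧
  (∀ k (h : ∀ p, E.comp p ≠ k) (h' : ∀ p, D.comp p ≠ k),
    ℓ (.inr ⟨k, h⟩) = ℓ' (.inr ⟨k, h'⟩)) ∧
  ∀ e ∈ T, E.inLabel 𝓑 m ℓ e = D.endLabel 𝓑 m' ℓ' (δ.arc e)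

theorem exists_restriction (H : TwistData δ T ε m m' f x) (hT : E.Erasable 𝓑 K T ε)
    {ℓ : E.Semiarc → X} (hℓ : ℓ ∈ E.twisted 𝓑 m) :
    ∃ ℓ' ∈ D.twisted 𝓑 m', Corresponds δ 𝓑 T m m' ℓ ℓ' := by
  classical
  have hfree : ∀ k : {k : Fin c // ∀ p, D.comp p ≠ k}, ∃ a,
      (∀ q, E.comp q = k.1 → entryLabel E 𝓑 T m ℓ q = a) ∧ (𝓑.kink ^ m' (.inr k)) a = a ∧
      ∀ h : ∀ p, E.comp p ≠ k.1, ℓ (.inr ⟨k.1, h⟩) = a := by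
    intro k
    by_cases hk : ∃ q, E.comp q = k.1
    · obtain ⟨a, h₁, h₂⟩ := H.entryLabel_of_free hT hℓ k hk
      exact ⟨a, h₁, h₂, fun h => absurd hk (by push Not; exact h)⟩
    · push Not at hk
      refine ⟨ℓ (.inr ⟨k.1, hk⟩), fun q hq => absurd hq (hk q), ?_, fun _ => rfl⟩
      rw [← H.free k.1 hk k.2]
      exact hℓ.2 _
  choose a ha₁ ha₂ ha₃ using hfree
  let ℓ' : D.Semiarc → X := Sum.elim (fun p => ℓ (.inl (δ.pass p))) a
  have hend (q) : entryLabel E 𝓑 T m ℓ q = D.endLabel 𝓑 m' ℓ' (δ.arc q) := by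
    rcases e : δ.arc q with p | k
    · obtain ⟨j, hj⟩ := δ.exists_reaches e
      exact H.entryLabel_of_reaches hT hℓ hj
    · rw [ha₁ k q (δ.comp_of_arc_inr e)]
      exact (ha₂ k).symm
  refine ⟨ℓ', ⟨fun v => ?_, ha₂⟩, fun p => rfl, fun k h h' => ha₃ ⟨k, h'⟩ h, fun e he => ?_⟩
  · have h := hℓ.1 (δ.incl v)
    rw [δ.sign_incl] at h
    have e : (fun s => D.inLabel 𝓑 m' ℓ' (v, s)) =
        fun s => E.inLabel 𝓑 m ℓ (δ.incl v, s) := by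
      funext s
      have h₁ := hend (δ.pass (v, s))
      rw [entryLabel_pass hT, δ.arc_pass] at h₁
      exact h₁.symm
    rw [e]
    exact h
  · rw [← entryLabel_first hT ℓ he, hend]

theorem exists_extension (H : TwistData δ T ε m m' f x) (hT : E.Erasable 𝓑 K T ε)
    {ℓ' : D.Semiarc → X} (hℓ' : ℓ' ∈ D.twisted 𝓑 m') :
    ∃ ℓ ∈ E.twisted 𝓑 m, Corresponds δ 𝓑 T m m' ℓ ℓ' := by
  classical
  obtain ⟨i, o, hio, hi⟩ := hT.exists_local fun q => D.endLabel 𝓑 m' ℓ' (δ.arc q)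
  have hP : ∀ q : Fin E.n × Bool, q.1 ∉ K → ∃ p, δ.pass p = q := fun q h => δ.exists_pass h
  let ℓ : E.Semiarc → X := Sum.elim
    (fun q => if h : q.1 ∈ K then o q else ℓ' (.inl (hP q h).choose))
    (fun k => ℓ' (.inr ⟨k.1, fun p => δ.comp_pass p ▸ k.2 _⟩))
  have hK (q) (h : q.1 ∈ K) : ℓ (.inl q) = o q := by
    simp only [ℓ, Sum.elim_inl, dif_pos h]
  have hpass (p) : ℓ (.inl (δ.pass p)) = ℓ' (.inl p) := by
    have h := hP _ (δ.pass_notMem p)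
    simp only [ℓ, Sum.elim_inl]
    rw [dif_neg (δ.pass_notMem p), δ.pass_injective h.choose_spec]
  have hTK {e} (he : e ∈ T) : e.1 ∈ K := (hT.mem_iff e).2 (.inl he)
  have hTK' {e} (he : e ∈ T) : (E.next e).1 ∈ K := (hT.mem_iff _).2 (.inr ⟨e, he, rfl⟩)
  -- The extra twist acts trivially on the label of the circle that carries it.
  have hextra (e) : (𝓑.kink ^ x e) (D.endLabel 𝓑 m' ℓ' (δ.arc e)) =
      D.endLabel 𝓑 m' ℓ' (δ.arc e) := by
    rcases h : δ.arc e with p | k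
    · rw [H.extra_inl e p h, zpow_zero, Equiv.Perm.one_apply]
    · by_cases hf : f k = some e
      · rw [H.extra_some e k h hf, endLabel, hℓ'.2 k, hℓ'.2 k]
      · rw [H.extra_ne e k h hf, zpow_zero, Equiv.Perm.one_apply]
  have hin (q) (hq : E.next.symm q ∉ T) :
      E.inLabel 𝓑 m ℓ q = D.endLabel 𝓑 m' ℓ' (δ.arc q) := by
    obtain ⟨q, rfl⟩ := E.next.surjective q
    rw [Equiv.symm_apply_apply] at hq
    rw [inLabel_next]
    by_cases hqK : q.1 ∈ K
    · rcases (hT.mem_iff q).1 hqK with h | ⟨e, he, rfl⟩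
      · exact absurd h hq
      · rw [hK _ hqK, H.second e he, hT.holonomy _ _ hio e he, hi e he, δ.arc_next hqK,
          δ.arc_next (hTK he), ← Equiv.Perm.mul_apply, ← zpow_add,
          show -ε e + x e + ε e = x e by ring, hextra]
    · obtain ⟨p, rfl⟩ := δ.exists_pass hqK
      rw [hpass, H.pass, δ.arc_next_pass]
      rfl
  have hinK (q) (h : q.1 ∈ K) : E.inLabel 𝓑 m ℓ q = i q := by
    rcases (hT.mem_iff q).1 h with h | ⟨e, he, rfl⟩
    · rw [hin q (symm_notMem hT h), hi q h]
    · rw [H.inLabel_second he, hK _ (hTK he), hio.2 e he]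
  refine ⟨ℓ, ⟨fun v => ?_, fun k => ?_⟩, hpass, fun k h h' => rfl,
    fun e he => hin e (symm_notMem hT he)⟩
  · by_cases hv : v ∈ K
    · simp only [hinK (v, _) hv, outArc, hK (v, _) hv]
      exact hio.1 v hv
    · obtain ⟨⟨w, s⟩, hw⟩ := δ.exists_pass (q := (v, true)) hv
      obtain ⟨rfl, rfl⟩ : δ.incl w = v ∧ s = true := by simpa [Deletion.pass] using hw
      have h := hℓ'.1 w
      rw [← δ.sign_incl] at h
      have e₁ : (fun s => E.inLabel 𝓑 m ℓ (δ.incl w, s)) =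
          fun s => D.inLabel 𝓑 m' ℓ' (w, s) := by
        funext s
        refine (hin (δ.pass (w, s)) (symm_pass_notMem hT _)).trans ?_
        rw [δ.arc_pass]
        rfl
      have e₂ : (fun s => ℓ (E.outArc (δ.incl w, s))) = fun s => ℓ' (D.outArc (w, s)) :=
        funext fun s => hpass (w, s)
      rw [e₁, e₂]
      exact h
  · rw [H.free k.1 k.2 fun p => δ.comp_pass p ▸ k.2 _]
    exact hℓ'.2 _

/-- Erasing tangles does not change the twisted labelings. -/
theorem labelEquiv (H : TwistData δ T ε m m' f x) (hT : E.Erasable 𝓑 K T ε) :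
    LabelEquiv 𝓑 (E.twisted 𝓑 m) (D.twisted 𝓑 m') := by
  have hstrand {k : {k : Fin c // ∀ p, D.comp p ≠ k}} (hk : ¬∀ p, E.comp p ≠ k.1) :
      ∃ e ∈ T, δ.arc e = .inr k := by
    push Not at hk
    obtain ⟨e, he⟩ := H.exists_some k hk
    obtain ⟨heT, hek⟩ := H.mem_of_some _ _ he
    exact ⟨e, heT, δ.arc_eq_inr k hek⟩
  have hcircle {ℓ' : D.Semiarc → X} (hℓ' : ℓ' ∈ D.twisted 𝓑 m') (k) :
      D.endLabel 𝓑 m' ℓ' (.inr k) = ℓ' (.inr k) := hℓ'.2 k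
  refine LabelEquiv.of_rel (Corresponds δ 𝓑 T m m') (fun ℓ hℓ => H.exists_restriction hT hℓ)
    (fun ℓ' hℓ' => H.exists_extension hT hℓ') ?_ ?_ ?_
  · rintro ℓ hℓ ℓ' hℓ' k' hk' ⟨r₁, r₂, r₃⟩ ⟨s₁, s₂, s₃⟩
    funext s
    rcases s with p | k
    · rw [← r₁, ← s₁]
    · by_cases hk : ∀ p, E.comp p ≠ k.1
      · rw [← r₂ k.1 hk k.2, ← s₂ k.1 hk k.2]
      · obtain ⟨e, he, harc⟩ := hstrand hk
        rw [← hcircle hℓ', ← hcircle hk', ← harc, ← r₃ e he, ← s₃ e he]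
  · rintro ℓ hℓ k hk ℓ' hℓ' ⟨r₁, r₂, r₃⟩ ⟨s₁, s₂, s₃⟩
    funext s
    rcases s with q | j
    · by_cases hq : q.1 ∈ K
      · exact hT.unique _ _ _ _ (H.isLocal hℓ) (H.isLocal hk)
          (fun e he => (r₃ e he).trans (s₃ e he).symm) q hq
      · obtain ⟨p, rfl⟩ := δ.exists_pass hq
        rw [r₁, s₁]
    · have h' : ∀ p, D.comp p ≠ j.1 := fun p => δ.comp_pass p ▸ j.2 _
      rw [r₂ j.1 j.2 h', s₂ j.1 j.2 h']
  · rintro Y hY ℓ hℓ ℓ' hℓ' ⟨r₁, r₂, r₃⟩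
    constructor
    · rintro h (p | k)
      · rw [← r₁]
        exact h _
      · by_cases hk : ∀ p, E.comp p ≠ k.1
        · rw [← r₂ k.1 hk k.2]
          exact h _
        · obtain ⟨e, he, harc⟩ := hstrand hk
          rw [← hcircle hℓ', ← harc, ← r₃ e he]
          exact (hY.zpow_mem_iff _ _).2 (h _)
    · rintro h (q | k)
      · by_cases hq : q.1 ∈ K
        · refine hT.closed Y hY _ _ (H.isLocal hℓ) (fun e he => ?_) q hq
          rw [r₃ e he]
          exact (hY.zpow_mem_iff _ _).2 (h _)
        · obtain ⟨p, rfl⟩ := δ.exists_pass hq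
          rw [r₁]
          exact h _
      · rw [r₂ k.1 k.2 fun p => δ.comp_pass p ▸ k.2 _]
        exact h _

end TwistData

end LinkDiagram

/-! ### Invariance under the moves which delete crossings -/

namespace Birack

variable {X : Type u} {𝓑 : Birack X} {ε : ℤˣ} {i o i' o' : Bool → X}

theorem crossRel_neg_iff : 𝓑.CrossRel (-ε) o i ↔ 𝓑.CrossRel ε i o := by
  rcases Int.units_eq_one_or ε with rfl | rfl <;> simp [CrossRel]

theorem CrossRel.in_unique (h : 𝓑.CrossRel ε i o) (h' : 𝓑.CrossRel ε i o') : o = o' := by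
  funext s
  rcases Int.units_eq_one_or ε with rfl | rfl <;> simp [CrossRel] at h h'
  · have := h.down_unique h'
    cases s
    exacts [this.1, this.2]
  · have := h.up_unique h'
    cases s
    exacts [this.2, this.1]

theorem CrossRel.mixed_unique (h : 𝓑.CrossRel ε i o) (h' : 𝓑.CrossRel ε i' o')
    (h₁ : i ovr = i' ovr) (h₂ : o und = o' und) : i = i' ∧ o = o' := by
  rcases Int.units_eq_one_or ε with rfl | rfl <;> simp [CrossRel] at h h'
  · rw [← h₁, ← h₂] at h'
    have := h.left_unique h'
    constructor <;> funext s <;> cases s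
    exacts [this.1, h₁, h₂, this.2]
  · rw [← h₁, ← h₂] at h'
    have := h.right_unique h'
    constructor <;> funext s <;> cases s
    exacts [this.2, h₁, h₂, this.1]

theorem CrossRel.mixed_unique' (h : 𝓑.CrossRel ε i o) (h' : 𝓑.CrossRel ε i' o')
    (h₁ : o ovr = o' ovr) (h₂ : i und = i' und) : i = i' ∧ o = o' :=
  ((crossRel_neg_iff.2 h).mixed_unique (crossRel_neg_iff.2 h') h₁ h₂).symm

variable (𝓑 ε) in
theorem exists_crossRel (i : Bool → X) : ∃ o, 𝓑.CrossRel ε i o := by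
  rcases Int.units_eq_one_or ε with rfl | rfl
  · obtain ⟨z, w, h⟩ := 𝓑.exists_cross_down (i ovr) (i und)
    exact ⟨fun s => bif s then w else z, by simpa [CrossRel] using h⟩
  · obtain ⟨x, y, h⟩ := 𝓑.exists_cross_up (i und) (i ovr)
    exact ⟨fun s => bif s then x else y, by simpa [CrossRel] using h⟩

variable (𝓑 ε) in
theorem exists_crossRel_mixed (x z : X) : ∃ i o, 𝓑.CrossRel ε i o ∧ i ovr = x ∧ o und = z := by
  rcases Int.units_eq_one_or ε with rfl | rfl
  · obtain ⟨y, w, h⟩ := 𝓑.exists_cross_left z x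
    exact ⟨fun s => bif s then x else y, fun s => bif s then w else z,
      by simpa [CrossRel] using h, rfl, rfl⟩
  · obtain ⟨y, w, h⟩ := 𝓑.exists_cross_right x z
    exact ⟨fun s => bif s then x else w, fun s => bif s then y else z,
      by simpa [CrossRel] using h, rfl, rfl⟩

theorem CrossRel.mem (h : 𝓑.CrossRel ε i o) {Y : Set X} (hY : 𝓑.IsClosed Y)
    (hi : ∀ s, i s ∈ Y) (s : Bool) : o s ∈ Y := by
  rcases Int.units_eq_one_or ε with rfl | rfl <;> simp [CrossRel] at h
  · have := hY.down h (hi _) (hi _)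
    cases s
    exacts [this.1, this.2]
  · have := hY.up h (hi _) (hi _)
    cases s
    exacts [this.2, this.1]

theorem CrossRel.mixed_mem (h : 𝓑.CrossRel ε i o) {Y : Set X} (hY : 𝓑.IsClosed Y)
    (h₁ : i ovr ∈ Y) (h₂ : o und ∈ Y) (s : Bool) : i s ∈ Y ∧ o s ∈ Y := by
  rcases Int.units_eq_one_or ε with rfl | rfl <;> simp [CrossRel] at h
  · have := hY.left h h₂ h₁
    cases s
    exacts [⟨this.2, h₂⟩, ⟨h₁, this.1⟩]
  · have := hY.right h h₁ h₂
    cases s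
    exacts [⟨this.1, h₂⟩, ⟨h₁, this.2⟩]

end Birack

namespace LinkDiagram

variable {c : ℕ} {X : Type u}

/-- The diagrams have the same twisted labelings, once the writhes of both are corrected by twists
to the same vector. -/
def SameTwisted (𝓑 : Birack X) (E D : LinkDiagram c) : Prop :=
  ∀ w m m', E.TwistsTo w m → D.TwistsTo w m' → LabelEquiv 𝓑 (E.twisted 𝓑 m) (D.twisted 𝓑 m')

theorem SameTwisted.symm {𝓑 : Birack X} {E D : LinkDiagram c} (h : SameTwisted 𝓑 E D) :
    SameTwisted 𝓑 D E := fun w m m' hm hm' => (h w m' m hm' hm).symm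

theorem exists_twistsTo (D : LinkDiagram c) (w : Fin c → ℤ) : ∃ m, D.TwistsTo w m := by
  obtain ⟨m, hm⟩ := D.exists_totalTwist fun k => w k - D.writhe k
  exact ⟨m, fun k => congrFun hm k⟩

theorem SameTwisted.trans {𝓑 : Birack X} {E D C : LinkDiagram c} (h : SameTwisted 𝓑 E D)
    (h' : SameTwisted 𝓑 D C) : SameTwisted 𝓑 E C := fun w m m' hm hm' => by
  obtain ⟨m₀, h₀⟩ := D.exists_twistsTo w
  exact (h w m m₀ hm h₀).trans (h' w m₀ m' h₀ hm')

theorem SameTwisted.refl (𝓑 : Birack X) (D : LinkDiagram c) : SameTwisted 𝓑 D D :=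
  fun w m m' hm hm' => twisted_equiv_of_totalTwist_eq 𝓑 (funext fun k => by rw [hm, hm'])

/-- Erasing tangles respects twisted labelings, if the holonomy of the erased strands agrees with
the change of the writhes. -/
theorem sameTwisted_of_deletion {E D : LinkDiagram c} {K : Set (Fin E.n)} (δ : Deletion E D K)
    {𝓑 : Birack X} {T : Finset (Fin E.n × Bool)} {ε : Fin E.n × Bool → ℤ}
    (hT : E.Erasable 𝓑 K T ε)
    (hw : ∀ k, E.writhe k = D.writhe k + ∑ e ∈ T, if E.comp e = k then ε e else 0) :
    SameTwisted 𝓑 E D := by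
  intro w m m' hm hm'
  obtain ⟨m₀, f, x, H⟩ := exists_twistData δ hT m'
  refine (twisted_equiv_of_totalTwist_eq 𝓑 (funext fun k => ?_)).trans (H.labelEquiv hT)
  rw [hm, H.totalTwist_eq hT, hm', hw]
  ring

theorem writhe_of_deletion {E D : LinkDiagram c} {K : Set (Fin E.n)} (δ : Deletion E D K)
    (F : Finset (Fin E.n)) (hF : ∀ v, v ∈ F ↔ v ∈ K) (k : Fin c) :
    E.writhe k = D.writhe k +
      ∑ v ∈ F, if E.comp (v, ovr) = k ∧ E.comp (v, und) = k then (E.sign v : ℤ) else 0 := by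
  classical
  have huniv : (Finset.univ : Finset (Fin E.n)) = Finset.univ.image δ.incl ∪ F := by
    refine (Finset.eq_univ_iff_forall.2 fun v => ?_).symm
    rw [Finset.mem_union, Finset.mem_image, hF]
    by_cases hv : v ∈ K
    · exact .inr hv
    · obtain ⟨w, hw⟩ : v ∈ Set.range δ.incl := by rwa [δ.range_eq]
      exact .inl ⟨w, Finset.mem_univ _, hw⟩
  have hdisj : Disjoint (Finset.univ.image δ.incl) F := by
    rw [Finset.disjoint_left]
    intro v hv hv'
    obtain ⟨w, -, rfl⟩ := Finset.mem_image.1 hv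
    exact δ.pass_notMem (w, true) ((hF _).1 hv')
  unfold writhe
  rw [huniv, Finset.sum_union hdisj, Finset.sum_image fun _ _ _ _ h => δ.injective h]
  simp only [δ.comp_incl, δ.sign_incl]

theorem erasable_empty (E : LinkDiagram c) (𝓑 : Birack X) (ε : Fin E.n × Bool → ℤ) :
    E.Erasable 𝓑 ∅ ∅ ε := by
  constructor <;> try simp
  exact fun b => ⟨b, b, by simp [IsLocal]⟩

theorem Erasable.union {E : LinkDiagram c} {𝓑 : Birack X} {K₁ K₂ : Set (Fin E.n)}
    {T₁ T₂ : Finset (Fin E.n × Bool)} {ε : Fin E.n × Bool → ℤ} (h₁ : E.Erasable 𝓑 K₁ T₁ ε)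
    (h₂ : E.Erasable 𝓑 K₂ T₂ ε) (hd : Disjoint K₁ K₂) :
    E.Erasable 𝓑 (K₁ ∪ K₂) (T₁ ∪ T₂) ε := by
  classical
  have hloc (i o) : E.IsLocal 𝓑 (K₁ ∪ K₂) (T₁ ∪ T₂) i o ↔
      E.IsLocal 𝓑 K₁ T₁ i o ∧ E.IsLocal 𝓑 K₂ T₂ i o := by
    simp only [IsLocal, Set.mem_union, Finset.mem_union, or_imp, forall_and]
    tauto
  have hT₁ {e} (he : e ∈ T₁) : e.1 ∈ K₁ := (h₁.mem_iff _).2 (.inl he)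
  have hT₂ {e} (he : e ∈ T₂) : e.1 ∈ K₂ := (h₂.mem_iff _).2 (.inl he)
  have hN₁ {e} (he : e ∈ T₁) : (E.next e).1 ∈ K₁ := (h₁.mem_iff _).2 (.inr ⟨e, he, rfl⟩)
  have hN₂ {e} (he : e ∈ T₂) : (E.next e).1 ∈ K₂ := (h₂.mem_iff _).2 (.inr ⟨e, he, rfl⟩)
  have hno {v} (hv : v ∈ K₂) : v ∉ K₁ := fun hv' => hd.notMem_of_mem_left hv' hv
  refine ⟨fun q => ?_, fun e he => ?_, fun i o hio e he => ?_, fun b => ?_,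
    fun i o i' o' hio hio' hi q hq => ?_, fun Y hY i o hio hi q hq => ?_⟩
  · rw [Set.mem_union, h₁.mem_iff, h₂.mem_iff]
    simp only [Finset.mem_union, or_and_right, exists_or]
    exact or_or_or_comm
  · rw [Finset.mem_union, not_or]
    rcases Finset.mem_union.1 he with he | he
    · exact ⟨h₁.next_notMem e he, fun h => hno (hT₂ h) (hN₁ he)⟩
    · exact ⟨fun h => hno (hN₂ he) (hT₁ h), h₂.next_notMem e he⟩
  · rw [hloc] at hio
    rcases Finset.mem_union.1 he with he | he
    exacts [h₁.holonomy i o hio.1 e he, h₂.holonomy i o hio.2 e he]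
  · obtain ⟨i₁, o₁, hio₁, hi₁⟩ := h₁.exists_local b
    obtain ⟨i₂, o₂, hio₂, hi₂⟩ := h₂.exists_local b
    refine ⟨fun q => if q.1 ∈ K₁ then i₁ q else i₂ q, fun q => if q.1 ∈ K₁ then o₁ q else o₂ q,
      (hloc _ _).2 ⟨⟨fun v hv => ?_, fun e he => ?_⟩, ⟨fun v hv => ?_, fun e he => ?_⟩⟩,
      fun e he => ?_⟩
    · simpa only [if_pos hv] using hio₁.1 v hv
    · simpa only [if_pos (hN₁ he), if_pos (hT₁ he)] using hio₁.2 e he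
    · simpa only [if_neg (hno hv)] using hio₂.1 v hv
    · simpa only [if_neg (hno (hN₂ he)), if_neg (hno (hT₂ he))] using hio₂.2 e he
    · rcases Finset.mem_union.1 he with he | he
      · simpa only [if_pos (hT₁ he)] using hi₁ e he
      · simpa only [if_neg (hno (hT₂ he))] using hi₂ e he
  · rw [hloc] at hio hio'
    rcases hq with hq | hq
    · exact h₁.unique i o i' o' hio.1 hio'.1 (fun e he => hi e (Finset.mem_union_left _ he)) q hq
    · exact h₂.unique i o i' o' hio.2 hio'.2 (fun e he => hi e (Finset.mem_union_right _ he)) q hq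
  · rw [hloc] at hio
    rcases hq with hq | hq
    · exact h₁.closed Y hY i o hio.1 (fun e he => hi e (Finset.mem_union_left _ he)) q hq
    · exact h₂.closed Y hY i o hio.2 (fun e he => hi e (Finset.mem_union_right _ he)) q hq

theorem IsKink.erasable {E : LinkDiagram c} {a : Fin E.n} {s : Bool} (h : E.IsKink a s)
    (𝓑 : Birack X) : E.Erasable 𝓑 {a} {(a, s)} fun q => E.sign q.1 := by
  unfold IsKink at h
  have hloc (i o) : E.IsLocal 𝓑 {a} {(a, s)} i o ↔ 𝓑.CrossRel (E.sign a)
      (fun s => i (a, s)) (fun s => o (a, s)) ∧ i (a, !s) = o (a, s) := by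
    simp [IsLocal, h]
  refine ⟨fun q => ?_, fun e he => ?_, fun i o hio e he => ?_, fun b => ?_,
    fun i o i' o' hio hio' hi q hq => ?_, fun Y hY i o hio hi q hq => ?_⟩
  · obtain ⟨v, t⟩ := q
    rcases Bool.eq_or_eq_not t s with rfl | rfl <;> simp [h, eq_comm]
  · rw [Finset.mem_singleton] at he
    simp [he, h]
  · rw [Finset.mem_singleton] at he
    rw [hloc] at hio
    rw [he, h]
    exact hio.1.kink hio.2
  · obtain ⟨i, o, hio, h₁, h₂⟩ := 𝓑.exists_crossRel_kink (E.sign a) s (b (a, s))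
    exact ⟨fun q => i q.2, fun q => o q.2, (hloc _ _).2 ⟨hio, h₁⟩, by simpa using h₂⟩
  · obtain ⟨v, t⟩ := q
    obtain rfl : v = a := hq
    rw [hloc] at hio hio'
    exact congrFun (hio.1.kink_unique hio'.1 hio.2 hio'.2 (hi _ (by simp))) t
  · obtain ⟨v, t⟩ := q
    obtain rfl : v = a := hq
    rw [hloc] at hio
    exact hio.1.kink_mem hio.2 hY (hi _ (by simp)) t

theorem IsKink.comp_eq {E : LinkDiagram c} {a : Fin E.n} {s : Bool} (h : E.IsKink a s) (t : Bool) :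
    E.comp (a, t) = E.comp (a, s) := by
  rcases Bool.eq_or_eq_not t s with rfl | rfl
  · rfl
  · rw [← show E.next (a, s) = (a, !s) from h, Deletion.comp_next]

theorem MoveI.sameTwisted {E D : LinkDiagram c} (h : MoveI E D) (𝓑 : Birack X) :
    SameTwisted 𝓑 E D := by
  obtain ⟨a, s, ha, hdel⟩ := h
  obtain ⟨δ⟩ := hdel.exists_deletion
  refine sameTwisted_of_deletion δ (ha.erasable 𝓑) fun k => ?_
  rw [writhe_of_deletion δ {a} (by simp) k]
  simp [ha.comp_eq ovr, ha.comp_eq und]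

theorem FramedMoveI.sameTwisted {E D : LinkDiagram c} (h : FramedMoveI E D) (𝓑 : Birack X) :
    SameTwisted 𝓑 E D := by
  obtain ⟨a, b, s, t, hab, -, ha, -, hb, hdel⟩ := h
  obtain ⟨δ⟩ := hdel.exists_deletion
  refine sameTwisted_of_deletion δ
    ((ha.erasable 𝓑).union (hb.erasable 𝓑) (by simpa using hab)) fun k => ?_
  rw [writhe_of_deletion δ {a, b} (by simp) k, Finset.sum_pair hab,
    Finset.sum_union (by simp [hab]), Finset.sum_singleton, Finset.sum_singleton]
  simp [ha.comp_eq ovr, ha.comp_eq und, hb.comp_eq ovr, hb.comp_eq und]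

theorem FramedMoveI.writhe_eq {E D : LinkDiagram c} (h : FramedMoveI E D) :
    E.writhe = D.writhe := by
  obtain ⟨a, b, s, t, hab, hs, ha, hn, hb, hdel⟩ := h
  obtain ⟨δ⟩ := hdel.exists_deletion
  funext k
  have hc : E.comp (b, t) = E.comp (a, s) := by
    rw [← hn, Deletion.comp_next, ha.comp_eq]
  rw [writhe_of_deletion δ {a, b} (by simp) k, Finset.sum_pair hab]
  simp [ha.comp_eq ovr, ha.comp_eq und, hb.comp_eq ovr, hb.comp_eq und, hc, hs]
  split_ifs <;> simp

/-- Two crossings of opposite sign which are consecutive on both strands. -/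
theorem erasable_bigon {E : LinkDiagram c} (𝓑 : Birack X) {a b : Fin E.n} (hab : a ≠ b)
    (hs : E.sign b = -E.sign a) (ho : E.next (a, ovr) = (b, ovr))
    (hu : E.next (a, und) = (b, und) ∨ E.next (b, und) = (a, und)) :
    ∃ T, E.Erasable 𝓑 {a, b} T fun _ => 0 := by
  have hsol {i o : Fin E.n × Bool → X}
      (hr : 𝓑.CrossRel (E.sign a) (fun s => i (a, s)) (fun s => o (a, s)))
      (h₁ : (fun s => i (b, s)) = fun s => o (a, s))
      (h₂ : (fun s => o (b, s)) = fun s => i (a, s)) :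
      𝓑.CrossRel (E.sign b) (fun s => i (b, s)) (fun s => o (b, s)) := by
    rw [h₁, h₂, hs, Birack.crossRel_neg_iff]
    exact hr
  have hext (i₁ o₁ : Bool → X) : ∃ i o : Fin E.n × Bool → X, (∀ s, i (a, s) = i₁ s) ∧
      (∀ s, o (a, s) = o₁ s) ∧ (∀ s, i (b, s) = o₁ s) ∧ ∀ s, o (b, s) = i₁ s :=
    ⟨fun q => if q.1 = a then i₁ q.2 else o₁ q.2, fun q => if q.1 = a then o₁ q.2 else i₁ q.2,
      by simp [hab.symm]⟩
  have hba := hab.symm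
  rcases hu with hu | hu
  · refine ⟨{(a, ovr), (a, und)}, ?_⟩
    have hloc {i o} (h : E.IsLocal 𝓑 {a, b} {(a, ovr), (a, und)} i o) :
        𝓑.CrossRel (E.sign a) (fun s => i (a, s)) (fun s => o (a, s)) ∧
        (∀ s, i (b, s) = o (a, s)) ∧ ∀ s, o (b, s) = i (a, s) := by
      have ha := h.1 a (by simp)
      have hb := h.1 b (by simp)
      have h₁ := h.2 (a, ovr) (by simp)
      have h₂ := h.2 (a, und) (by simp)
      rw [ho] at h₁
      rw [hu] at h₂
      have h₃ : (fun s => i (b, s)) = fun s => o (a, s) := by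
        funext s
        cases s
        exacts [h₂, h₁]
      rw [hs, h₃] at hb
      exact ⟨ha, congrFun h₃, congrFun (hb.in_unique (Birack.crossRel_neg_iff.2 ha))⟩
    refine ⟨fun q => ?_, fun e he => ?_, fun i o hio e he => ?_, fun β => ?_,
      fun i o i' o' hio hio' hi q hq => ?_, fun Y hY i o hio hi q hq => ?_⟩
    · obtain ⟨v, t⟩ := q
      cases t <;> simp [ho, hu, eq_comm]
    · simp only [Finset.mem_insert, Finset.mem_singleton] at he
      rcases he with rfl | rfl <;> simp [ho, hu, hba]
    · simp only [Finset.mem_insert, Finset.mem_singleton] at he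
      have := (hloc hio).2.2
      rcases he with rfl | rfl <;> simp [ho, hu, this]
    · obtain ⟨o₁, h₁⟩ := 𝓑.exists_crossRel (E.sign a) fun s => β (a, s)
      obtain ⟨i, o, h₂, h₃, h₄, h₅⟩ := hext (fun s => β (a, s)) o₁
      have hr : 𝓑.CrossRel (E.sign a) (fun s => i (a, s)) (fun s => o (a, s)) := by
        rwa [funext h₂, funext h₃]
      refine ⟨i, o, ⟨?_, ?_⟩, ?_⟩
      · rintro v (rfl | rfl)
        exacts [hr, hsol hr (by simp [h₃, h₄]) (by simp [h₂, h₅])]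
      · simp [ho, hu, h₃, h₄]
      · simp [h₂]
    · obtain ⟨h₁, h₂, h₃⟩ := hloc hio
      obtain ⟨k₁, k₂, k₃⟩ := hloc hio'
      have hia : (fun s => i (a, s)) = fun s => i' (a, s) := by
        funext s
        cases s <;> exact hi _ (by simp)
      obtain ⟨v, t⟩ := q
      rcases hq with rfl | rfl
      · rw [← hia] at k₁
        exact congrFun (h₁.in_unique k₁) t
      · rw [h₃, k₃]
        exact congrFun hia t
    · obtain ⟨h₁, h₂, h₃⟩ := hloc hio
      have hia : ∀ s, i (a, s) ∈ Y := by
        intro s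
        cases s <;> exact hi _ (by simp)
      obtain ⟨v, t⟩ := q
      rcases hq with rfl | rfl
      · exact h₁.mem hY hia t
      · rw [h₃]
        exact hia t
  · refine ⟨{(a, ovr), (b, und)}, ?_⟩
    have hloc {i o} (h : E.IsLocal 𝓑 {a, b} {(a, ovr), (b, und)} i o) :
        𝓑.CrossRel (E.sign a) (fun s => i (a, s)) (fun s => o (a, s)) ∧
        (∀ s, i (b, s) = o (a, s)) ∧ ∀ s, o (b, s) = i (a, s) := by
      have ha := h.1 a (by simp)
      have hb := h.1 b (by simp)
      have h₁ := h.2 (a, ovr) (by simp)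
      have h₂ := h.2 (b, und) (by simp)
      rw [ho] at h₁
      rw [hu] at h₂
      rw [hs, Birack.crossRel_neg_iff] at hb
      have := hb.mixed_unique' ha h₁ h₂.symm
      exact ⟨ha, congrFun this.2, congrFun this.1⟩
    refine ⟨fun q => ?_, fun e he => ?_, fun i o hio e he => ?_, fun β => ?_,
      fun i o i' o' hio hio' hi q hq => ?_, fun Y hY i o hio hi q hq => ?_⟩
    · obtain ⟨v, t⟩ := q
      cases t <;> simp [ho, hu, eq_comm, or_comm]
    · simp only [Finset.mem_insert, Finset.mem_singleton] at he
      rcases he with rfl | rfl <;> simp [ho, hu, hab, hba]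
    · simp only [Finset.mem_insert, Finset.mem_singleton] at he
      have := (hloc hio).2
      rcases he with rfl | rfl <;> simp [ho, hu, this]
    · obtain ⟨i₁, o₁, h₁, e₁, e₂⟩ :=
        𝓑.exists_crossRel_mixed (E.sign a) (β (a, ovr)) (β (b, und))
      obtain ⟨i, o, h₂, h₃, h₄, h₅⟩ := hext i₁ o₁
      have hr : 𝓑.CrossRel (E.sign a) (fun s => i (a, s)) (fun s => o (a, s)) := by
        rwa [funext h₂, funext h₃]
      refine ⟨i, o, ⟨?_, ?_⟩, ?_⟩
      · rintro v (rfl | rfl)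
        exacts [hr, hsol hr (by simp [h₃, h₄]) (by simp [h₂, h₅])]
      · simp [ho, hu, h₂, h₃, h₄, h₅]
      · simp [h₂, h₄, e₁, e₂]
    · obtain ⟨h₁, h₂, h₃⟩ := hloc hio
      obtain ⟨k₁, k₂, k₃⟩ := hloc hio'
      have := h₁.mixed_unique k₁ (hi _ (by simp))
        ((h₂ und).symm.trans ((hi (b, und) (by simp)).trans (k₂ und)))
      obtain ⟨v, t⟩ := q
      rcases hq with rfl | rfl
      · exact congrFun this.2 t
      · rw [h₃, k₃]
        exact congrFun this.1 t
    · obtain ⟨h₁, h₂, h₃⟩ := hloc hio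
      have := h₁.mixed_mem hY (hi _ (by simp)) (h₂ und ▸ hi (b, und) (by simp))
      obtain ⟨v, t⟩ := q
      rcases hq with rfl | rfl
      · exact (this t).2
      · rw [h₃]
        exact (this t).1

theorem MoveII.writhe_eq {E D : LinkDiagram c} (h : MoveII E D) : E.writhe = D.writhe := by
  obtain ⟨a, b, hab, hs, ho, hu, hdel⟩ := h
  obtain ⟨δ⟩ := hdel.exists_deletion
  funext k
  have h₁ : E.comp (b, ovr) = E.comp (a, ovr) := by rw [← ho, Deletion.comp_next]
  have h₂ : E.comp (b, und) = E.comp (a, und) := by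
    rcases hu with hu | hu <;> rw [← hu, Deletion.comp_next]
  rw [writhe_of_deletion δ {a, b} (by simp) k, Finset.sum_pair hab, h₁, h₂, hs]
  split_ifs <;> simp

theorem MoveII.sameTwisted {E D : LinkDiagram c} (h : MoveII E D) (𝓑 : Birack X) :
    SameTwisted 𝓑 E D := by
  have hw := h.writhe_eq
  obtain ⟨a, b, hab, hs, ho, hu, hdel⟩ := h
  obtain ⟨δ⟩ := hdel.exists_deletion
  obtain ⟨T, hT⟩ := erasable_bigon 𝓑 hab hs ho hu
  exact sameTwisted_of_deletion δ hT fun k => by simp [hw]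

theorem writhe_eq_of_isDeletion_empty {E D : LinkDiagram c} (h : IsDeletion E D ∅) :
    E.writhe = D.writhe := by
  obtain ⟨δ⟩ := h.exists_deletion
  funext k
  simp [writhe_of_deletion δ ∅ (by simp) k]

theorem sameTwisted_of_isDeletion_empty {E D : LinkDiagram c} (h : IsDeletion E D ∅)
    (𝓑 : Birack X) : SameTwisted 𝓑 E D := by
  obtain ⟨δ⟩ := h.exists_deletion
  exact sameTwisted_of_deletion δ (E.erasable_empty 𝓑 fun _ => 0) fun k => by
    simp [writhe_eq_of_isDeletion_empty h]

end LinkDiagram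

namespace LinkDiagram

variable {c : ℕ} {X : Type u}

/-! ### Invariance under type III moves -/

/-- The crossings of a triangle on its top, middle and bottom strand, first entries. -/
def strandFst {n : ℕ} (a b : Fin n) : Fin 3 → Fin n × Bool := ![(a, ovr), (a, und), (b, und)]

/-- The crossings of a triangle on its top, middle and bottom strand, second entries. -/
def strandSnd {n : ℕ} (b d : Fin n) : Fin 3 → Fin n × Bool := ![(b, ovr), (d, ovr), (d, und)]

/-- The directions of the strands of a triangle: whether the passage `strandFst` or `strandSnd`
comes first. -/
def strandSign (E : LinkDiagram c) (a b d : Fin E.n) (κ : ℤˣ) : Fin 3 → ℤˣ :=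
  ![κ * E.sign b, κ * E.sign d, κ * E.sign a * E.sign b * E.sign d]

/-- The first passage on each strand of a triangle. For `-κ` in place of `κ`, it is the second
passage. -/
def firstPass (E : LinkDiagram c) (a b d : Fin E.n) (κ : ℤˣ) (j : Fin 3) : Fin E.n × Bool :=
  if E.strandSign a b d κ j = 1 then strandFst a b j else strandSnd b d j

theorem strandSign_neg (E : LinkDiagram c) (a b d : Fin E.n) (κ : ℤˣ) (j : Fin 3) :
    E.strandSign a b d (-κ) j = -E.strandSign a b d κ j := by
  fin_cases j <;> simp [strandSign]

theorem firstPass_neg (E : LinkDiagram c) (a b d : Fin E.n) (κ : ℤˣ) (j : Fin 3) :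
    E.firstPass a b d (-κ) j =
      if E.strandSign a b d κ j = 1 then strandSnd b d j else strandFst a b j := by
  rw [firstPass, strandSign_neg]
  rcases Int.units_eq_one_or (E.strandSign a b d κ j) with h | h <;> simp [h]

theorem strandFst_injective {n : ℕ} {a b : Fin n} (hab : a ≠ b) :
    Function.Injective (strandFst a b) := by
  intro j j' h
  fin_cases j <;> fin_cases j' <;> simp_all [strandFst, eq_comm]

theorem strandSnd_injective {n : ℕ} {b d : Fin n} (hbd : b ≠ d) :
    Function.Injective (strandSnd b d) := by
  intro j j' h
  fin_cases j <;> fin_cases j' <;> simp_all [strandSnd, eq_comm]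

theorem strandFst_ne_strandSnd {n : ℕ} {a b d : Fin n} (hab : a ≠ b) (had : a ≠ d) (hbd : b ≠ d)
    (j j' : Fin 3) : strandFst a b j ≠ strandSnd b d j' := by
  fin_cases j <;> fin_cases j' <;> simp_all [strandFst, strandSnd]

section

variable {E : LinkDiagram c} {a b d : Fin E.n}

theorem firstPass_injective (hab : a ≠ b) (had : a ≠ d) (hbd : b ≠ d) (κ : ℤˣ) :
    Function.Injective (E.firstPass a b d κ) := by
  intro j j' h
  unfold firstPass at h
  split_ifs at h
  · exact strandFst_injective hab h
  · exact absurd h (strandFst_ne_strandSnd hab had hbd _ _)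
  · exact absurd h.symm (strandFst_ne_strandSnd hab had hbd _ _)
  · exact strandSnd_injective hbd h

theorem firstPass_ne (hab : a ≠ b) (had : a ≠ d) (hbd : b ≠ d) (κ : ℤˣ) (j j' : Fin 3) :
    E.firstPass a b d κ j ≠ E.firstPass a b d (-κ) j' := by
  intro h
  rw [firstPass_neg] at h
  unfold firstPass at h
  split_ifs at h with h₁ h₂ h₂
  · exact absurd h (strandFst_ne_strandSnd hab had hbd _ _)
  · have := strandFst_injective hab h
    exact h₂ (this ▸ h₁)
  · have := strandSnd_injective hbd h
    exact h₁ (this ▸ h₂)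
  · exact absurd h.symm (strandFst_ne_strandSnd hab had hbd _ _)

theorem fst_firstPass_mem (κ : ℤˣ) (j : Fin 3) :
    (E.firstPass a b d κ j).1 = a ∨ (E.firstPass a b d κ j).1 = b ∨
      (E.firstPass a b d κ j).1 = d := by
  unfold firstPass
  split_ifs <;> fin_cases j <;> simp [strandFst, strandSnd]

theorem exists_firstPass (κ : ℤˣ) {p : Fin E.n × Bool} (hp : p.1 = a ∨ p.1 = b ∨ p.1 = d) :
    ∃ j, p = E.firstPass a b d κ j ∨ p = E.firstPass a b d (-κ) j := by
  have h : ∃ j, p = strandFst a b j ∨ p = strandSnd b d j := by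
    obtain ⟨v, s⟩ := p
    rcases hp with rfl | rfl | rfl <;> cases s
    exacts [⟨1, .inl rfl⟩, ⟨0, .inl rfl⟩, ⟨2, .inl rfl⟩, ⟨0, .inr rfl⟩, ⟨2, .inr rfl⟩,
      ⟨1, .inr rfl⟩]
  obtain ⟨j, h⟩ := h
  refine ⟨j, ?_⟩
  rw [firstPass_neg]
  unfold firstPass
  split_ifs
  exacts [h, h.symm]

end

/-- The crossing relations at the three crossings of a triangle. -/
theorem triangle_iff (E : LinkDiagram c) (a b d : Fin E.n) (κ : ℤˣ) (𝓑 : Birack X)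
    (i o : Fin E.n × Bool → X)
    (h : ∀ j, i (E.firstPass a b d (-κ) j) = o (E.firstPass a b d κ j)) :
    (𝓑.CrossRel (E.sign a) (fun s => i (a, s)) (fun s => o (a, s)) ∧
      𝓑.CrossRel (E.sign b) (fun s => i (b, s)) (fun s => o (b, s)) ∧
      𝓑.CrossRel (E.sign d) (fun s => i (d, s)) (fun s => o (d, s))) ↔
    𝓑.Triangle (E.sign a) (E.sign b) (E.sign d) κ
      ![i (E.firstPass a b d κ 0), o (E.firstPass a b d (-κ) 0), i (E.firstPass a b d κ 1),
        o (E.firstPass a b d (-κ) 1), i (E.firstPass a b d κ 2), o (E.firstPass a b d (-κ) 2)]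
      (fun j => o (E.firstPass a b d κ j)) := by
  have key (j : Fin 3) : Birack.passLabels (E.strandSign a b d κ j) (i (E.firstPass a b d κ j))
      (o (E.firstPass a b d κ j)) (o (E.firstPass a b d (-κ) j)) =
        (i (strandFst a b j), o (strandFst a b j)) ∧
      Birack.passLabels (-E.strandSign a b d κ j) (i (E.firstPass a b d κ j))
      (o (E.firstPass a b d κ j)) (o (E.firstPass a b d (-κ) j)) =
        (i (strandSnd b d j), o (strandSnd b d j)) := by
    have hj := h j
    rw [firstPass_neg] at hj ⊢
    unfold firstPass at hj ⊢
    rcases Int.units_eq_one_or (E.strandSign a b d κ j) with hs | hs <;>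
      simp [hs, Birack.passLabels] at hj ⊢ <;> exact hj.symm
  have h₀ := key 0
  have h₁ := key 1
  have h₂ := key 2
  simp only [strandSign, strandFst, strandSnd, Matrix.cons_val] at h₀ h₁ h₂
  have hbool (f : Bool → X) : f = fun s => bif s then f ovr else f und := by
    funext s
    cases s <;> rfl
  simp only [Birack.Triangle, Matrix.cons_val, h₀.1, h₀.2, h₁.1, h₁.2, h₂.1, h₂.2]
  rw [hbool fun s => i (a, s), hbool fun s => o (a, s), hbool fun s => i (b, s),
    hbool fun s => o (b, s), hbool fun s => i (d, s), hbool fun s => o (d, s)]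

/-- Two diagrams with twists related by a type III move, where `pass` matches the passages in the
order in which they are met. -/
structure TriangleSlide (E D : LinkDiagram c) (m : E.Semiarc → ℤ) (m' : D.Semiarc → ℤ) where
  /-- the corners of the triangle -/
  a : Fin E.n
  /-- the corners of the triangle -/
  b : Fin E.n
  /-- the corners of the triangle -/
  d : Fin E.n
  /-- the side of the top-middle crossing on which the bottom strand lies -/
  κ : ℤˣ
  /-- the bijection of the crossings -/
  cross : Fin E.n ≃ Fin D.n
  /-- the bijection of the passages -/
  pass : Fin E.n × Bool ≃ Fin D.n × Bool
  a_ne_b : a ≠ b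
  a_ne_d : a ≠ d
  b_ne_d : b ≠ d
  sign_cross : ∀ v, D.sign (cross v) = E.sign v
  comp_pass : ∀ p, D.comp (pass p) = E.comp p
  next_first : ∀ j, E.next (E.firstPass a b d κ j) = E.firstPass a b d (-κ) j
  next_pass : ∀ p, D.next (pass p) = pass (E.next p)
  pass_first : ∀ j, pass (E.firstPass a b d κ j) =
    D.firstPass (cross a) (cross b) (cross d) (-κ) j
  pass_second : ∀ j, pass (E.firstPass a b d (-κ) j) =
    D.firstPass (cross a) (cross b) (cross d) κ j
  pass_other : ∀ v, v ≠ a → v ≠ b → v ≠ d → ∀ s, pass (v, s) = (cross v, s)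
  twist_first : ∀ j, m (.inl (E.firstPass a b d κ j)) = 0
  twist_pass : ∀ p, m' (.inl (pass p)) = m (.inl p)
  twist_free : ∀ k (h : ∀ p, E.comp p ≠ k) (h' : ∀ p, D.comp p ≠ k),
    m (.inr ⟨k, h⟩) = m' (.inr ⟨k, h'⟩)

namespace TriangleSlide

variable {E D : LinkDiagram c} {m : E.Semiarc → ℤ} {m' : D.Semiarc → ℤ} {𝓑 : Birack X}

/-- The inverse move. -/
def symm (H : TriangleSlide E D m m') : TriangleSlide D E m' m where
  a := H.cross H.a
  b := H.cross H.b
  d := H.cross H.d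
  κ := -H.κ
  cross := H.cross.symm
  pass := H.pass.symm
  a_ne_b := H.cross.injective.ne H.a_ne_b
  a_ne_d := H.cross.injective.ne H.a_ne_d
  b_ne_d := H.cross.injective.ne H.b_ne_d
  sign_cross v := by rw [← H.sign_cross, Equiv.apply_symm_apply]
  comp_pass p := by rw [← H.comp_pass, Equiv.apply_symm_apply]
  next_first j := by rw [← H.pass_first, H.next_pass, H.next_first, H.pass_second, neg_neg]
  next_pass p := by rw [Equiv.eq_symm_apply, ← H.next_pass, Equiv.apply_symm_apply]
  pass_first j := by simp [Equiv.symm_apply_eq, H.pass_first]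
  pass_second j := by simp [Equiv.symm_apply_eq, H.pass_second]
  pass_other v ha hb hd s := by
    rw [Equiv.symm_apply_eq, H.pass_other, Equiv.apply_symm_apply] <;>
      rwa [Ne, Equiv.symm_apply_eq]
  twist_first j := by rw [← H.pass_first, H.twist_pass, H.twist_first]
  twist_pass p := by rw [← H.twist_pass, Equiv.apply_symm_apply]
  twist_free k h h' := (H.twist_free k h' h).symm

/-- Correspondence between twisted labelings before and after a type III move: only the labels
inside the triangle change. -/
def Corresponds (H : TriangleSlide E D m m') (ℓ : E.Semiarc → X) (ℓ' : D.Semiarc → X) : Prop :=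
  (∀ p, (∀ j, p ≠ E.firstPass H.a H.b H.d H.κ j) → ℓ' (.inl (H.pass p)) = ℓ (.inl p)) ∧
  ∀ k (h : ∀ p, E.comp p ≠ k) (h' : ∀ p, D.comp p ≠ k), ℓ (.inr ⟨k, h⟩) = ℓ' (.inr ⟨k, h'⟩)

theorem Corresponds.symm {H : TriangleSlide E D m m'} {ℓ : E.Semiarc → X} {ℓ' : D.Semiarc → X}
    (h : H.Corresponds ℓ ℓ') : H.symm.Corresponds ℓ' ℓ := by
  refine ⟨fun p hp => ?_, fun k hk hk' => (h.2 k hk' hk).symm⟩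
  have := h.1 (H.pass.symm p) fun j hj => hp j ?_
  · rw [Equiv.apply_symm_apply] at this
    exact this.symm
  · rw [Equiv.symm_apply_eq, H.pass_first] at hj
    exact hj

theorem inLabel_pass_next (H : TriangleSlide E D m m') (ℓ' : D.Semiarc → X) (p) :
    D.inLabel 𝓑 m' ℓ' (H.pass (E.next p)) = (𝓑.kink ^ m (.inl p)) (ℓ' (.inl (H.pass p))) := by
  rw [← H.next_pass, inLabel_next, H.twist_pass]

theorem inLabel_second (H : TriangleSlide E D m m') (ℓ : E.Semiarc → X) (j) :
    E.inLabel 𝓑 m ℓ (E.firstPass H.a H.b H.d (-H.κ) j) =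
      ℓ (.inl (E.firstPass H.a H.b H.d H.κ j)) := by
  rw [← H.next_first, inLabel_next, H.twist_first, zpow_zero, Equiv.Perm.one_apply]

theorem inLabel_pass (H : TriangleSlide E D m m') {ℓ : E.Semiarc → X} {ℓ' : D.Semiarc → X}
    (h : H.Corresponds ℓ ℓ') (q) (hq : ∀ j, q ≠ E.firstPass H.a H.b H.d (-H.κ) j) :
    D.inLabel 𝓑 m' ℓ' (H.pass q) = E.inLabel 𝓑 m ℓ q := by
  obtain ⟨p, rfl⟩ := E.next.surjective q
  rw [H.inLabel_pass_next, inLabel_next, h.1 p]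
  rintro j rfl
  exact hq j (H.next_first j)

theorem notMem (H : TriangleSlide E D m m') {v} (ha : v ≠ H.a) (hb : v ≠ H.b) (hd : v ≠ H.d)
    (κ : ℤˣ) (s : Bool) (j) : (v, s) ≠ E.firstPass H.a H.b H.d κ j := by
  intro h
  rcases fst_firstPass_mem (E := E) (a := H.a) (b := H.b) (d := H.d) κ j with h' | h' | h' <;>
    rw [← h] at h'
  exacts [ha h', hb h', hd h']

variable (𝓑) in
/-- The boundary labels of the triangle. -/
noncomputable def boundary (H : TriangleSlide E D m m') (ℓ : E.Semiarc → X) : Fin 6 → X :=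
  ![E.inLabel 𝓑 m ℓ (E.firstPass H.a H.b H.d H.κ 0), ℓ (.inl (E.firstPass H.a H.b H.d (-H.κ) 0)),
    E.inLabel 𝓑 m ℓ (E.firstPass H.a H.b H.d H.κ 1), ℓ (.inl (E.firstPass H.a H.b H.d (-H.κ) 1)),
    E.inLabel 𝓑 m ℓ (E.firstPass H.a H.b H.d H.κ 2), ℓ (.inl (E.firstPass H.a H.b H.d (-H.κ) 2))]

theorem triangle_iff (H : TriangleSlide E D m m') (ℓ : E.Semiarc → X) :
    (∀ v, v = H.a ∨ v = H.b ∨ v = H.d → 𝓑.CrossRel (E.sign v)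
      (fun s => E.inLabel 𝓑 m ℓ (v, s)) (fun s => ℓ (E.outArc (v, s)))) ↔
    𝓑.Triangle (E.sign H.a) (E.sign H.b) (E.sign H.d) H.κ (H.boundary 𝓑 ℓ)
      fun j => ℓ (.inl (E.firstPass H.a H.b H.d H.κ j)) := by
  refine Iff.trans ?_ (E.triangle_iff H.a H.b H.d H.κ 𝓑 (E.inLabel 𝓑 m ℓ) (fun q => ℓ (.inl q))
    (H.inLabel_second ℓ))
  simp [outArc]

theorem boundary_eq (H : TriangleSlide E D m m') {ℓ : E.Semiarc → X} {ℓ' : D.Semiarc → X}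
    (h : H.Corresponds ℓ ℓ') : H.symm.boundary 𝓑 ℓ' = H.boundary 𝓑 ℓ := by
  have h₁ (j) : D.inLabel 𝓑 m' ℓ' (D.firstPass H.symm.a H.symm.b H.symm.d H.symm.κ j) =
      E.inLabel 𝓑 m ℓ (E.firstPass H.a H.b H.d H.κ j) := by
    rw [← H.inLabel_pass h _ fun j' => firstPass_ne H.a_ne_b H.a_ne_d H.b_ne_d H.κ j j',
      H.pass_first]
    rfl
  have h₂ (j) : ℓ' (.inl (D.firstPass H.symm.a H.symm.b H.symm.d (-H.symm.κ) j)) =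
      ℓ (.inl (E.firstPass H.a H.b H.d (-H.κ) j)) := by
    rw [← h.1 _ fun j' => (firstPass_ne H.a_ne_b H.a_ne_d H.b_ne_d H.κ j' j).symm, H.pass_second]
    simp [TriangleSlide.symm]
  simp only [boundary, h₁, h₂]

theorem triangle_symm_iff (H : TriangleSlide E D m m') {ℓ : E.Semiarc → X} {ℓ' : D.Semiarc → X}
    (h : H.Corresponds ℓ ℓ') : (∀ v, v = H.a ∨ v = H.b ∨ v = H.d → 𝓑.CrossRel (D.sign (H.cross v))
      (fun s => D.inLabel 𝓑 m' ℓ' (H.cross v, s)) (fun s => ℓ' (D.outArc (H.cross v, s)))) ↔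
    𝓑.Triangle (E.sign H.a) (E.sign H.b) (E.sign H.d) (-H.κ) (H.boundary 𝓑 ℓ)
      fun j => ℓ' (.inl (H.pass (E.firstPass H.a H.b H.d H.κ j))) := by
  have := H.symm.triangle_iff (𝓑 := 𝓑) ℓ'
  rw [H.boundary_eq h] at this
  simp only [TriangleSlide.symm, H.sign_cross, ← H.pass_first] at this
  rw [← this]
  simp [H.sign_cross]

theorem exists_corresponds (H : TriangleSlide E D m m') {ℓ : E.Semiarc → X}
    (hℓ : ℓ ∈ E.twisted 𝓑 m) : ∃ ℓ' ∈ D.twisted 𝓑 m', H.Corresponds ℓ ℓ' := by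
  classical
  obtain ⟨v, hv⟩ := ((H.triangle_iff ℓ).1 fun v _ => hℓ.1 v).flip
  have hfree (k : Fin c) : (∀ p, D.comp p ≠ k) ↔ ∀ p, E.comp p ≠ k := by
    rw [← H.pass.forall_congr_right (q := fun p => D.comp p ≠ k)]
    simp only [H.comp_pass]
  let ℓ' : D.Semiarc → X := Sum.elim
    (fun p => if h : ∃ j, H.pass.symm p = E.firstPass H.a H.b H.d H.κ j then v h.choose
      else ℓ (.inl (H.pass.symm p)))
    (fun k => ℓ (.inr ⟨k.1, (hfree k.1).1 k.2⟩))
  have hc : H.Corresponds ℓ ℓ' := by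
    refine ⟨fun p hp => ?_, fun k h h' => rfl⟩
    simp only [ℓ', Sum.elim_inl, Equiv.symm_apply_apply]
    rw [dif_neg (by push Not; exact hp)]
  have hinner (j) : ℓ' (.inl (H.pass (E.firstPass H.a H.b H.d H.κ j))) = v j := by
    have h : ∃ j', E.firstPass H.a H.b H.d H.κ j = E.firstPass H.a H.b H.d H.κ j' := ⟨j, rfl⟩
    simp only [ℓ', Sum.elim_inl, Equiv.symm_apply_apply]
    rw [dif_pos h]
    exact congrArg v (firstPass_injective H.a_ne_b H.a_ne_d H.b_ne_d _ h.choose_spec.symm)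
  refine ⟨ℓ', ⟨fun w => ?_, fun k => ?_⟩, hc⟩
  · obtain ⟨w, rfl⟩ := H.cross.surjective w
    by_cases hw : w = H.a ∨ w = H.b ∨ w = H.d
    · refine (H.triangle_symm_iff hc).2 ?_ w hw
      simp only [hinner]
      exact hv
    · push Not at hw
      obtain ⟨ha, hb, hd⟩ := hw
      have h := hℓ.1 w
      rw [← H.sign_cross] at h
      have e₁ : (fun s => D.inLabel 𝓑 m' ℓ' (H.cross w, s)) =
          fun s => E.inLabel 𝓑 m ℓ (w, s) := by
        funext s
        rw [← H.pass_other w ha hb hd]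
        exact H.inLabel_pass hc _ (H.notMem ha hb hd _ s)
      have e₂ : (fun s => ℓ' (D.outArc (H.cross w, s))) = fun s => ℓ (E.outArc (w, s)) := by
        funext s
        rw [← H.pass_other w ha hb hd]
        exact hc.1 _ (H.notMem ha hb hd _ s)
      rw [e₁, e₂]
      exact h
  · rw [← H.twist_free k.1 ((hfree k.1).1 k.2) k.2]
    exact hℓ.2 _

theorem corresponds_unique (H : TriangleSlide E D m m') {ℓ : E.Semiarc → X}
    {ℓ' k' : D.Semiarc → X} (hℓ' : ℓ' ∈ D.twisted 𝓑 m')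
    (hk' : k' ∈ D.twisted 𝓑 m') (h : H.Corresponds ℓ ℓ') (h' : H.Corresponds ℓ k') : ℓ' = k' := by
  have t := ((H.triangle_symm_iff h).1 fun v _ => hℓ'.1 (H.cross v)).unique
    ((H.triangle_symm_iff h').1 fun v _ => hk'.1 (H.cross v))
  funext s
  rcases s with p | k
  · obtain ⟨p, rfl⟩ := H.pass.surjective p
    by_cases hp : ∃ j, p = E.firstPass H.a H.b H.d H.κ j
    · obtain ⟨j, rfl⟩ := hp
      exact congrFun t j
    · push Not at hp
      rw [h.1 p hp, h'.1 p hp]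
  · have hk : ∀ p, E.comp p ≠ k.1 := fun p => H.comp_pass p ▸ k.2 _
    rw [← h.2 k.1 hk k.2, ← h'.2 k.1 hk k.2]

theorem mem_of_corresponds (H : TriangleSlide E D m m') {ℓ : E.Semiarc → X}
    {ℓ' : D.Semiarc → X} (hℓ' : ℓ' ∈ D.twisted 𝓑 m') (h : H.Corresponds ℓ ℓ') {Y : Set X}
    (hY : 𝓑.IsClosed Y) (hmem : ∀ s, ℓ s ∈ Y) (s : D.Semiarc) : ℓ' s ∈ Y := by
  have t := ((H.triangle_symm_iff h).1 fun v _ => hℓ'.1 (H.cross v)).mem hY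
    (by
      intro i
      fin_cases i <;> simp [boundary, inLabel, hY.zpow_mem_iff, hmem])
  rcases s with p | k
  · obtain ⟨p, rfl⟩ := H.pass.surjective p
    by_cases hp : ∃ j, p = E.firstPass H.a H.b H.d H.κ j
    · obtain ⟨j, rfl⟩ := hp
      exact t j
    · push Not at hp
      rw [h.1 p hp]
      exact hmem _
  · rw [← h.2 k.1 (fun p => H.comp_pass p ▸ k.2 _) k.2]
    exact hmem _

theorem labelEquiv (H : TriangleSlide E D m m') (𝓑 : Birack X) :
    LabelEquiv 𝓑 (E.twisted 𝓑 m) (D.twisted 𝓑 m') := by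
  refine LabelEquiv.of_rel H.Corresponds (fun ℓ hℓ => H.exists_corresponds hℓ)
    (fun ℓ' hℓ' => ?_) (fun ℓ _ ℓ' hℓ' k' hk' h h' => H.corresponds_unique hℓ' hk' h h')
    (fun ℓ hℓ k hk ℓ' _ h h' => H.symm.corresponds_unique hℓ hk h.symm h'.symm)
    fun Y hY ℓ hℓ ℓ' hℓ' h => ⟨fun hm => H.mem_of_corresponds hℓ' h hY hm,
      fun hm => H.symm.mem_of_corresponds hℓ h.symm hY hm⟩
  obtain ⟨ℓ, hℓ, h⟩ := H.symm.exists_corresponds hℓ'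
  refine ⟨ℓ, hℓ, fun p hp => ?_, fun k hk hk' => (h.2 k hk' hk).symm⟩
  have := h.1 (H.pass p) fun j hj => hp j ?_
  · simp only [TriangleSlide.symm, Equiv.symm_apply_apply] at this
    exact this.symm
  · simp only [TriangleSlide.symm, ← H.pass_first] at hj
    exact H.pass.injective hj

end TriangleSlide

/-- A twist can be pushed off a set of semiarcs no two of which are consecutive. -/
theorem exists_twist_eq_zero (E : LinkDiagram c) (m : E.Semiarc → ℤ) (F : Set (Fin E.n × Bool))
    (hF : ∀ p ∈ F, E.next p ∉ F) :
    ∃ m', E.totalTwist m' = E.totalTwist m ∧ ∀ p ∈ F, m' (.inl p) = 0 := by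
  classical
  let g : Fin E.n × Bool → ℤ := fun p => if p ∈ F then m (.inl p) else 0
  refine ⟨Sum.elim (fun p => m (.inl p) - g p + g (E.next.symm p)) fun k => m (.inr k),
    funext fun k => ?_, fun p hp => ?_⟩
  · unfold totalTwist
    refine congrArg₂ (· + ·) ?_ rfl
    have h : ∑ p, (if E.comp p = k then g (E.next.symm p) else 0) =
        ∑ p, if E.comp p = k then g p else 0 := by
      rw [← Equiv.sum_comp E.next]
      simp [Deletion.comp_next]
    have h' : ∀ p, (if E.comp p = k then m (.inl p) - g p + g (E.next.symm p) else 0) =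
        (if E.comp p = k then m (.inl p) else 0) - (if E.comp p = k then g p else 0) +
          if E.comp p = k then g (E.next.symm p) else 0 := fun p => by split_ifs <;> simp
    simp only [Sum.elim_inl, h', Finset.sum_add_distrib, Finset.sum_sub_distrib, h]
    ring
  · have : E.next.symm p ∉ F := fun h => hF _ h (by simpa using hp)
    simp [g, hp, this]

theorem MoveIII.writhe_eq {E D : LinkDiagram c} (h : MoveIII E D) : E.writhe = D.writhe := by
  obtain ⟨a, b, d, κ, e, -, -, -, -, -, -, hs, hc, -⟩ := h
  funext k
  unfold writhe
  rw [← Equiv.sum_comp e]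
  simp only [hs, hc]

theorem MoveIII.sameTwisted {E D : LinkDiagram c} (h : MoveIII E D) (𝓑 : Birack X) :
    SameTwisted 𝓑 E D := by
  intro w m₀ m₀' hm₀ hm₀'
  have hw := h.writhe_eq
  obtain ⟨a, b, d, κ, e, hab, had, hbd, ht, hm, hb, hs, hc, hn⟩ := h
  have hprec (j) : E.Precedes (E.strandSign a b d κ j) (strandFst a b j) (strandSnd b d j) := by
    fin_cases j
    exacts [ht, hm, hb]
  have hnext (j) : E.next (E.firstPass a b d κ j) = E.firstPass a b d (-κ) j := by
    have := hprec j
    rw [firstPass_neg]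
    unfold firstPass
    unfold Precedes at this
    split_ifs at this ⊢ <;> exact this
  obtain ⟨m, hmtot, hmzero⟩ := E.exists_twist_eq_zero m₀
    (Set.range (E.firstPass a b d κ)) (by
      rintro _ ⟨j, rfl⟩ ⟨j', hj'⟩
      rw [hnext] at hj'
      exact firstPass_ne hab had hbd κ j' j hj')
  let τ : Equiv.Perm (Fin E.n × Bool) := Equiv.swap (a, ovr) (b, ovr) *
    Equiv.swap (a, und) (d, ovr) * Equiv.swap (b, und) (d, und)
  have hτfst (j) : τ (strandFst a b j) = strandSnd b d j := by
    fin_cases j <;>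
      simp [τ, strandFst, strandSnd, Equiv.swap_apply_def, hab, had, had.symm, hbd.symm]
  have hτsnd (j) : τ (strandSnd b d j) = strandFst a b j := by
    fin_cases j <;>
      simp [τ, strandFst, strandSnd, Equiv.swap_apply_def, hab, hbd, hab.symm, hbd.symm]
  have hτ₁ (κ' j) : τ (E.firstPass a b d κ' j) = E.firstPass a b d (-κ') j := by
    rw [firstPass_neg]
    unfold firstPass
    split_ifs
    exacts [hτfst j, hτsnd j]
  have hτother (v) (ha : v ≠ a) (hb : v ≠ b) (hd : v ≠ d) (s) : τ (v, s) = (v, s) := by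
    simp [τ, Equiv.swap_apply_def, ha, hb, hd]
  have hfirst (κ' j) : D.firstPass (e a) (e b) (e d) κ' j =
      Prod.map e id (E.firstPass a b d κ' j) := by
    have h₁ : D.strandSign (e a) (e b) (e d) κ' j = E.strandSign a b d κ' j := by
      fin_cases j <;> simp [strandSign, hs]
    have h₂ : strandFst (e a) (e b) j = Prod.map e id (strandFst a b j) := by
      fin_cases j <;> rfl
    have h₃ : strandSnd (e b) (e d) j = Prod.map e id (strandSnd b d j) := by
      fin_cases j <;> rfl
    rw [firstPass, h₁, h₂, h₃, firstPass]
    split_ifs <;> rfl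
  let pass : Fin E.n × Bool ≃ Fin D.n × Bool := τ.trans (Equiv.prodCongr e (Equiv.refl Bool))
  have hpass (p) : pass p = Prod.map e id (τ p) := rfl
  have hcomp (p) : D.comp (pass p) = E.comp p := by
    rw [hpass]
    refine (hc _ _).trans ?_
    show E.comp (τ p) = E.comp p
    by_cases hp : p.1 = a ∨ p.1 = b ∨ p.1 = d
    · obtain ⟨j, rfl | rfl⟩ := exists_firstPass (E := E) (a := a) (b := b) (d := d) κ hp
      · rw [hτ₁, ← hnext, Deletion.comp_next]
      · rw [hτ₁, neg_neg, ← hnext, Deletion.comp_next]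
    · push Not at hp
      rw [hτother p.1 hp.1 hp.2.1 hp.2.2 p.2]
  have hfree (k : Fin c) : (∀ p, D.comp p ≠ k) ↔ ∀ p, E.comp p ≠ k := by
    rw [← pass.forall_congr_right (q := fun p => D.comp p ≠ k)]
    simp only [hcomp]
  let m' : D.Semiarc → ℤ := Sum.elim (fun p => m (.inl (pass.symm p)))
    fun k => m (.inr ⟨k.1, (hfree k.1).1 k.2⟩)
  let H : TriangleSlide E D m m' :=
    { a := a, b := b, d := d, κ := κ, cross := e, pass := pass
      a_ne_b := hab, a_ne_d := had, b_ne_d := hbd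
      sign_cross := hs
      comp_pass := hcomp
      next_first := hnext
      next_pass := hn
      pass_first := fun j => by rw [hpass, hτ₁, hfirst]
      pass_second := fun j => by rw [hpass, hτ₁, neg_neg, hfirst]
      pass_other := fun v ha hb hd s => by rw [hpass, hτother v ha hb hd]; rfl
      twist_first := fun j => hmzero _ ⟨j, rfl⟩
      twist_pass := fun p => by simp [m']
      twist_free := fun k h h' => rfl }
  have htot : D.totalTwist m' = E.totalTwist m := by
    funext k
    unfold totalTwist
    congr 1
    · rw [← Equiv.sum_comp pass]
      simp [hcomp, m']
    · by_cases h : ∀ p, D.comp p ≠ k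
      · rw [dif_pos h, dif_pos ((hfree k).1 h)]
        rfl
      · rw [dif_neg h, dif_neg (mt (hfree k).2 h)]
  refine ((twisted_equiv_of_totalTwist_eq 𝓑 hmtot.symm).trans (H.labelEquiv 𝓑)).trans
    (twisted_equiv_of_totalTwist_eq 𝓑 (funext fun k => ?_))
  rw [htot, hmtot, hm₀, hm₀', hw]

/-! ### Labelings of links -/

theorem Move.sameTwisted {E D : LinkDiagram c} (h : Move E D) (𝓑 : Birack X) :
    SameTwisted 𝓑 E D := by
  rcases h with h | h | h | h
  exacts [sameTwisted_of_isDeletion_empty h 𝓑, h.sameTwisted 𝓑, h.sameTwisted 𝓑, h.sameTwisted 𝓑]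

theorem FramedMove.sameTwisted {E D : LinkDiagram c} (h : FramedMove E D) (𝓑 : Birack X) :
    SameTwisted 𝓑 E D := by
  rcases h with h | h | h | h
  exacts [sameTwisted_of_isDeletion_empty h 𝓑, h.sameTwisted 𝓑, h.sameTwisted 𝓑, h.sameTwisted 𝓑]

theorem FramedMove.writhe_eq {E D : LinkDiagram c} (h : FramedMove E D) : E.writhe = D.writhe := by
  rcases h with h | h | h | h
  exacts [writhe_eq_of_isDeletion_empty h, h.writhe_eq, h.writhe_eq, h.writhe_eq]

end LinkDiagram

section

open LinkDiagram

variable {X : Type u} (𝓑 : Birack X) {𝓚 : Kind} {c : ℕ}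

theorem sameTwisted_of_link_eq {D D' : Diagram 𝓚 c} (h : D.link = D'.link) :
    SameTwisted 𝓑 D.1 D'.1 := by
  have := Quot.eqvGen_exact h
  clear h
  induction this with
  | rel E D h => exact h.sameTwisted 𝓑
  | refl D => exact .refl 𝓑 D.1
  | symm _ _ _ ih => exact ih.symm
  | trans _ _ _ _ _ ih₁ ih₂ => exact ih₁.trans ih₂

theorem sameTwisted_of_framedLink_eq {D D' : Diagram 𝓚 c} (h : D.framedLink = D'.framedLink) :
    SameTwisted 𝓑 D.1 D'.1 ∧ D.1.writhe = D'.1.writhe := by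
  have := Quot.eqvGen_exact h
  clear h
  induction this with
  | rel E D h => exact ⟨h.sameTwisted 𝓑, h.writhe_eq⟩
  | refl D => exact ⟨.refl 𝓑 D.1, rfl⟩
  | symm _ _ _ ih => exact ⟨ih.1.symm, ih.2.symm⟩
  | trans _ _ _ _ _ ih₁ ih₂ => exact ⟨ih₁.1.trans ih₂.1, ih₁.2.trans ih₂.2⟩

/-- Untwisted labelings only depend on the twisted labelings and the writhes modulo the rank. -/
theorem LinkDiagram.SameTwisted.labelEquiv {𝓑 : Birack X} {E D : LinkDiagram c}
    (h : SameTwisted 𝓑 E D) (hw : ∀ k, E.writhe k ≡ D.writhe k [ZMOD 𝓑.rank]) :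
    LabelEquiv 𝓑 (E.twisted 𝓑 fun _ => 0) (D.twisted 𝓑 fun _ => 0) := by
  choose t ht using fun k => (hw k).symm.dvd
  obtain ⟨m, hm⟩ := D.exists_totalTwist t
  rw [← D.twisted_rank_mul 𝓑 m]
  refine h E.writhe _ _ (fun k => ?_) fun k => ?_
  · rw [totalTwist_zero, sub_self]
  · rw [totalTwist_mul, hm, ht]

theorem LabelEquiv.nonempty_labeling_equiv {𝓑 : Birack X} {E D : LinkDiagram c}
    (h : LabelEquiv 𝓑 (E.twisted 𝓑 fun _ => 0) (D.twisted 𝓑 fun _ => 0)) :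
    Nonempty (E.Labeling 𝓑 ≃ D.Labeling 𝓑) := by
  obtain ⟨e, -⟩ := h
  exact ⟨((E.labelingEquiv 𝓑).trans e).trans (D.labelingEquiv 𝓑).symm⟩

/-- A bijection of labelings gives a bijection of homomorphisms which preserves the images. -/
theorem LabelEquiv.exists_hom_equiv [Finite X] {𝓑 : Birack X} {E D : LinkDiagram c}
    (h : LabelEquiv 𝓑 (E.twisted 𝓑 fun _ => 0) (D.twisted 𝓑 fun _ => 0)) :
    ∃ e : E.HomTo 𝓑 ≃ D.HomTo 𝓑, ∀ f, (e f).image = f.image := by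
  obtain ⟨e, he⟩ := h
  let g (C : LinkDiagram c) : C.HomTo 𝓑 ≃ C.twisted 𝓑 fun _ => 0 :=
    (Equiv.ofBijective _ (C.labelingOfHom_bijective 𝓑)).trans (C.labelingEquiv 𝓑)
  have hg (C : LinkDiagram c) (f : C.HomTo 𝓑) : f.image =
      ⋂₀ {Y | 𝓑.IsClosed Y ∧ ∀ s, (g C f).1 s ∈ Y} := C.image_eq_sInter 𝓑 f
  refine ⟨((g E).trans e).trans (g D).symm, fun f => ?_⟩
  rw [hg, hg]
  refine congrArg Set.sInter (Set.ext fun Y => and_congr_right fun hY => ?_)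
  rw [he Y hY]
  simp

end

/-! ### Counting cycles -/

/-- A permutation `φ'` of a larger set, whose cycles are the cycles of `φ` with some points
inserted, together with new cycles indexed by `R`. -/
theorem card_cycles_eq {A A' R : Type*} [Finite A] [Finite R] (φ : Equiv.Perm A)
    (φ' : Equiv.Perm A') (j : A → A') (ρ : R → A')
    (F : A' → Quotient (Equiv.Perm.SameCycle.setoid φ) ⊕ R) (hF : ∀ x, F (φ' x) = F x)
    (hFj : ∀ a, F (j a) = .inl (Quotient.mk _ a)) (hFρ : ∀ r, F (ρ r) = .inr r)
    (hj : ∀ a, φ'.SameCycle (j (φ a)) (j a))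
    (hx : ∀ x, (∃ a, φ'.SameCycle x (j a)) ∨ ∃ r, φ'.SameCycle x (ρ r)) :
    Nat.card (Quotient (Equiv.Perm.SameCycle.setoid φ')) =
      Nat.card (Quotient (Equiv.Perm.SameCycle.setoid φ)) + Nat.card R := by
  have hF' : ∀ x y, φ'.SameCycle x y → F x = F y := by
    rintro x y ⟨n, rfl⟩
    induction n with
    | zero => rfl
    | succ n ih => rw [add_comm, zpow_add, Equiv.Perm.mul_apply, zpow_one, hF, ih]
    | pred n ih =>
      rw [ih, sub_eq_add_neg, add_comm, zpow_add, Equiv.Perm.mul_apply, zpow_neg_one]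
      have := hF (φ'⁻¹ ((φ' ^ (-n : ℤ)) x))
      rwa [← Equiv.Perm.mul_apply, mul_inv_cancel, Equiv.Perm.one_apply] at this
  have hj' : ∀ a b, φ.SameCycle a b → φ'.SameCycle (j a) (j b) := by
    intro a b hab
    obtain ⟨n, rfl⟩ := hab.exists_nat_pow_eq
    clear hab
    induction n with
    | zero => exact .refl _ _
    | succ n ih =>
      rw [pow_succ', Equiv.Perm.mul_apply]
      exact ih.trans (hj _).symm
  rw [← Nat.card_sum]
  refine Nat.card_eq_of_bijective (Quotient.lift F hF') ⟨?_, ?_⟩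
  · rintro ⟨x⟩ ⟨y⟩ (h : F x = F y)
    refine Quotient.sound (?_ : φ'.SameCycle x y)
    rcases hx x with ⟨a, ha⟩ | ⟨r, hr⟩ <;> rcases hx y with ⟨b, hb⟩ | ⟨r', hr'⟩
    · rw [hF' _ _ ha, hF' _ _ hb, hFj, hFj, Sum.inl.injEq] at h
      exact (ha.trans (hj' a b (Quotient.exact h))).trans hb.symm
    · simp [hF' _ _ ha, hF' _ _ hr', hFj, hFρ] at h
    · simp [hF' _ _ hr, hF' _ _ hb, hFj, hFρ] at h
    · rw [hF' _ _ hr, hF' _ _ hr', hFρ, hFρ, Sum.inr.injEq] at h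
      subst h
      exact hr.trans hr'.symm
  · rintro (q | r)
    · induction q using Quotient.inductionOn with
      | h a => exact ⟨Quotient.mk _ (j a), hFj a⟩
    · exact ⟨Quotient.mk _ (ρ r), hFρ r⟩

namespace LinkDiagram

variable {c : ℕ}

/-! ### Inserting kinks -/

/-- The passages of a diagram with a further crossing of sign `ε`. The passages `inr true` and `inr
false` through the new crossing are its first and second one, where a positive crossing is first
passed over and a negative one is first passed under. -/
def addPass (n : ℕ) (ε : ℤˣ) : (Fin n × Bool) ⊕ Bool ≃ Fin (n + 1) × Bool where
  toFun := Sum.elim (fun p => (p.1.castSucc, p.2))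
    fun b => (Fin.last n, if ε = 1 then b else !b)
  invFun q := Fin.lastCases (motive := fun _ => (Fin n × Bool) ⊕ Bool)
    (.inr (if ε = 1 then q.2 else !q.2)) (fun v => .inl (v, q.2)) q.1
  left_inv := by
    rintro (⟨v, s⟩ | b)
    · simp
    · by_cases h : ε = 1 <;> simp [h]
  right_inv := by
    rintro ⟨v, s⟩
    induction v using Fin.lastCases with
    | last => by_cases h : ε = 1 <;> simp [h]
    | cast v => simp

theorem addPass_inl (n : ℕ) (ε : ℤˣ) (p : Fin n × Bool) :
    addPass n ε (.inl p) = (p.1.castSucc, p.2) := rfl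

theorem addPass_inr (n : ℕ) (ε : ℤˣ) (b : Bool) :
    addPass n ε (.inr b) = (Fin.last n, if ε = 1 then b else !b) := rfl

theorem sameCycle_permCongr {A A' : Type*} (e : A ≃ A') (N : Equiv.Perm A) (x y : A) :
    (e.permCongr N).SameCycle (e x) (e y) ↔ N.SameCycle x y := by
  have h (i : ℤ) : (e.permCongr N) ^ i = e.permCongr (N ^ i) := (map_zpow e.permCongrHom N i).symm
  simp [Equiv.Perm.SameCycle, h, Equiv.permCongr_apply]

/-- The diagram with a further crossing of sign `ε`, for given order `N` of passages and components
`C`. -/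
def addCrossing (D : LinkDiagram c) (ε : ℤˣ) (N : Equiv.Perm ((Fin D.n × Bool) ⊕ Bool))
    (C : (Fin D.n × Bool) ⊕ Bool → Fin c) (hC : ∀ x y, C x = C y ↔ N.SameCycle x y) :
    LinkDiagram c where
  n := D.n + 1
  sign := Fin.snoc (α := fun _ => ℤˣ) D.sign ε
  next := (addPass D.n ε).permCongr N
  comp q := C ((addPass D.n ε).symm q)
  comp_eq_iff p q := by
    rw [hC, ← sameCycle_permCongr (addPass D.n ε), Equiv.apply_symm_apply, Equiv.apply_symm_apply]

/-- The diagram `E` arises from `D` by the insertion of a crossing of sign `ε`, for given order `N`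
of passages and components `C`. -/
structure Insertion (D E : LinkDiagram c) (ε : ℤˣ) (N : Equiv.Perm ((Fin D.n × Bool) ⊕ Bool))
    (C : (Fin D.n × Bool) ⊕ Bool → Fin c) where
  /-- the inclusion of the old crossings -/
  incl : Fin D.n → Fin E.n
  /-- the new crossing -/
  new : Fin E.n
  /-- the old and the new passages -/
  pass : (Fin D.n × Bool) ⊕ Bool ≃ Fin E.n × Bool
  card_eq : E.n = D.n + 1
  pass_inl : ∀ p, pass (.inl p) = (incl p.1, p.2)
  pass_inr : ∀ b, pass (.inr b) = (new, if ε = 1 then b else !b)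
  sign_incl : ∀ v, E.sign (incl v) = D.sign v
  sign_new : E.sign new = ε
  next_pass : ∀ x, E.next (pass x) = pass (N x)
  comp_pass : ∀ x, E.comp (pass x) = C x

theorem exists_insertion (D : LinkDiagram c) (ε : ℤˣ) (N : Equiv.Perm ((Fin D.n × Bool) ⊕ Bool))
    (C : (Fin D.n × Bool) ⊕ Bool → Fin c) (hC : ∀ x y, C x = C y ↔ N.SameCycle x y) :
    ∃ E, Nonempty (Insertion D E ε N C) :=
  ⟨D.addCrossing ε N C hC, ⟨
    { incl := Fin.castSucc
      new := Fin.last D.n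
      pass := addPass D.n ε
      card_eq := rfl
      pass_inl := addPass_inl D.n ε
      pass_inr := addPass_inr D.n ε
      sign_incl := fun _ => Fin.snoc_castSucc (α := fun _ => ℤˣ) ..
      sign_new := Fin.snoc_last (α := fun _ => ℤˣ) ..
      next_pass := fun x =>
        congrArg (fun y => addPass D.n ε (N y)) ((addPass D.n ε).symm_apply_apply x)
      comp_pass := fun x => congrArg C ((addPass D.n ε).symm_apply_apply x) }⟩⟩

namespace Insertion

variable {D E : LinkDiagram c} {ε : ℤˣ} {N : Equiv.Perm ((Fin D.n × Bool) ⊕ Bool)}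
  {C : (Fin D.n × Bool) ⊕ Bool → Fin c} (I : Insertion D E ε N C)

theorem next_pow_pass (x : (Fin D.n × Bool) ⊕ Bool) (k : ℕ) :
    (E.next ^ k) (I.pass x) = I.pass ((N ^ k) x) := by
  induction k with
  | zero => rfl
  | succ k ih =>
    rw [pow_succ', Equiv.Perm.mul_apply, ih, I.next_pass, pow_succ', Equiv.Perm.mul_apply]

theorem incl_injective : Function.Injective I.incl := by
  intro v w h
  have : I.pass (.inl (v, true)) = I.pass (.inl (w, true)) := by
    rw [I.pass_inl, I.pass_inl, h]
  simpa using I.pass.injective this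

theorem incl_ne_new (v : Fin D.n) : I.incl v ≠ I.new := by
  intro h
  have : I.pass (.inl (v, if ε = 1 then true else !true)) = I.pass (.inr true) := by
    rw [I.pass_inl, I.pass_inr, h]
  simpa using I.pass.injective this

theorem eq_new_or_exists (w : Fin E.n) : w = I.new ∨ ∃ v, I.incl v = w := by
  obtain ⟨p | b, h⟩ := I.pass.surjective (w, true)
  · rw [I.pass_inl] at h
    exact .inr ⟨p.1, congrArg Prod.fst h⟩
  · rw [I.pass_inr] at h
    exact .inl (congrArg Prod.fst h).symm

/-- If the new crossing is a kink, its deletion gives back the old diagram. -/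
theorem exists_kink (h₁ : N (.inr true) = .inr false)
    (hN : ∀ p, N (.inl p) = .inl (D.next p) ∨
      N (.inl p) = .inr true ∧ N (.inr false) = .inl (D.next p))
    (hC' : ∀ p, C (.inl p) = D.comp p) :
    (∃ s, E.IsKink I.new s) ∧ IsDeletion E D {I.new} := by
  refine ⟨⟨if ε = 1 then true else false, ?_⟩, I.incl, I.incl_injective, ?_, I.sign_incl,
    fun v s => ?_, fun v s => ?_⟩
  · have := I.next_pass (.inr true)
    rw [h₁, I.pass_inr, I.pass_inr] at this
    unfold IsKink
    split_ifs at this ⊢ <;> exact this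
  · ext w
    rcases I.eq_new_or_exists w with rfl | ⟨v, rfl⟩
    · exact iff_of_false (fun ⟨v, hv⟩ => I.incl_ne_new v hv) fun h => h rfl
    · exact iff_of_true ⟨v, rfl⟩ (I.incl_ne_new v)
  · rw [← hC', ← I.comp_pass, I.pass_inl]
  · have hk (k : ℕ) : (E.next ^ k) (I.incl v, s) = I.pass ((N ^ k) (.inl (v, s))) := by
      rw [← I.next_pow_pass, I.pass_inl]
    rcases hN (v, s) with h | ⟨h, h'⟩
    · refine ⟨0, ?_, fun j hj hj' => by omega⟩
      rw [hk, zero_add, pow_one, h, I.pass_inl]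
    · refine ⟨2, ?_, fun j hj hj' => ?_⟩
      · rw [hk]
        simp only [pow_succ, pow_zero, one_mul, Equiv.Perm.mul_apply, h, h₁, h', I.pass_inl]
      · rw [hk]
        have : j = 1 ∨ j = 2 := by omega
        rcases this with rfl | rfl
        · rw [pow_one, h, I.pass_inr]
          rfl
        · rw [pow_two, Equiv.Perm.mul_apply, h, h₁, I.pass_inr]
          rfl

/-- The ends of strands at the crossings, including the new one. -/
def dart : ((Fin D.n × Bool) ⊕ Bool) × Bool ≃ E.Dart :=
  Equiv.prodCongr I.pass (Equiv.refl Bool)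

theorem rotation_inl (p : Fin D.n × Bool) (b : Bool) : E.rotation (I.dart (.inl p, b)) =
    I.dart (.inl (D.rotation (p, b)).1, (D.rotation (p, b)).2) := by
  simp [rotation, dart, I.pass_inl, I.sign_incl]

theorem rotation_inr (b b' : Bool) : E.rotation (I.dart (.inr b, b')) =
    I.dart (.inr !b, if b then b' else !b') := by
  by_cases h : ε = 1 <;> cases b <;> simp [rotation, dart, I.pass_inr, I.sign_new, h]

theorem face_out (x : (Fin D.n × Bool) ⊕ Bool) : (E.rotation * E.edgeFlip) (I.dart (x, true)) =
    E.rotation (I.dart (N x, false)) := by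
  simp [edgeFlip, dart, I.next_pass]

theorem face_in (x : (Fin D.n × Bool) ⊕ Bool) : (E.rotation * E.edgeFlip) (I.dart (N x, false)) =
    E.rotation (I.dart (x, true)) := by
  have : E.next.symm (I.pass (N x)) = I.pass x := by rw [Equiv.symm_apply_eq, I.next_pass]
  simp [edgeFlip, dart, this]

end Insertion

theorem face_in (D : LinkDiagram c) (p : Fin D.n × Bool) :
    (D.rotation * D.edgeFlip) (D.next p, false) = D.rotation (p, true) := by
  rw [Equiv.Perm.mul_apply]
  simp [edgeFlip]

/-! #### A kink on a semiarc which leaves a passage -/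

/-- The order of passages after the insertion of a kink after the passage `p`. -/
def kinkNext (D : LinkDiagram c) (p : Fin D.n × Bool) : Equiv.Perm ((Fin D.n × Bool) ⊕ Bool) :=
  Equiv.sumCongr D.next (Equiv.boolNot) * Equiv.swap (.inl p) (.inr false)

section kinkNext

variable (D : LinkDiagram c) (p : Fin D.n × Bool)

theorem kinkNext_self : D.kinkNext p (.inl p) = .inr true := by
  simp [kinkNext]

theorem kinkNext_first : D.kinkNext p (.inr true) = .inr false := by
  rw [kinkNext, Equiv.Perm.mul_apply, Equiv.swap_apply_of_ne_of_ne] <;> simp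

theorem kinkNext_second : D.kinkNext p (.inr false) = .inl (D.next p) := by
  simp [kinkNext]

theorem kinkNext_of_ne {q : Fin D.n × Bool} (h : q ≠ p) :
    D.kinkNext p (.inl q) = .inl (D.next q) := by
  rw [kinkNext, Equiv.Perm.mul_apply, Equiv.swap_apply_of_ne_of_ne] <;> simp [h]

theorem sameCycle_inr_kinkNext (b : Bool) : (D.kinkNext p).SameCycle (.inr b) (.inl p) := by
  have h : (D.kinkNext p).SameCycle (.inr true) (.inl p) := by
    rw [← kinkNext_self D p]
    exact Equiv.Perm.sameCycle_apply_left.2 (.refl _ _)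
  cases b
  · rw [← kinkNext_first D p]
    exact Equiv.Perm.sameCycle_apply_left.2 h
  · exact h

theorem sameCycle_inl_kinkNext (q : Fin D.n × Bool) :
    (D.kinkNext p).SameCycle (.inl (D.next q)) (.inl q) := by
  by_cases h : q = p
  · rw [h, ← kinkNext_second]
    exact Equiv.Perm.sameCycle_apply_left.2 (D.sameCycle_inr_kinkNext p false)
  · rw [← kinkNext_of_ne D p h]
    exact Equiv.Perm.sameCycle_apply_left.2 (.refl _ _)

end kinkNext

/-- If a function is invariant under `N`, it is constant on cycles. -/
theorem eq_of_sameCycle_of_invariant {A B : Type*} [Finite A] {N : Equiv.Perm A} {C : A → B}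
    (hC : ∀ x, C (N x) = C x) {x y : A} (h : N.SameCycle x y) : C x = C y := by
  obtain ⟨n, rfl⟩ := h.exists_nat_pow_eq
  clear h
  induction n with
  | zero => rfl
  | succ n ih => rw [pow_succ', Equiv.Perm.mul_apply, hC, ih]

theorem sameCycle_inl_of {D : LinkDiagram c} {N : Equiv.Perm ((Fin D.n × Bool) ⊕ Bool)}
    (hN : ∀ q, N.SameCycle (.inl (D.next q)) (.inl q)) {p q : Fin D.n × Bool}
    (h : D.comp p = D.comp q) : N.SameCycle (.inl p) (.inl q) := by
  obtain ⟨n, rfl⟩ := ((D.comp_eq_iff p q).1 h).exists_nat_pow_eq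
  clear h
  induction n with
  | zero => exact .refl _ _
  | succ n ih =>
    rw [pow_succ', Equiv.Perm.mul_apply]
    exact ih.trans (hN _).symm

theorem kinkNext_sameCycle_iff (D : LinkDiagram c) (p : Fin D.n × Bool)
    (x y : (Fin D.n × Bool) ⊕ Bool) :
    Sum.elim D.comp (fun _ => D.comp p) x = Sum.elim D.comp (fun _ => D.comp p) y ↔
      (D.kinkNext p).SameCycle x y := by
  have hinv : ∀ x, Sum.elim D.comp (fun _ => D.comp p) (D.kinkNext p x) =
      Sum.elim D.comp (fun _ => D.comp p) x := by
    rintro (q | _ | _)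
    · by_cases h : q = p
      · rw [h, kinkNext_self]
        rfl
      · rw [kinkNext_of_ne D p h]
        exact Deletion.comp_next D q
    · rw [kinkNext_second]
      exact Deletion.comp_next D p
    · rw [kinkNext_first]
      rfl
  have hrep : ∀ x, ∃ q, (D.kinkNext p).SameCycle x (.inl q) ∧
      Sum.elim D.comp (fun _ => D.comp p) x = D.comp q := by
    rintro (q | b)
    · exact ⟨q, .refl _ _, rfl⟩
    · exact ⟨p, D.sameCycle_inr_kinkNext p b, rfl⟩
  refine ⟨fun h => ?_, eq_of_sameCycle_of_invariant hinv⟩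
  obtain ⟨q, hq, hq'⟩ := hrep x
  obtain ⟨r, hr, hr'⟩ := hrep y
  exact (hq.trans (sameCycle_inl_of (D.sameCycle_inl_kinkNext p)
    (hq'.symm.trans (h.trans hr')))).trans hr.symm

theorem Insertion.card_face_kinkNext {D E : LinkDiagram c} {ε : ℤˣ} {p : Fin D.n × Bool}
    {C : (Fin D.n × Bool) ⊕ Bool → Fin c} (I : Insertion D E ε (D.kinkNext p) C) :
    Nat.card E.Face = Nat.card D.Face + 1 := by
  classical
  let φ := D.rotation * D.edgeFlip
  let cl : D.Dart → D.Face := fun d => Quotient.mk _ d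
  have hcl (d) : cl (φ d) = cl d :=
    Quotient.sound (Equiv.Perm.sameCycle_apply_left.2 (.refl _ _))
  -- The loop of the kink bounds a new face; the other new ends lie in the two old faces at `p`.
  let F₀ : ((Fin D.n × Bool) ⊕ Bool) × Bool → D.Face ⊕ Unit := fun x =>
    match x with
    | (.inl q, b) => .inl (cl (q, b))
    | (.inr true, true) => .inr ()
    | (.inr true, false) => .inl (cl (D.next p, false))
    | (.inr false, _) => .inl (cl (p, true))
  let φ' := E.rotation * E.edgeFlip
  have hout (x) : φ' (I.dart (x, true)) = E.rotation (I.dart (D.kinkNext p x, false)) :=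
    I.face_out x
  have hin (x) : φ' (I.dart (D.kinkNext p x, false)) = E.rotation (I.dart (x, true)) :=
    I.face_in x
  have h₁ : φ' (I.dart (.inl p, true)) = I.dart (.inr false, false) := by
    rw [hout, kinkNext_self, I.rotation_inr]
    rfl
  have h₂ (q) (hq : q ≠ p) : φ' (I.dart (.inl q, true)) =
      I.dart (.inl (φ (q, true)).1, (φ (q, true)).2) := by
    rw [hout, kinkNext_of_ne D p hq, I.rotation_inl]
    rfl
  have h₃ : φ' (I.dart (.inl (D.next p), false)) = I.dart (.inr true, false) := by
    rw [← kinkNext_second, hin, I.rotation_inr]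
    rfl
  have h₄ (q) (hq : q ≠ p) : φ' (I.dart (.inl (D.next q), false)) =
      I.dart (.inl (φ (D.next q, false)).1, (φ (D.next q, false)).2) := by
    rw [← kinkNext_of_ne D p hq, hin, I.rotation_inl, ← LinkDiagram.face_in]
  have h₅ : φ' (I.dart (.inr true, false)) =
      I.dart (.inl (φ (D.next p, false)).1, (φ (D.next p, false)).2) := by
    rw [← kinkNext_self D p, hin, I.rotation_inl, ← LinkDiagram.face_in]
  have h₆ : φ' (I.dart (.inr true, true)) = I.dart (.inr true, true) := by
    rw [hout, kinkNext_first, I.rotation_inr]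
    rfl
  have h₇ : φ' (I.dart (.inr false, false)) = I.dart (.inr false, true) := by
    rw [← kinkNext_first D p, hin, I.rotation_inr]
    rfl
  have h₈ : φ' (I.dart (.inr false, true)) =
      I.dart (.inl (φ (p, true)).1, (φ (p, true)).2) := by
    rw [hout, kinkNext_second, I.rotation_inl]
    rfl
  have step {x y} (h : φ' x = y) : φ'.SameCycle x y :=
    h ▸ Equiv.Perm.sameCycle_apply_right.2 (.refl _ _)
  have main := card_cycles_eq φ φ' (fun d => I.dart (.inl d.1, d.2))
    (fun _ : Unit => I.dart (.inr true, true)) (fun x => F₀ (I.dart.symm x))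
    (fun x => ?_) (fun a => ?_) (fun r => ?_) (fun a => ?_) fun x => ?_
  · rwa [Nat.card_unique (α := Unit)] at main
  · obtain ⟨⟨q | b, b'⟩, rfl⟩ := I.dart.surjective x
    · cases b'
      · obtain ⟨q, rfl⟩ := D.next.surjective q
        by_cases hq : q = p
        · subst hq
          rw [h₃]
          simp [F₀]
        · rw [h₄ q hq]
          simpa [F₀] using hcl _
      · by_cases hq : q = p
        · subst hq
          rw [h₁]
          simp [F₀]
        · rw [h₂ q hq]
          simpa [F₀] using hcl _
    · cases b <;> cases b'
      · rw [h₇]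
        simp [F₀]
      · rw [h₈]
        simpa [F₀] using hcl _
      · rw [h₅]
        simpa [F₀] using hcl _
      · rw [h₆]
  · simp only [Equiv.symm_apply_apply]
    rfl
  · simp [F₀]
  · obtain ⟨q, _ | _⟩ := a
    · obtain ⟨q, rfl⟩ := D.next.surjective q
      by_cases hq : q = p
      · subst hq
        exact ((step h₃).trans (step h₅)).symm
      · exact (step (h₄ q hq)).symm
    · by_cases hq : q = p
      · subst hq
        exact (((step h₁).trans (step h₇)).trans (step h₈)).symm
      · exact (step (h₂ q hq)).symm
  · obtain ⟨⟨q | b, b'⟩, rfl⟩ := I.dart.surjective x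
    · exact .inl ⟨(q, b'), .refl _ _⟩
    · cases b <;> cases b'
      · exact .inl ⟨(p, true), (step h₁).symm⟩
      · exact .inl ⟨(p, true), ((step h₁).trans (step h₇)).symm⟩
      · exact .inl ⟨(D.next p, false), (step h₃).symm⟩
      · exact .inr ⟨(), .refl _ _⟩

/-! ### Pieces of the four-valent graph after the insertion of a crossing -/

/-- If `G` follows the pieces along the new order of passages, the pieces of the new diagram are the
old pieces, together with new ones indexed by `R`. -/
theorem Insertion.card_piece {D E : LinkDiagram c} {ε : ℤˣ}
    {N : Equiv.Perm ((Fin D.n × Bool) ⊕ Bool)} {C : (Fin D.n × Bool) ⊕ Bool → Fin c}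
    (I : Insertion D E ε N C) {R : Type*} [Finite R] (ρ : R → Bool) (g : D.Piece ⊕ R)
    (hG : ∀ x, Sum.elim (fun q => .inl (Quot.mk _ q.1)) (fun _ => g) (N x) =
      (Sum.elim (fun q => .inl (Quot.mk _ q.1)) (fun _ => g) x : D.Piece ⊕ R))
    (hρ : ∀ r, g = .inr r) (hN : ∀ q, N.SameCycle (.inl (D.next q)) (.inl q))
    (hx : ∀ b, (∃ q, N.SameCycle (.inr b) (.inl q)) ∨ ∃ r, N.SameCycle (.inr b) (.inr (ρ r))) :
    Nat.card E.Piece = Nat.card D.Piece + Nat.card R := by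
  let G : (Fin D.n × Bool) ⊕ Bool → D.Piece ⊕ R :=
    Sum.elim (fun q => .inl (Quot.mk _ q.1)) fun _ => g
  let G' (w : Fin E.n) : D.Piece ⊕ R := G (I.pass.symm (w, true))
  have hG' (x) : G' (I.pass x).1 = G x := by
    rcases x with q | b
    · have : I.pass.symm ((I.pass (.inl q)).1, true) = .inl (q.1, true) := by
        rw [Equiv.symm_apply_eq, I.pass_inl, I.pass_inl]
      simp only [G', this]
      rfl
    · obtain ⟨b', hb'⟩ : ∃ b', I.pass (.inr b') = (I.new, true) := by
        by_cases h : ε = 1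
        · exact ⟨true, by rw [I.pass_inr, if_pos h]⟩
        · exact ⟨false, by rw [I.pass_inr, if_neg h]; rfl⟩
      have : I.pass.symm ((I.pass (.inr b)).1, true) = .inr b' := by
        rw [Equiv.symm_apply_eq, hb', I.pass_inr]
      simp only [G', this]
      rfl
  let m (x : (Fin D.n × Bool) ⊕ Bool) : E.Piece := Quot.mk _ (I.pass x).1
  have hm (x) : m (N x) = m x := (Quot.sound ⟨_, _, I.next_pass x⟩).symm
  have hmc {x y} (h : N.SameCycle x y) : m x = m y := eq_of_sameCycle_of_invariant hm h
  have hGc {x y} (h : N.SameCycle x y) : G x = G y := eq_of_sameCycle_of_invariant hG h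
  have hmv (v s t) : m (.inl (v, s)) = m (.inl (v, t)) := by
    simp only [m, I.pass_inl]
  let j : D.Piece → E.Piece := Quot.lift (fun v => m (.inl (v, true))) fun v w ⟨s, t, h⟩ => by
    rw [hmv v true s, hmv w true t, ← h]
    exact (hmc (hN (v, s))).symm
  have hj (q : Fin D.n × Bool) : m (.inl q) = j (Quot.mk _ q.1) := hmv q.1 q.2 true
  rw [← Nat.card_sum]
  refine Nat.card_eq_of_bijective (Quot.lift G' ?_) ⟨?_, ?_⟩
  · rintro v w ⟨s, t, h⟩
    obtain ⟨x, hx⟩ := I.pass.surjective (v, s)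
    rw [← hx, I.next_pass] at h
    have h₁ := hG' x
    have h₂ := hG' (N x)
    rw [hx] at h₁
    rw [h] at h₂
    exact h₁.trans ((hG x).symm.trans h₂.symm)
  · have key : ∀ x, (∃ q : Fin D.n × Bool, G x = .inl (Quot.mk _ q.1) ∧
        m x = j (Quot.mk _ q.1)) ∨ ∃ r, G x = .inr r ∧ m x = m (.inr (ρ r)) := by
      rintro (q | b)
      · exact .inl ⟨q, rfl, hj q⟩
      · rcases hx b with ⟨q, hq⟩ | ⟨r, hr⟩
        · exact .inl ⟨q, hGc hq, (hmc hq).trans (hj q)⟩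
        · exact .inr ⟨r, hρ r, hmc hr⟩
    rintro ⟨v⟩ ⟨w⟩ (h : G' v = G' w)
    obtain ⟨x, hx⟩ := I.pass.surjective (v, true)
    obtain ⟨y, hy⟩ := I.pass.surjective (w, true)
    have hv : v = (I.pass x).1 := by rw [hx]
    have hw : w = (I.pass y).1 := by rw [hy]
    rw [hv, hw, hG', hG'] at h
    rw [hv, hw]
    change m x = m y
    rcases key x with ⟨q, h₁, h₂⟩ | ⟨r, h₁, h₂⟩ <;>
      rcases key y with ⟨q', h₃, h₄⟩ | ⟨r', h₃, h₄⟩ <;>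
      rw [h₁, h₃] at h
    · rw [h₂, h₄, Sum.inl.inj h]
    · cases h
    · cases h
    · rw [h₂, h₄, Sum.inr.inj h]
  · rintro (⟨⟨v⟩⟩ | r)
    · exact ⟨Quot.mk _ (I.pass (.inl (v, true))).1, hG' _⟩
    · exact ⟨Quot.mk _ (I.pass (.inr (ρ r))).1, (hG' _).trans (hρ r)⟩

theorem Insertion.card_piece_kinkNext {D E : LinkDiagram c} {ε : ℤˣ} {p : Fin D.n × Bool}
    {C : (Fin D.n × Bool) ⊕ Bool → Fin c} (I : Insertion D E ε (D.kinkNext p) C) :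
    Nat.card E.Piece = Nat.card D.Piece := by
  have hp (q : Fin D.n × Bool) : (Quot.mk _ (D.next q).1 : D.Piece) = Quot.mk _ q.1 :=
    (Quot.sound ⟨_, _, rfl⟩).symm
  have := I.card_piece (R := Empty) Empty.elim (.inl (Quot.mk _ p.1)) ?_ (fun r => r.elim)
    (D.sameCycle_inl_kinkNext p) fun b => .inl ⟨p, D.sameCycle_inr_kinkNext p b⟩
  · simpa using this
  · rintro (q | _ | _)
    · by_cases h : q = p
      · rw [h, kinkNext_self]
        rfl
      · rw [kinkNext_of_ne D p h]
        exact congrArg Sum.inl (hp q)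
    · rw [kinkNext_second]
      exact congrArg Sum.inl (hp p)
    · rw [kinkNext_first]
      rfl

/-- A kink of either sign can be inserted on a semiarc which leaves a passage. -/
theorem exists_kink_of_pass (D : LinkDiagram c) (p : Fin D.n × Bool) (ε : ℤˣ) :
    ∃ (E : LinkDiagram c) (a : Fin E.n) (s : Bool), E.IsKink a s ∧ IsDeletion E D {a} ∧
      E.comp (a, s) = D.comp p ∧ E.sign a = ε ∧ (D.IsPlanar → E.IsPlanar) := by
  obtain ⟨E, ⟨I⟩⟩ := D.exists_insertion ε (D.kinkNext p) _ (D.kinkNext_sameCycle_iff p)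
  have hN (q) : D.kinkNext p (.inl q) = .inl (D.next q) ∨
      D.kinkNext p (.inl q) = .inr true ∧ D.kinkNext p (.inr false) = .inl (D.next q) := by
    by_cases h : q = p
    · exact .inr ⟨by rw [h, kinkNext_self], by rw [h, kinkNext_second]⟩
    · exact .inl (kinkNext_of_ne D p h)
  obtain ⟨⟨s, hs⟩, hdel⟩ := I.exists_kink (D.kinkNext_first p) hN fun _ => rfl
  refine ⟨E, I.new, s, hs, hdel, ?_, I.sign_new, fun hD => ?_⟩
  · rw [← hs.comp_eq (if ε = 1 then true else !true), ← I.pass_inr, I.comp_pass]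
    rfl
  · unfold IsPlanar at hD ⊢
    rw [I.card_face_kinkNext, I.card_piece_kinkNext, I.card_eq, hD]
    ring

/-! #### A kink on a circle without crossings -/

/-- The order of passages after the insertion of a kink on a circle without crossings. -/
def circleNext (D : LinkDiagram c) : Equiv.Perm ((Fin D.n × Bool) ⊕ Bool) :=
  Equiv.sumCongr D.next Equiv.boolNot

theorem circleNext_inl (D : LinkDiagram c) (q : Fin D.n × Bool) :
    D.circleNext (.inl q) = .inl (D.next q) := rfl

theorem circleNext_inr (D : LinkDiagram c) (b : Bool) : D.circleNext (.inr b) = .inr !b := rfl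

theorem sameCycle_inl_circleNext (D : LinkDiagram c) (q : Fin D.n × Bool) :
    D.circleNext.SameCycle (.inl (D.next q)) (.inl q) :=
  Equiv.Perm.sameCycle_apply_left.2 (.refl D.circleNext (.inl q))

theorem sameCycle_inr_circleNext (D : LinkDiagram c) (b b' : Bool) :
    D.circleNext.SameCycle (.inr b) (.inr b') := by
  rcases Bool.eq_or_eq_not b b' with rfl | rfl
  · exact .refl _ _
  · exact Equiv.Perm.sameCycle_apply_left.2 (.refl D.circleNext (.inr b'))

theorem circleNext_sameCycle_iff (D : LinkDiagram c) {k : Fin c} (hk : ∀ p, D.comp p ≠ k)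
    (x y : (Fin D.n × Bool) ⊕ Bool) :
    Sum.elim D.comp (fun _ => k) x = Sum.elim D.comp (fun _ => k) y ↔
      D.circleNext.SameCycle x y := by
  refine ⟨fun h => ?_, eq_of_sameCycle_of_invariant ?_⟩
  · rcases x with p | b <;> rcases y with q | b'
    · exact sameCycle_inl_of D.sameCycle_inl_circleNext h
    · exact absurd h (hk p)
    · exact absurd h.symm (hk q)
    · exact D.sameCycle_inr_circleNext b b'
  · rintro (q | b)
    · exact Deletion.comp_next D q
    · rfl

theorem Insertion.card_face_circleNext {D E : LinkDiagram c} {ε : ℤˣ}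
    {C : (Fin D.n × Bool) ⊕ Bool → Fin c} (I : Insertion D E ε D.circleNext C) :
    Nat.card E.Face = Nat.card D.Face + 3 := by
  let φ := D.rotation * D.edgeFlip
  let cl : D.Dart → D.Face := fun d => Quotient.mk _ d
  have hcl (d) : cl (φ d) = cl d :=
    Quotient.sound (Equiv.Perm.sameCycle_apply_left.2 (.refl _ _))
  -- The ends at the first passage bound one loop each, the others bound the outside of both loops.
  let F₀ : ((Fin D.n × Bool) ⊕ Bool) × Bool → D.Face ⊕ Option Bool := fun x =>
    match x with
    | (.inl q, b) => .inl (cl (q, b))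
    | (.inr true, b) => .inr (some b)
    | (.inr false, _) => .inr none
  let φ' := E.rotation * E.edgeFlip
  have h₁ (q) : φ' (I.dart (.inl q, true)) =
      I.dart (.inl (φ (q, true)).1, (φ (q, true)).2) := by
    rw [I.face_out, circleNext_inl, I.rotation_inl]
    rfl
  have h₂ (q) : φ' (I.dart (.inl (D.next q), false)) =
      I.dart (.inl (φ (D.next q, false)).1, (φ (D.next q, false)).2) := by
    rw [← circleNext_inl, I.face_in, I.rotation_inl, ← LinkDiagram.face_in]
  have h₃ (b) : φ' (I.dart (.inr true, b)) = I.dart (.inr true, b) := by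
    cases b
    · rw [← show D.circleNext (.inr false) = .inr true from rfl, I.face_in, I.rotation_inr]
      rfl
    · rw [I.face_out, circleNext_inr, I.rotation_inr]
      rfl
  have h₄ (b) : φ' (I.dart (.inr false, b)) = I.dart (.inr false, !b) := by
    cases b
    · rw [← show D.circleNext (.inr true) = .inr false from rfl, I.face_in, I.rotation_inr]
      rfl
    · rw [I.face_out, circleNext_inr, I.rotation_inr]
      rfl
  have step {x y} (h : φ' x = y) : φ'.SameCycle x y :=
    h ▸ Equiv.Perm.sameCycle_apply_right.2 (.refl _ _)
  have main := card_cycles_eq φ φ' (fun d => I.dart (.inl d.1, d.2))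
    (fun r : Option Bool => I.dart (r.elim (.inr false, true) fun b => (.inr true, b)))
    (fun x => F₀ (I.dart.symm x)) (fun x => ?_) (fun a => ?_) (fun r => ?_) (fun a => ?_)
    fun x => ?_
  · simpa using main
  · obtain ⟨⟨q | b, b'⟩, rfl⟩ := I.dart.surjective x
    · cases b'
      · obtain ⟨q, rfl⟩ := D.next.surjective q
        rw [h₂]
        simpa [F₀] using hcl _
      · rw [h₁]
        simpa [F₀] using hcl _
    · cases b
      · rw [h₄]
        simp [F₀]
      · rw [h₃]
  · simp only [Equiv.symm_apply_apply]
    rfl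
  · rcases r with _ | b <;> simp [F₀]
  · obtain ⟨q, _ | _⟩ := a
    · obtain ⟨q, rfl⟩ := D.next.surjective q
      exact (step (h₂ q)).symm
    · exact (step (h₁ q)).symm
  · obtain ⟨⟨q | b, b'⟩, rfl⟩ := I.dart.surjective x
    · exact .inl ⟨(q, b'), .refl _ _⟩
    · cases b
      · cases b'
        · exact .inr ⟨none, step (h₄ false)⟩
        · exact .inr ⟨none, .refl _ _⟩
      · exact .inr ⟨some b', .refl _ _⟩

theorem Insertion.card_piece_circleNext {D E : LinkDiagram c} {ε : ℤˣ}
    {C : (Fin D.n × Bool) ⊕ Bool → Fin c} (I : Insertion D E ε D.circleNext C) :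
    Nat.card E.Piece = Nat.card D.Piece + 1 := by
  have := I.card_piece (R := Unit) (fun _ => true) (.inr ()) ?_ (fun _ => rfl)
    D.sameCycle_inl_circleNext fun b => .inr ⟨(), D.sameCycle_inr_circleNext b true⟩
  · rwa [Nat.card_unique (α := Unit)] at this
  · rintro (q | b)
    · exact congrArg Sum.inl (Quot.sound ⟨_, _, rfl⟩ : (Quot.mk _ q.1 : D.Piece) = _).symm
    · rfl

/-- A kink of either sign can be inserted on a circle without crossings. -/
theorem exists_kink_of_forall_ne (D : LinkDiagram c) {k : Fin c} (hk : ∀ p, D.comp p ≠ k)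
    (ε : ℤˣ) :
    ∃ (E : LinkDiagram c) (a : Fin E.n) (s : Bool), E.IsKink a s ∧ IsDeletion E D {a} ∧
      E.comp (a, s) = k ∧ E.sign a = ε ∧ (D.IsPlanar → E.IsPlanar) := by
  obtain ⟨E, ⟨I⟩⟩ := D.exists_insertion ε D.circleNext _ (D.circleNext_sameCycle_iff hk)
  obtain ⟨⟨s, hs⟩, hdel⟩ := I.exists_kink rfl (fun q => .inl rfl) fun _ => rfl
  refine ⟨E, I.new, s, hs, hdel, ?_, I.sign_new, fun hD => ?_⟩
  · rw [← hs.comp_eq (if ε = 1 then true else !true), ← I.pass_inr, I.comp_pass]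
    rfl
  · unfold IsPlanar at hD ⊢
    rw [I.card_face_circleNext, I.card_piece_circleNext, I.card_eq, hD]
    ring

/-- A kink of either sign can be inserted on every component. -/
theorem exists_kink (D : LinkDiagram c) (k : Fin c) (ε : ℤˣ) :
    ∃ (E : LinkDiagram c) (a : Fin E.n) (s : Bool), E.IsKink a s ∧ IsDeletion E D {a} ∧
      E.comp (a, s) = k ∧ E.sign a = ε ∧ (D.IsPlanar → E.IsPlanar) := by
  by_cases hk : ∀ p, D.comp p ≠ k
  · exact D.exists_kink_of_forall_ne hk ε
  · push Not at hk
    obtain ⟨p, rfl⟩ := hk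
    exact D.exists_kink_of_pass p ε

end LinkDiagram

section

open LinkDiagram

variable {𝓚 : Kind} {c : ℕ}

/-- Inserting a kink changes the writhe of one component by its sign. -/
theorem exists_link_eq_writhe_add (D : Diagram 𝓚 c) (k : Fin c) (ε : ℤˣ) :
    ∃ E : Diagram 𝓚 c, E.link = D.link ∧ E.1.writhe = D.1.writhe + Pi.single k (ε : ℤ) := by
  obtain ⟨E, a, s, ha, hdel, hk, hε, hE⟩ := D.1.exists_kink k ε
  have hE' : 𝓚.Allows E := by
    cases 𝓚
    · exact hE D.2
    · trivial
  refine ⟨⟨E, hE'⟩, Quot.sound (.inr (.inl ⟨a, s, ha, hdel⟩)), funext fun i => ?_⟩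
  obtain ⟨δ⟩ := hdel.exists_deletion
  rw [writhe_of_deletion δ {a} (by simp) i, Pi.add_apply]
  simp [ha.comp_eq ovr, ha.comp_eq und, hk, hε, Pi.single_apply, eq_comm]

/-- Kinks change the writhe of each component by arbitrary amounts. -/
theorem exists_writhe_eq (L : Link 𝓚 c) (w : Fin c → ℤ) :
    ∃ D : Diagram 𝓚 c, D.link = L ∧ D.1.writhe = w := by
  obtain ⟨D, rfl⟩ := Quot.exists_rep L
  let H : AddSubgroup (Fin c → ℤ) := AddSubgroup.closure {x | ∃ k, x = Pi.single k 1}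
  have hH (x) (hx : x ∈ H) : ∀ D : Diagram 𝓚 c, ∃ E : Diagram 𝓚 c, E.link = D.link ∧
      E.1.writhe = D.1.writhe + x := by
    have hneg (k : Fin c) : -(Pi.single k 1 : Fin c → ℤ) = Pi.single k ((-1 : ℤˣ) : ℤ) := by
      simp [Pi.single_neg]
    induction hx using AddSubgroup.closure_induction'' with
    | mem x hx =>
      obtain ⟨k, rfl⟩ := hx
      exact fun D => exists_link_eq_writhe_add D k 1
    | neg_mem x hx =>
      obtain ⟨k, rfl⟩ := hx
      intro D
      rw [hneg]
      exact exists_link_eq_writhe_add D k (-1)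
    | zero => exact fun D => ⟨D, rfl, (add_zero _).symm⟩
    | add x y _ _ ihx ihy =>
      intro D
      obtain ⟨E, h₁, h₂⟩ := ihx D
      obtain ⟨E', h₃, h₄⟩ := ihy E
      exact ⟨E', h₃.trans h₁, by rw [h₄, h₂, add_assoc]⟩
  have htop (x : Fin c → ℤ) : x ∈ H := by
    rw [pi_eq_sum_univ x]
    refine sum_mem fun k _ => zsmul_mem (AddSubgroup.subset_closure ?_) (x k)
    refine ⟨k, funext fun i => ?_⟩
    simp [Pi.single_apply, eq_comm]
  obtain ⟨E, h₁, h₂⟩ := hH _ (htop (w - D.1.writhe)) D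
  exact ⟨E, h₁, by rw [h₂, add_sub_cancel]⟩

end

open LinkDiagram

/-! ### Reordering the components -/

namespace LinkDiagram

variable {c : ℕ} (σ : Equiv.Perm (Fin c))

theorem isDeletion_relabel {E D : LinkDiagram c} {K : Set (Fin E.n)} (h : IsDeletion E D K) :
    IsDeletion (E.relabel σ) (D.relabel σ) K := by
  obtain ⟨i, h₁, h₂, h₃, h₄, h₅⟩ := h
  exact ⟨i, h₁, h₂, h₃, fun v s => congrArg σ (h₄ v s), h₅⟩

theorem Move.relabel {E D : LinkDiagram c} (h : Move E D) :
    Move (E.relabel σ) (D.relabel σ) := by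
  rcases h with h | ⟨a, s, ha, h⟩ | ⟨a, b, hab, hs, h₁, h₂, h⟩ |
    ⟨a, b, d, κ, e, hab, had, hbd, h₁, h₂, h₃, h₄, h₅, h₆⟩
  · exact .inl (isDeletion_relabel σ h)
  · exact .inr (.inl ⟨a, s, ha, isDeletion_relabel σ h⟩)
  · exact .inr (.inr (.inl ⟨a, b, hab, hs, h₁, h₂, isDeletion_relabel σ h⟩))
  · exact .inr (.inr (.inr ⟨a, b, d, κ, e, hab, had, hbd, h₁, h₂, h₃, h₄,
      fun v s => congrArg σ (h₅ v s), h₆⟩))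

theorem writhe_relabel (D : LinkDiagram c) (k : Fin c) :
    (D.relabel σ).writhe k = D.writhe (σ.symm k) := by
  simp only [writhe, Equiv.eq_symm_apply]
  rfl

/-- Reordering the components does not affect labelings. -/
theorem labelEquiv_relabel {X : Type u} (𝓑 : Birack X) (D : LinkDiagram c) :
    LabelEquiv 𝓑 (D.twisted 𝓑 fun _ => 0) ((D.relabel σ).twisted 𝓑 fun _ => 0) := by
  let e : D.Semiarc ≃ (D.relabel σ).Semiarc := Equiv.sumCongr (Equiv.refl _)
    (σ.subtypeEquiv fun k => forall_congr' fun p => σ.injective.ne_iff.symm)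
  refine ⟨(Equiv.arrowCongr e (Equiv.refl X)).subtypeEquiv fun ℓ => ?_, fun Y _ ℓ =>
    ⟨fun h a => h _, fun h a => ?_⟩⟩
  · rw [mem_twisted_zero, mem_twisted_zero]
    refine forall_congr' fun v => ?_
    by_cases h : D.sign v = 1
    · simp only [source, target, relabel, h, if_true]
      rfl
    · simp only [source, target, relabel, h, if_false]
      rfl
  · simpa using h (e a)

end LinkDiagram

variable {𝓚 : Kind} {c : ℕ}

/-- Reordering the components of an allowed diagram. -/
def Diagram.relabel (D : Diagram 𝓚 c) (σ : Equiv.Perm (Fin c)) : Diagram 𝓚 c :=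
  ⟨D.1.relabel σ, by
    have h := D.2
    cases 𝓚
    · exact h
    · trivial⟩

theorem Diagram.link_relabel_eq {E D : Diagram 𝓚 c} (h : E.link = D.link)
    (σ : Equiv.Perm (Fin c)) : (E.relabel σ).link = (D.relabel σ).link := by
  have := Quot.eqvGen_exact h
  clear h
  induction this with
  | rel E D h => exact Quot.sound (h.relabel σ)
  | refl D => rfl
  | symm _ _ _ ih => exact ih.symm
  | trans _ _ _ _ _ ih₁ ih₂ => exact ih₁.trans ih₂

/-! ### The counting invariants -/

/-- Integral lifts of the residues are realized as writhes. -/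
theorem exists_isPeriodOf (N : ℕ) (L : Link 𝓚 c) : ∃ 𝓓, IsPeriodOf N L 𝓓 := by
  have h (w : Fin c → ZMod N) : ∃ D : Diagram 𝓚 c,
      D.link = L ∧ ∀ k, (D.1.writhe k : ZMod N) = w k := by
    obtain ⟨D, hD, hw⟩ := exists_writhe_eq L fun k => (w k).cast
    exact ⟨D, hD, fun k => by rw [hw, ZMod.intCast_zmod_cast]⟩
  choose 𝓓 h𝓓 using h
  exact ⟨𝓓, h𝓓⟩

variable {X : Type u} (𝓑 : Birack X)

/-- The homomorphisms from two fundamental biracks correspond to each other, with the same images.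
-/
def SameHoms (E D : LinkDiagram c) : Prop :=
  ∃ e : E.HomTo 𝓑 ≃ D.HomTo 𝓑, ∀ f, (e f).image = f.image

variable {𝓑}

theorem SameHoms.symm {E D : LinkDiagram c} (h : SameHoms 𝓑 E D) : SameHoms 𝓑 D E := by
  obtain ⟨e, he⟩ := h
  exact ⟨e.symm, fun f => by rw [← he, Equiv.apply_symm_apply]⟩

theorem SameHoms.trans {E D C : LinkDiagram c} (h : SameHoms 𝓑 E D) (h' : SameHoms 𝓑 D C) :
    SameHoms 𝓑 E C := by
  obtain ⟨e, he⟩ := h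
  obtain ⟨e', he'⟩ := h'
  exact ⟨e.trans e', fun f => (he' _).trans (he f)⟩

theorem sameHoms_relabel [Finite X] (σ : Equiv.Perm (Fin c)) (D : LinkDiagram c) :
    SameHoms 𝓑 D (D.relabel σ) :=
  (labelEquiv_relabel σ 𝓑 D).exists_hom_equiv

theorem SameHoms.card_eq {E D : LinkDiagram c} (h : SameHoms 𝓑 E D) :
    Nat.card (E.HomTo 𝓑) = Nat.card (D.HomTo 𝓑) := by
  obtain ⟨e, -⟩ := h
  exact Nat.card_congr e

theorem SameHoms.map_eq [Finite X] {E D : LinkDiagram c} (h : SameHoms 𝓑 E D) {β : Type*}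
    (g : Set X → β) :
    ((Finset.univ : Finset (E.HomTo 𝓑)).val.map fun f => g f.image) =
      (Finset.univ : Finset (D.HomTo 𝓑)).val.map fun f => g f.image := by
  obtain ⟨e, he⟩ := h
  rw [← Multiset.map_univ_val_equiv e, Multiset.map_map]
  simp only [Function.comp_def, he]

theorem SameHoms.sum_eq [Finite X] {E D : LinkDiagram c} (h : SameHoms 𝓑 E D) {β : Type*}
    [AddCommMonoid β] (g : Set X → β) : ∑ f : E.HomTo 𝓑, g f.image = ∑ f : D.HomTo 𝓑, g f.image :=
  congrArg Multiset.sum (h.map_eq g)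

theorem IsPeriodOf.sameHoms [Finite X] {L : Link 𝓚 c} {𝓓 𝓓' : (Fin c → ZMod 𝓑.rank) → Diagram 𝓚 c}
    (h : IsPeriodOf 𝓑.rank L 𝓓) (h' : IsPeriodOf 𝓑.rank L 𝓓') (w : Fin c → ZMod 𝓑.rank) :
    SameHoms 𝓑 (𝓓 w).1 (𝓓' w).1 :=
  ((sameTwisted_of_link_eq 𝓑 ((h w).1.trans (h' w).1.symm)).labelEquiv fun k =>
    (ZMod.intCast_eq_intCast_iff _ _ _).1 (((h w).2 k).trans ((h' w).2 k).symm)).exists_hom_equiv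

/-- Reordering the components of a period of framings. -/
theorem IsPeriodOf.relabel {N : ℕ} {D : Diagram 𝓚 c} {𝓓 : (Fin c → ZMod N) → Diagram 𝓚 c}
    (h : IsPeriodOf N D.link 𝓓) (σ : Equiv.Perm (Fin c)) :
    IsPeriodOf N (D.relabel σ).link fun w => (𝓓 (w ∘ σ)).relabel σ := by
  refine fun w => ⟨Diagram.link_relabel_eq (h _).1 σ, fun k => ?_⟩
  have := (h (w ∘ σ)).2 (σ.symm k)
  rw [Function.comp_apply, Equiv.apply_symm_apply] at this
  rw [← this]
  exact congrArg Int.cast (writhe_relabel σ _ k)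

/-- The counting invariants only depend on the homomorphisms and their images for each residue
vector, and a permutation of the components permutes the residue vectors. -/
theorem invariants_relabel [Finite X] {𝓓 𝓓' : (Fin c → ZMod 𝓑.rank) → Diagram 𝓚 c}
    {σ : Equiv.Perm (Fin c)} (h : ∀ w, SameHoms 𝓑 (𝓓' w).1 (𝓓 (w ∘ σ)).1) :
    integralInvariant 𝓑 𝓓' = integralInvariant 𝓑 𝓓 ∧
    writheMultiset 𝓑 𝓓' = (writheMultiset 𝓑 𝓓).map (fun t => (t.1, t.2 ∘ σ.symm)) ∧
    writhePolynomial 𝓑 𝓓' = MvPolynomial.rename σ (writhePolynomial 𝓑 𝓓) ∧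
    imageMultiset 𝓑 𝓓' = imageMultiset 𝓑 𝓓 ∧
    imagePolynomial 𝓑 𝓓' = imagePolynomial 𝓑 𝓓 ∧
    ∀ 𝓒, birackPolynomialMultiset 𝓑 𝓒 𝓓' = birackPolynomialMultiset 𝓑 𝓒 𝓓 ∧
      birackPolynomialInvariant 𝓑 𝓒 𝓓' = birackPolynomialInvariant 𝓑 𝓒 𝓓 := by
  let τ : Equiv.Perm (Fin c → ZMod 𝓑.rank) := Equiv.arrowCongr σ.symm (Equiv.refl _)
  have hτ (w) : τ w = w ∘ σ := rfl
  have key {β : Type _} [AddCommMonoid β] {F G : (Fin c → ZMod 𝓑.rank) → β}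
      (hFG : ∀ w, G w = F (w ∘ σ)) : ∑ w, G w = ∑ w, F w :=
    (Finset.sum_congr rfl fun w _ => hFG w).trans (Equiv.sum_comp τ F)
  refine ⟨key fun w => (h w).card_eq, ?_, ?_, key fun w => (h w).map_eq fun Y => Nat.card Y,
    key fun w => (h w).sum_eq fun Y => Polynomial.X ^ Nat.card Y, fun 𝓒 =>
    ⟨key fun w => (h w).map_eq (subbirackPolynomial 𝓑 𝓒),
      key fun w => (h w).sum_eq fun Y => AddMonoidAlgebra.single (subbirackPolynomial 𝓑 𝓒 Y) 1⟩⟩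
  · rw [writheMultiset, writheMultiset, Multiset.map_map]
    conv_rhs => rw [← Multiset.map_univ_val_equiv τ, Multiset.map_map]
    refine Multiset.map_congr rfl fun w _ => Prod.ext (h w).card_eq ?_
    simp [hτ, Function.comp_assoc]
  · rw [writhePolynomial, writhePolynomial, map_sum]
    refine key fun w => ?_
    rw [(h w).card_eq, map_mul, map_natCast, map_prod, ← Equiv.prod_comp σ]
    simp

end BirackLinks

theorem mainTheorem1 {X : Type u} (𝓑 : Birack X) (𝓚 : Kind) (c : ℕ) :
    -- homomorphisms from the fundamental birack are the same as labelings
    (∀ D : Diagram 𝓚 c, Function.Bijective (D.1.labelingOfHom 𝓑)) ∧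
    -- labelings are invariant under blackboard-framed isotopy
    (∀ D D' : Diagram 𝓚 c, D.framedLink = D'.framedLink →
      Nonempty (D.1.Labeling 𝓑 ≃ D'.1.Labeling 𝓑)) ∧
    -- labelings are periodic in the writhe of each component
    (∀ D D' : Diagram 𝓚 c, D.link = D'.link →
      (∀ k, D.1.writhe k ≡ D'.1.writhe k [ZMOD 𝓑.rank]) →
      Nonempty (D.1.Labeling 𝓑 ≃ D'.1.Labeling 𝓑)) ∧
    -- every link has diagrams with any given writhe vector
    (∀ (L : Link 𝓚 c) (w : Fin c → ℤ), ∃ D : Diagram 𝓚 c, D.link = L ∧ D.1.writhe = w) ∧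
    -- for a finite birack the counting invariants depend on the link only
    ∀ [Finite X],
      (∀ L : Link 𝓚 c, ∃ 𝓓, IsPeriodOf 𝓑.rank L 𝓓) ∧
      ∃ (φZ : Link 𝓚 c → ℕ)
        (φWM : Link 𝓚 c → Multiset (ℕ × (Fin c → ZMod 𝓑.rank)))
        (φW : Link 𝓚 c → MvPolynomial (Fin c) ℤ)
        (φIM : Link 𝓚 c → Multiset ℕ)
        (φI : Link 𝓚 c → Polynomial ℤ)
        (φρM : CountConvention → Link 𝓚 c → Multiset (MvPolynomial (Fin 4) ℤ))
        (φρ : CountConvention → Link 𝓚 c → AddMonoidAlgebra ℤ (MvPolynomial (Fin 4) ℤ)),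
        (∀ L 𝓓, IsPeriodOf 𝓑.rank L 𝓓 →
          integralInvariant 𝓑 𝓓 = φZ L ∧
          writheMultiset 𝓑 𝓓 = φWM L ∧
          writhePolynomial 𝓑 𝓓 = φW L ∧
          imageMultiset 𝓑 𝓓 = φIM L ∧
          imagePolynomial 𝓑 𝓓 = φI L ∧
          ∀ 𝓒, birackPolynomialMultiset 𝓑 𝓒 𝓓 = φρM 𝓒 L ∧
            birackPolynomialInvariant 𝓑 𝓒 𝓓 = φρ 𝓒 L) ∧
        -- the effect of reordering the components
        ∀ (σ : Equiv.Perm (Fin c)) (D D' : Diagram 𝓚 c), D'.1 = D.1.relabel σ →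
          φZ D'.link = φZ D.link ∧
          φWM D'.link = (φWM D.link).map (fun t => (t.1, t.2 ∘ σ.symm)) ∧
          φW D'.link = MvPolynomial.rename σ (φW D.link) ∧
          φIM D'.link = φIM D.link ∧
          φI D'.link = φI D.link ∧
          ∀ 𝓒, φρM 𝓒 D'.link = φρM 𝓒 D.link ∧ φρ 𝓒 D'.link = φρ 𝓒 D.link := by
  refine ⟨fun D => D.1.labelingOfHom_bijective 𝓑, fun D D' h => ?_, fun D D' h hw => ?_,
    exists_writhe_eq, fun {_} => ⟨exists_isPeriodOf 𝓑.rank, ?_⟩⟩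
  · obtain ⟨h₁, h₂⟩ := sameTwisted_of_framedLink_eq 𝓑 h
    exact (h₁.labelEquiv fun k => by rw [h₂]).nonempty_labeling_equiv
  · exact ((sameTwisted_of_link_eq 𝓑 h).labelEquiv hw).nonempty_labeling_equiv
  choose 𝓓 h𝓓 using exists_isPeriodOf (𝓚 := 𝓚) (c := c) 𝓑.rank
  refine ⟨fun L => integralInvariant 𝓑 (𝓓 L), fun L => writheMultiset 𝓑 (𝓓 L),
    fun L => writhePolynomial 𝓑 (𝓓 L), fun L => imageMultiset 𝓑 (𝓓 L),
    fun L => imagePolynomial 𝓑 (𝓓 L), fun 𝓒 L => birackPolynomialMultiset 𝓑 𝓒 (𝓓 L),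
    fun 𝓒 L => birackPolynomialInvariant 𝓑 𝓒 (𝓓 L), fun L 𝓓' h => ?_, fun σ D D' h => ?_⟩
  -- Two periods of the same link: the case of the trivial permutation.
  · have := invariants_relabel (σ := 1) fun w => h.sameHoms (h𝓓 L) w
    simpa [← Equiv.Perm.inv_def, MvPolynomial.rename_id_apply] using this
  · obtain rfl : D' = D.relabel σ := Subtype.ext h
    exact invariants_relabel fun w => ((h𝓓 _).sameHoms ((h𝓓 D.link).relabel σ) w).trans
      (sameHoms_relabel σ (𝓓 D.link (w ∘ σ)).1).symm
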